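/- Let $k$ be a field of characteristic different from $2$ with algebraic closure $\bar k$, and let $C, C' \subset \mathbb{P}^2$ be two (reduced) projective plane curves over $k$ with no components in common. Let $\tilde C$ be the normalisation of $C$. For $S \in C(\bar k)$, let $m_S$ be the multiplicity of $S$ on $C$ and let $\mu_S(C,C')$ be the intersection multiplicity of $C$ and $C'$ at $S$, that is, the length of $\mathcal{O}_{S,C_{\bar k}}/(h)$, where $h$ is a local equation of $C'$ at $S$. For $T \in \tilde C(\bar k)$, let $\mu_T(\tilde C, C')$ be the length of $\mathcal{O}_{T,\tilde C_{\bar k}}/(h)$, where $h$ is a local equation of $C'$ at the image of $T$ in $\mathbb{P}^2$. Set $$b(C,C') = \{S \in C(\bar k) : \mu_S(C,C') \text{ is odd}\}, \qquad b(\tilde C,C') = \{T \in \tilde C(\bar k) : \mu_T(\tilde C,C') \text{ is odd}\}.$$ Let $C^s \subset C(\bar k)$ be the set of singular points of $C_{\bar k}$. Assume that $C'$ is smooth over $k$ and that every $S \in C^s$ that lies on $C'$ is an ordinary singularity, that is, $C_{\bar k}$ has $m_S$ distinct tangent lines at $S$. Then $C(\bar k) \cap C'(\bar k)$ and $b(\tilde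 C,C')$ are finite, and $$\#b(\tilde C, C') = \sum_{S \in C(\bar k)\cap C'(\bar k)} c_S(C,C'), \qquad c_S(C,C') = \begin{cases} m_S & \text{if } m_S \equiv \mu_S(C,C') \pmod 2,\\ m_S - 1 & \text{if } m_S \not\equiv \mu_S(C,C') \pmod 2.\end{cases}$$ If moreover $C$ and $C'$ are geometrically integral, then the following statements hold. 1. The set $b(\tilde C,C')$ is empty if and only if both $b(C,C')$ and $C^s \cap C'$ are empty. 2. We have $\#b(\tilde C,C') = 2$ if and only if either (a) $b(C,C') = \emptyset$ and there exists a point $S \in C(\bar k)$ such that $m_S \in \{2,3\}$ and $C^s \cap C' = \{S\}$, or (b) there exist two points $S_1, S_2 \in C(\bar k)$ with $S_1 \neq S_2$, $b(C,C') = \{S_1,S_2\}$, $m_{S_1}, m_{S_2} \in \{1,2\}$ and $C^s \cap C' \subset \{S_1,S_2\}$. -/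

import Mathlib

open scoped LinearAlgebra.Projectivization TensorProduct

namespace PlaneCurves

open MvPolynomial

noncomputable section

/-- A (reduced) projective plane curve over `k`, given by an equation `form = 0` with `form` a
squarefree homogeneous polynomial of positive degree in `k[x₀, x₁, x₂]`. -/
structure PlaneCurve (k : Type*) [Field k] where
  form : MvPolynomial (Fin 3) k
  degree : ℕ
  degree_pos : 0 < degree
  isHomogeneous : form.IsHomogeneous degree
  squarefree : Squarefree form

/-! ### Local rings of the plane and of plane curves

`K` is an extension field of `k`. A vector `s` in `K³`, not zero, represents a `K`-point of the
projective plane over `k`. -/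

section LocalRings

variable (k : Type*) {K : Type*} [Field k] [Field K] [Algebra k K]

/-- The prime ideal of all polynomials over `k` that vanish at `s`. -/
def pointIdeal (s : Fin 3 → K) : Ideal (MvPolynomial (Fin 3) k) :=
  RingHom.ker (aeval s : MvPolynomial (Fin 3) k →ₐ[k] K)

instance pointIdeal_isPrime (s : Fin 3 → K) : (pointIdeal k s).IsPrime :=
  RingHom.ker_isPrime _

/-- All fractions `G / H` with `G, H` homogeneous over `k` of the same degree and `H(s) ≠ 0`. -/
def planeFractions (s : Fin 3 → K) : Subalgebra k (Localization.AtPrime (pointIdeal k s)) where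
  carrier := {a | ∃ (n : ℕ) (G H : MvPolynomial (Fin 3) k), G.IsHomogeneous n ∧
    H.IsHomogeneous n ∧ aeval s H ≠ 0 ∧ a * algebraMap _ _ H = algebraMap _ _ G}
  mul_mem' := by
    rintro a b ⟨n, G, H, hG, hH, hs, e⟩ ⟨n', G', H', hG', hH', hs', e'⟩
    refine ⟨n + n', G * G', H * H', hG.mul hG', hH.mul hH', ?_, ?_⟩
    · rw [map_mul]; exact mul_ne_zero hs hs'
    · rw [map_mul, map_mul, ← e, ← e']; ring
  add_mem' := by
    rintro a b ⟨n, G, H, hG, hH, hs, e⟩ ⟨n', G', H', hG', hH', hs', e'⟩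
    refine ⟨n + n', G * H' + H * G', H * H', (hG.mul hH').add (hH.mul hG'), hH.mul hH', ?_, ?_⟩
    · rw [map_mul]; exact mul_ne_zero hs hs'
    · rw [map_add, map_mul, map_mul, map_mul, ← e, ← e']; ring
  algebraMap_mem' := by
    intro r
    refine ⟨0, C r, 1, isHomogeneous_C _ _, isHomogeneous_one _ _, by simp, ?_⟩
    rw [map_one, mul_one, IsScalarTower.algebraMap_apply k (MvPolynomial (Fin 3) k)]
    rfl

/-- The local ring of the projective plane over `k` at (the image of) the `K`-point represented by
`s`. -/
def PlaneLocalRing (s : Fin 3 → K) : Type _ :=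
  planeFractions k s

instance (s : Fin 3 → K) : CommRing (PlaneLocalRing k s) :=
  inferInstanceAs (CommRing (planeFractions k s))

instance (s : Fin 3 → K) : Algebra k (PlaneLocalRing k s) :=
  inferInstanceAs (Algebra k (planeFractions k s))

/-- The inclusion of the local ring of the plane into the ring of all fractions. -/
def toFractions (s : Fin 3 → K) :
    PlaneLocalRing k s →ₐ[k] Localization.AtPrime (pointIdeal k s) :=
  (planeFractions k s).val

/-- Evaluation `G / H ↦ G(s) / H(s)`. -/
def evalAt (s : Fin 3 → K) : PlaneLocalRing k s →ₐ[k] K :=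
  (IsLocalization.liftAlgHom (M := (pointIdeal k s).primeCompl)
    (f := (aeval s : MvPolynomial (Fin 3) k →ₐ[k] K))
    (fun y => isUnit_iff_ne_zero.mpr fun h => y.2 h)).comp (toFractions k s)

variable {k}

/-- The ideal of the curve `F = 0` in the local ring of the plane, that is, all fractions in that
ring that are multiples of `F`. It is principal, generated by any local equation `F / L ^ deg F` of
the curve, where `L` is a linear form with `L(s) ≠ 0`. -/
def curveIdeal (F : MvPolynomial (Fin 3) k) (s : Fin 3 → K) : Ideal (PlaneLocalRing k s) :=
  (Ideal.span {algebraMap (MvPolynomial (Fin 3) k)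
    (Localization.AtPrime (pointIdeal k s)) F}).comap (toFractions k s)

/-- The local ring of the curve `F = 0` at (the image of) the `K`-point represented by `s`. -/
abbrev CurveLocalRing (F : MvPolynomial (Fin 3) k) (s : Fin 3 → K) : Type _ :=
  PlaneLocalRing k s ⧸ curveIdeal F s

/-- The integral closure of the local ring of `F = 0` at `s` in its total ring of fractions. It is
the (semilocal) ring of the normalisation of the curve `F = 0` along the fibre over `s`. -/
abbrev NormalizedLocalRing (F : MvPolynomial (Fin 3) k) (s : Fin 3 → K) : Type _ :=
  integralClosure (CurveLocalRing F s) (FractionRing (CurveLocalRing F s))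

/-- The pull back map from the local ring of the plane. -/
def toNormalized (F : MvPolynomial (Fin 3) k) (s : Fin 3 → K) :
    PlaneLocalRing k s →+* NormalizedLocalRing F s :=
  (algebraMap (CurveLocalRing F s) (NormalizedLocalRing F s)).comp
    (Ideal.Quotient.mk (curveIdeal F s))

end LocalRings

/-! ### Geometric points, multiplicities, singularities -/

section Points

variable {K : Type*} [Field K]

/-- The Taylor expansion `F(s + X)`. -/
def taylorAt (F : MvPolynomial (Fin 3) K) (s : Fin 3 → K) : MvPolynomial (Fin 3) K :=
  aeval (fun i => C (s i) + X i) F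

/-- The multiplicity of the point represented by `s` on the curve `F = 0`: the lowest degree that
occurs in the Taylor expansion of `F` at `s`. It is `0` if the point is not on the curve. -/
def multiplicityAt (F : MvPolynomial (Fin 3) K) (s : Fin 3 → K) : ℕ :=
  sInf {n | homogeneousComponent n (taylorAt F s) ≠ 0}

/-- The multiple point represented by `s` on `F = 0` is ordinary: with `m` its multiplicity, the
leading form of the Taylor expansion is a product of `m` linear forms that define `m` distinct lines
through the point (the tangent lines). -/
def IsOrdinaryAt (F : MvPolynomial (Fin 3) K) (s : Fin 3 → K) : Prop :=
  ∃ l : Fin (multiplicityAt F s) → Fin 3 → K,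
    (∀ i, ∑ j, l i j * s j = 0) ∧
    (∀ i i', i ≠ i' → LinearIndependent K ![l i, l i']) ∧
    homogeneousComponent (multiplicityAt F s) (taylorAt F s) = ∏ i, ∑ j, C (l i j) * X j

/-- The intersection multiplicity at the point represented by `s` of the curves `F = 0` and `G = 0`
over `K`: the length of the local ring of `F = 0` modulo a local equation of `G = 0`. (The length is
finite if the curves have no common component through the point.) -/
def intersectionMultiplicity (F G : MvPolynomial (Fin 3) K) (s : Fin 3 → K) : ℕ :=
  (Module.length (CurveLocalRing F s)
    (CurveLocalRing F s ⧸ (curveIdeal G s).map (Ideal.Quotient.mk (curveIdeal F s)))).toNat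

end Points

namespace PlaneCurve

variable {k : Type*} [Field k] (K : Type*) [Field K] [Algebra k K]

/-- The equation of the base change of the curve to `K`. -/
def formOver (D : PlaneCurve k) : MvPolynomial (Fin 3) K :=
  map (algebraMap k K) D.form

/-- The set `D(K)`, as a subset of the projective plane over `K`. -/
def points (D : PlaneCurve k) : Set (ℙ K (Fin 3 → K)) :=
  {S | eval S.rep (D.formOver K) = 0}

/-- The set of those points of `D(K)` at which the base change of `D` to `K` is singular. -/
def singularPoints (D : PlaneCurve k) : Set (ℙ K (Fin 3 → K)) :=
  {S | S ∈ D.points K ∧ ∀ i, eval S.rep (pderiv i (D.formOver K)) = 0}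

/-- Smoothness over `k`, for `K` an algebraic closure of `k`. -/
def IsSmooth (D : PlaneCurve k) : Prop :=
  D.singularPoints K = ∅

/-- Geometric integrality, for `K` an algebraic closure of `k`. -/
def IsGeometricallyIntegral (D : PlaneCurve k) : Prop :=
  Irreducible (D.formOver K)

variable {K}

/-- The multiplicity `m_S` of `S` on `D`. -/
def mult (D : PlaneCurve k) (S : ℙ K (Fin 3 → K)) : ℕ :=
  multiplicityAt (D.formOver K) S.rep

/-- The intersection multiplicity `μ_S(D, D')` at the geometric point `S`. -/
def mu (D D' : PlaneCurve k) (S : ℙ K (Fin 3 → K)) : ℕ :=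
  intersectionMultiplicity (D.formOver K) (D'.formOver K) S.rep

variable (K)

/-- The `K`-points of the normalisation of the plane curve `D` (a curve over `k`). Such a point
consists of its image `base` in the plane and a `k`-algebra homomorphism to `K` from the normalised
local ring of `D` at `base` that lies over the evaluation at `base`. -/
structure NormalizationPoint (D : PlaneCurve k) where
  base : ℙ K (Fin 3 → K)
  hom : NormalizedLocalRing D.form base.rep →ₐ[k] K
  hom_toNormalized : ∀ a : PlaneLocalRing k base.rep,
    hom (toNormalized D.form base.rep a) = evalAt k base.rep a

variable {K}

namespace NormalizationPoint

variable {D : PlaneCurve k} (T : D.NormalizationPoint K)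

/-- The `K`-algebra homomorphism from the base change to `K` of the normalised local ring, that
corresponds to `T`. -/
def homOver : K ⊗[k] NormalizedLocalRing D.form T.base.rep →ₐ[K] K :=
  Algebra.TensorProduct.lift (AlgHom.id K K) T.hom fun _ _ => Commute.all _ _

/-- The maximal ideal that corresponds to `T`. -/
def ideal : Ideal (K ⊗[k] NormalizedLocalRing D.form T.base.rep) :=
  RingHom.ker T.homOver

instance ideal_isPrime : T.ideal.IsPrime :=
  RingHom.ker_isPrime _

/-- The local ring at `T` of the base change to `K` of the normalisation of `D`. -/
abbrev LocalRing : Type _ :=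
  Localization.AtPrime T.ideal

/-- The pull back map from the local ring of the plane at the image of `T`. -/
def toLocalRing : PlaneLocalRing k T.base.rep →+* T.LocalRing :=
  (algebraMap (K ⊗[k] NormalizedLocalRing D.form T.base.rep) T.LocalRing).comp
    ((Algebra.TensorProduct.includeRight : NormalizedLocalRing D.form T.base.rep →ₐ[k]
      K ⊗[k] NormalizedLocalRing D.form T.base.rep).toRingHom.comp
        (toNormalized D.form T.base.rep))

/-- The intersection multiplicity `μ_T` at `T` of the normalisation of `D` with the curve `D'`: the
length of the local ring at `T` modulo a local equation of `D'`. -/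
def mu (D' : PlaneCurve k) : ℕ :=
  (Module.length T.LocalRing
    (T.LocalRing ⧸ (curveIdeal D'.form T.base.rep).map T.toLocalRing)).toNat

end NormalizationPoint

variable (K)

/-- The set `b(D, D')` of points of `D(K)` at which the intersection multiplicity is odd. -/
def oddPoints (D D' : PlaneCurve k) : Set (ℙ K (Fin 3 → K)) :=
  {S | S ∈ D.points K ∧ Odd (D.mu D' S)}

/-- The set `b(D̃, D')` of `K`-points of the normalisation of `D` at which the intersection
multiplicity with `D'` is odd. -/
def oddBranches (D D' : PlaneCurve k) : Set (D.NormalizationPoint K) :=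
  {T | Odd (T.mu D')}

variable {K}

/-- The contribution `c_S(D, D')` of a point `S` of `D` that lies on `D'`. -/
def contribution (D D' : PlaneCurve k) (S : ℙ K (Fin 3 → K)) : ℕ :=
  if D.mult S ≡ D.mu D' S [MOD 2] then D.mult S else D.mult S - 1

end PlaneCurve

end

end PlaneCurves

namespace PlaneCurves

/-! ### Power series expansions of ring elements in terms of one element. -/

section Expansion

open PowerSeries

/-! The problem is local at a common point `S` of `C : F = 0` and `C' : F' = 0`. In an affine chart
let `p` be the point, and let `v, w` be a frame with `w` tangent to neither curve. As `S` is
ordinary of multiplicity `m`, one has `F(p + t v + t Y w) = t ^ m Φ(t, Y)`, where `Φ(0, Y)` has `m`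
simple roots. Hensel's lemma lifts them to power series `γ_a` with distinct constant terms: the `m`
branches of `C` at `S` (`exists_branches`). The smooth curve `C'` has a single branch `γ'`.

The branches are exactly the points of the normalisation over `S` (`exists_points_of_isAdapted`).
Put `e_a = ord (γ_a - γ')`. The branch `a` meets `C'` with multiplicity `1 + e_a`
(`exists_aeval_arc_eq`), and restricting `F` to the branch of `C'` gives `μ_S = m + ∑ e_a`
(`intersectionMultiplicity_eq`). The constant terms of the `γ_a` are distinct, so at most one `e_a`
is positive. Hence all `m` numbers `1 + e_a` are odd if `μ_S ≡ m` modulo `2`, and exactly one of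
them is even otherwise; this is `c_S` (`card_filter_odd_one_add`). Summation over `S` gives the
formula, and the two final statements say when a sum of such contributions is `0` or `2`.

The main work is the identification of points with branches. The local ring `L` at a point of the
normalisation is a localisation of `K ⊗ N`, where `N` is an integral closure formed over `k`. Since
`K` may be inseparable over `k`, normality of `L` cannot be taken for granted. A branch gives a
point because `K⟦X⟧` is integrally closed. Conversely, let `x, y` be the frame coordinates in `L`;
the key is that `y = x ℓ` for some `ℓ` (`exists_eq_mul_of_normalized`). If `m ≥ 2`, some Hasse
derivative `q` of `F` of order `m - 1`, again defined over `k`, is transversal to `F'`. Then `F = ∑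
a_j F' ^ (m - j) q ^ j` with some `a_j` a unit, and integrality of the Horner tails of this relation
in `q / F'` shows that one of `F'` and `q` divides the other in `L`. So the ideal `(x, y)` is
principal, and `x` generates it because `w` is not tangent.

Now `ℓ` is a root of `Φ(x, ·)` whose residue is the slope of one branch, and Newton's argument
expands `ℓ`, then every element of `L`, as a power series in `x` along that branch
(`exists_branch`). Lengths thereby become orders of vanishing (`length_quotient_of_hasExpansion`).
-/

theorem coe_X_pow_dvd_iff {K : Type*} [Field K] {p : Polynomial K} {n : ℕ} :
    (X ^ n : K⟦X⟧) ∣ (p : K⟦X⟧) ↔ Polynomial.X ^ n ∣ p := by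
  rw [PowerSeries.X_pow_dvd_iff, Polynomial.X_pow_dvd_iff]
  simp

theorem X_pow_dvd_sub_trunc {K : Type*} [Field K] (g : K⟦X⟧) (n : ℕ) :
    (X ^ n : K⟦X⟧) ∣ g - (trunc n g : Polynomial K) := by
  rw [PowerSeries.X_pow_dvd_iff]
  intro m hm
  rw [map_sub, Polynomial.coeff_coe, coeff_trunc, if_pos hm, sub_self]

/-- The element `a` has the power series expansion `g` in terms of `x`. -/
def HasExpansion {K L : Type*} [Field K] [CommRing L] [Algebra K L] (x a : L) (g : K⟦X⟧) : Prop :=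
  ∀ n : ℕ, ∃ p : Polynomial K, x ^ n ∣ a - Polynomial.aeval x p ∧ (X ^ n : K⟦X⟧) ∣ g - p

variable {K L : Type*} [Field K] [CommRing L] [Algebra K L] {x a b : L} {g h : K⟦X⟧}

namespace HasExpansion

theorem add (ha : HasExpansion x a g) (hb : HasExpansion x b h) :
    HasExpansion x (a + b) (g + h) := by
  intro n
  obtain ⟨p, hp, hp'⟩ := ha n
  obtain ⟨q, hq, hq'⟩ := hb n
  refine ⟨p + q, ?_, ?_⟩
  · rw [map_add, add_sub_add_comm]
    exact dvd_add hp hq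
  · rw [Polynomial.coe_add, add_sub_add_comm]
    exact dvd_add hp' hq'

theorem mul (ha : HasExpansion x a g) (hb : HasExpansion x b h) :
    HasExpansion x (a * b) (g * h) := by
  intro n
  obtain ⟨p, hp, hp'⟩ := ha n
  obtain ⟨q, hq, hq'⟩ := hb n
  refine ⟨p * q, ?_, ?_⟩
  · rw [map_mul, show a * b - Polynomial.aeval x p * Polynomial.aeval x q =
      (a - Polynomial.aeval x p) * b + Polynomial.aeval x p * (b - Polynomial.aeval x q) by ring]
    exact dvd_add (hp.mul_right _) (hq.mul_left _)
  · rw [Polynomial.coe_mul, show g * h - (p : K⟦X⟧) * q = (g - p) * h + p * (h - q) by ring]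
    exact dvd_add (hp'.mul_right _) (hq'.mul_left _)

theorem const (x : L) (r : K) : HasExpansion x (algebraMap K L r) (C r) :=
  fun _ => ⟨Polynomial.C r, by simp, by simp⟩

theorem self (x : L) : HasExpansion x x (X : K⟦X⟧) :=
  fun _ => ⟨Polynomial.X, by simp, by simp⟩

theorem zero (x : L) : HasExpansion x 0 (0 : K⟦X⟧) := by
  simpa using const x (0 : K)

theorem aeval {σ : Type*} {ξ : σ → L} {c : σ → K⟦X⟧} (H : ∀ j, HasExpansion x (ξ j) (c j))
    (G : MvPolynomial σ K) :
    HasExpansion x (MvPolynomial.aeval ξ G) (MvPolynomial.aeval c G) := by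
  induction G using MvPolynomial.induction_on with
  | C r => simpa using const x r
  | add p q hp hq => simpa using hp.add hq
  | mul_X p j hp => simpa using hp.mul (H j)

theorem dvd_sub (ha : HasExpansion x a g) : x ∣ a - algebraMap K L (constantCoeff g) := by
  obtain ⟨p, hp, hp'⟩ := ha 1
  rw [pow_one] at hp hp'
  rw [X_dvd_iff, map_sub, sub_eq_zero] at hp'
  have h0 : constantCoeff (p : K⟦X⟧) = p.eval 0 := by
    rw [← coeff_zero_eq_constantCoeff_apply, Polynomial.coeff_coe, Polynomial.coeff_zero_eq_eval_zero]
  have := Polynomial.X_dvd_sub_C (p := p)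
  rw [Polynomial.coeff_zero_eq_eval_zero, ← h0, ← hp'] at this
  have h1 := map_dvd (Polynomial.aeval x) this
  rw [Polynomial.aeval_X, map_sub, Polynomial.aeval_C] at h1
  simpa using dvd_add hp h1

theorem pow_dvd (ha : HasExpansion x a g) {n : ℕ} (hg : X ^ n ∣ g) : x ^ n ∣ a := by
  obtain ⟨p, hp, hp'⟩ := ha n
  have h1 : (X ^ n : K⟦X⟧) ∣ p := by simpa using _root_.dvd_sub hg hp'
  have h2 := map_dvd (Polynomial.aeval x) (coe_X_pow_dvd_iff.mp h1)
  rw [map_pow, Polynomial.aeval_X] at h2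
  simpa using dvd_add hp h2

/-- With `q` the truncation of `h`, the polynomial `1 - p q` is divisible by `X ^ n`, already among
polynomials; substituting `x` carries this over to `L`. -/
theorem of_mul_eq_one (ha : HasExpansion x a g) (hab : a * b = 1) (hgh : g * h = 1) :
    HasExpansion x b h := by
  intro n
  obtain ⟨p, hp, hp'⟩ := ha n
  refine ⟨trunc n h, ?_, X_pow_dvd_sub_trunc h n⟩
  set q := trunc n h with hq
  have hq' : (X ^ n : K⟦X⟧) ∣ h - q := X_pow_dvd_sub_trunc h n
  have h1 : (X ^ n : K⟦X⟧) ∣ ((1 - p * q : Polynomial K) : K⟦X⟧) := by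
    have : ((1 - p * q : Polynomial K) : K⟦X⟧) = (g - p) * h + p * (h - q) := by
      rw [Polynomial.coe_sub, Polynomial.coe_one, Polynomial.coe_mul, ← hgh]; ring
    rw [this]
    exact dvd_add (hp'.mul_right _) (hq'.mul_left _)
  have h2 := map_dvd (Polynomial.aeval x) (coe_X_pow_dvd_iff.mp h1)
  rw [map_pow, Polynomial.aeval_X, map_sub, map_mul, map_one] at h2
  have : b - Polynomial.aeval x q =
      b * (1 - Polynomial.aeval x p * Polynomial.aeval x q) -
      b * ((a - Polynomial.aeval x p) * Polynomial.aeval x q) := by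
    linear_combination (Polynomial.aeval x q) * hab
  rw [this]
  exact _root_.dvd_sub (h2.mul_left _) ((hp.mul_right _).mul_left _)

/-- Cancelling `x` costs one order of precision, hence the use of the approximation of order `n +
1`. -/
theorem of_mul_left (hx : IsLeftRegular x) (ha : HasExpansion x (x * a) (X * g)) :
    HasExpansion x a g := by
  intro n
  obtain ⟨p, hp, hp'⟩ := ha (n + 1)
  have h1 : Polynomial.X ∣ p := by
    have : (X ^ 1 : K⟦X⟧) ∣ p := by
      have := _root_.dvd_sub (Dvd.intro g rfl) ((pow_dvd_pow X (Nat.le_add_left 1 n)).trans hp')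
      simpa using this
    simpa using coe_X_pow_dvd_iff.mp this
  obtain ⟨q, rfl⟩ := h1
  refine ⟨q, ?_, ?_⟩
  · obtain ⟨r, hr⟩ := hp
    refine ⟨r, hx ?_⟩
    rw [map_mul, Polynomial.aeval_X] at hr
    change x * _ = x * _
    rw [mul_sub, hr]; ring
  · obtain ⟨r, hr⟩ := hp'
    refine ⟨r, mul_left_cancel₀ X_ne_zero ?_⟩
    rw [Polynomial.coe_mul, Polynomial.coe_X] at hr
    rw [mul_sub, hr]; ring

theorem of_pow_mul_left (hx : IsLeftRegular x) (n : ℕ)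
    (ha : HasExpansion x (x ^ n * a) (X ^ n * g)) : HasExpansion x a g := by
  induction n with
  | zero => simpa using ha
  | succ n ih =>
    rw [pow_succ', pow_succ', mul_assoc, mul_assoc] at ha
    exact ih (of_mul_left hx ha)

theorem isUnit [IsLocalRing L] (hx : ¬ IsUnit x) (ha : HasExpansion x a g)
    (hg : constantCoeff g ≠ 0) : IsUnit a := by
  by_contra h
  have h1 : x ∈ IsLocalRing.maximalIdeal L := hx
  have h2 : a ∈ IsLocalRing.maximalIdeal L := h
  have h3 := sub_mem h2 (Ideal.mem_of_dvd _ ha.dvd_sub h1)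
  rw [sub_sub_cancel] at h3
  exact h3 ((isUnit_iff_ne_zero.mpr hg).map (algebraMap K L))

theorem of_isUnit_mul [IsLocalRing L] (hx : ¬ IsUnit x) (ha : HasExpansion x a g)
    (hg : constantCoeff g ≠ 0) (hab : HasExpansion x (a * b) (g * h)) : HasExpansion x b h := by
  obtain ⟨u, hu⟩ := (ha.isUnit hx hg).exists_right_inv
  have hv := g.mul_inv_cancel hg
  have := (ha.of_mul_eq_one hu hv).mul hab
  rwa [← mul_assoc, ← mul_assoc, mul_comm u, hu, mul_comm g⁻¹, hv, one_mul, one_mul] at this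

/-- Newton's argument without completeness: a truncation `p` of `γ` is an approximate root over
`K[X]`, so `Φ(p)` becomes divisible by a high power of `x`. As `Φ(a) = 0` and the root is simple, `a
- p` is a unit times `Φ(p)`. -/
theorem of_root [IsLocalRing L] (hx : ¬ IsUnit x) {Φ : Polynomial (Polynomial K)} {γ : K⟦X⟧}
    (ha : Φ.eval₂ (Polynomial.aeval x : Polynomial K →ₐ[K] L).toRingHom a = 0)
    (hγ : Φ.eval₂ Polynomial.coeToPowerSeries.ringHom γ = 0)
    (hres : ¬ IsUnit (a - algebraMap K L (constantCoeff γ)))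
    (hd : Φ.derivative.eval₂ Polynomial.constantCoeff (constantCoeff γ) ≠ 0) :
    HasExpansion x a γ := by
  intro n
  -- The extra order ensures that the truncation contains the constant term of `γ` even for `n = 0`.
  set N := n + 1 with hN
  set p := trunc N γ with hp
  have hp' : (X ^ N : K⟦X⟧) ∣ γ - p := X_pow_dvd_sub_trunc γ N
  refine ⟨p, ?_, (pow_dvd_pow X (Nat.le_succ n)).trans hp'⟩
  refine (pow_dvd_pow x (Nat.le_succ n)).trans ?_
  set ε : Polynomial K →+* L := (Polynomial.aeval x : Polynomial K →ₐ[K] L).toRingHom with hε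
  have hεp : ∀ q, Polynomial.aeval x q = ε q := fun _ => rfl
  have hp0 : Polynomial.constantCoeff p = constantCoeff γ := by
    rw [Polynomial.constantCoeff_apply, hp, coeff_trunc, if_pos (Nat.succ_pos n),
      coeff_zero_eq_constantCoeff_apply]
  have hcoe : ∀ q : Polynomial K, (q : K⟦X⟧) = Polynomial.coeToPowerSeries.ringHom q :=
    fun _ => rfl
  have h1 : Polynomial.X ^ N ∣ Φ.eval p := by
    rw [← coe_X_pow_dvd_iff, hcoe, ← Polynomial.eval₂_at_apply, ← hcoe, ← Polynomial.eval_map]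
    rw [← Polynomial.eval_map] at hγ
    have := hp'.trans (Polynomial.sub_dvd_eval_sub γ (p : K⟦X⟧) (Φ.map Polynomial.coeToPowerSeries.ringHom))
    rw [hγ, zero_sub, dvd_neg] at this
    exact this
  have h2 : x ^ N ∣ ε (Φ.eval p) := by
    have := map_dvd ε h1
    rwa [map_pow, show ε Polynomial.X = x from Polynomial.aeval_X x] at this
  -- The Taylor formula reads `0 = Φ(p) + (Φ'(p) + k (a - p)) (a - p)`, and the bracket will be a
  -- unit.
  obtain ⟨k, hk⟩ := Polynomial.binomExpansion (Φ.map ε) (ε p) (a - ε p)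
  rw [add_sub_cancel, Polynomial.eval_map, ha, Polynomial.eval_map, Polynomial.eval₂_at_apply,
    Polynomial.derivative_map, Polynomial.eval_map, Polynomial.eval₂_at_apply] at hk
  have hmem : x ∈ IsLocalRing.maximalIdeal L := hx
  have hconst : ∀ q : Polynomial K, ε q - algebraMap K L (Polynomial.constantCoeff q) ∈
      IsLocalRing.maximalIdeal L := by
    intro q
    have := map_dvd ε (Polynomial.X_dvd_sub_C (p := q))
    rw [show ε Polynomial.X = x from Polynomial.aeval_X x, map_sub,
      show ε (Polynomial.C (q.coeff 0)) = algebraMap K L (q.coeff 0) from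
        Polynomial.aeval_C x _] at this
    exact Ideal.mem_of_dvd _ this hmem
  have h3 : a - ε p ∈ IsLocalRing.maximalIdeal L := by
    have e1 := hconst p
    rw [hp0] at e1
    have e2 : a - algebraMap K L (constantCoeff γ) ∈ IsLocalRing.maximalIdeal L := hres
    simpa using sub_mem e2 e1
  have h4 : IsUnit (ε (Φ.derivative.eval p) + k * (a - ε p)) := by
    by_contra hu
    have hu' : _ ∈ IsLocalRing.maximalIdeal L := hu
    have e1 := sub_mem (sub_mem hu' (Ideal.mul_mem_left _ k h3)) (hconst (Φ.derivative.eval p))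
    rw [add_sub_cancel_right, sub_sub_cancel, ← Polynomial.eval₂_at_apply, hp0] at e1
    exact e1 ((isUnit_iff_ne_zero.mpr hd).map (algebraMap K L))
  obtain ⟨v, hv⟩ := h4.exists_left_inv
  have h5 : a - ε p = -(v * ε (Φ.eval p)) := by
    linear_combination (-(a - ε p)) * hv - v * hk
  rw [hεp, h5, dvd_neg]
  exact h2.mul_left _

end HasExpansion

/-- Hensel's lemma for a simple root of a polynomial that need not be monic. -/
theorem exists_powerSeries_root (Φ : Polynomial K⟦X⟧) (r : K)
    (h0 : Φ.eval₂ constantCoeff r = 0) (hd : Φ.derivative.eval₂ constantCoeff r ≠ 0) :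
    ∃ γ : K⟦X⟧, constantCoeff γ = r ∧ Φ.eval γ = 0 := by
  have step : ∀ (n : ℕ) (c : K⟦X⟧), constantCoeff c = r → X ^ (n + 1) ∣ Φ.eval c →
      ∃ c', (constantCoeff c' = r ∧ X ^ (n + 1 + 1) ∣ Φ.eval c') ∧ X ^ (n + 1) ∣ c' - c := by
    intro n c hc hdvd
    have hu : constantCoeff (Φ.derivative.eval c) ≠ 0 := by
      rwa [← Polynomial.eval₂_at_apply, hc]
    have hv := PowerSeries.mul_inv_cancel _ hu
    set v := (Φ.derivative.eval c)⁻¹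
    obtain ⟨w, hw⟩ := hdvd
    -- One Newton step; a gain of a single order is all that is needed.
    refine ⟨c + -(Φ.eval c * v), ⟨?_, ?_⟩, ?_⟩
    · rw [map_add, map_neg, map_mul, hc, hw, map_mul, map_pow, constantCoeff_X]
      simp
    · obtain ⟨k, hk⟩ := Polynomial.binomExpansion Φ c (-(Φ.eval c * v))
      rw [hk]
      have : Φ.eval c + Φ.derivative.eval c * -(Φ.eval c * v) + k * (-(Φ.eval c * v)) ^ 2 =
          X ^ (n + 1) * X ^ (n + 1) * (k * w ^ 2 * v ^ 2) := by
        rw [hw]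
        linear_combination (-(X ^ (n + 1) * w)) * hv
      rw [this, ← pow_add]
      exact (pow_dvd_pow X (by omega)).mul_right _
    · rw [hw, add_sub_cancel_left, dvd_neg, mul_assoc]
      exact dvd_mul_right _ _
  choose! s hs hs' using step
  let seq : ℕ → K⟦X⟧ := fun n => Nat.rec (C r) (fun n c => s n c) n
  have hseq : ∀ n, constantCoeff (seq n) = r ∧ X ^ (n + 1) ∣ Φ.eval (seq n) := by
    intro n
    induction n with
    | zero =>
      refine ⟨by simp [seq], ?_⟩
      rw [zero_add, pow_one, X_dvd_iff, ← Polynomial.eval₂_at_apply]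
      simpa [seq] using h0
    | succ n ih => exact hs n (seq n) ih.1 ih.2
  have hdiff : ∀ n, X ^ (n + 1) ∣ seq (n + 1) - seq n := fun n =>
    hs' n (seq n) (hseq n).1 (hseq n).2
  have hcauchy : ∀ n k, X ^ (n + 1) ∣ seq (n + k) - seq n := by
    intro n k
    induction k with
    | zero => simp
    | succ k ih =>
      have := dvd_add ((pow_dvd_pow X (by omega : n + 1 ≤ n + k + 1)).trans (hdiff (n + k))) ih
      simpa [add_assoc] using this
  -- The coefficient of index `n` no longer changes from `seq n` on.
  set γ : K⟦X⟧ := PowerSeries.mk fun n => coeff n (seq n) with hγ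
  have hlim : ∀ n, X ^ (n + 1) ∣ γ - seq n := by
    intro n
    rw [X_pow_dvd_iff]
    intro m hm
    obtain ⟨k, rfl⟩ := Nat.exists_eq_add_of_le (Nat.lt_succ_iff.mp hm)
    have := X_pow_dvd_iff.mp (hcauchy m k) m (Nat.lt_succ_self m)
    rw [map_sub, sub_eq_zero] at this
    rw [map_sub, hγ, coeff_mk, this, sub_self]
  refine ⟨γ, ?_, ?_⟩
  · rw [hγ, ← coeff_zero_eq_constantCoeff_apply, coeff_mk, coeff_zero_eq_constantCoeff_apply]
    exact (hseq 0).1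
  · ext n
    have h1 := (hlim n).trans (Polynomial.sub_dvd_eval_sub γ (seq n) Φ)
    have h2 := dvd_add h1 (hseq n).2
    rw [sub_add_cancel] at h2
    rw [map_zero]
    exact X_pow_dvd_iff.mp h2 n (Nat.lt_succ_self n)

theorem length_quotient_eq {R S : Type*} [CommRing R] [CommRing S] {I : Ideal R} {J : Ideal S}
    (f : R →+* S) (hf : Function.Surjective ((Ideal.Quotient.mk J).comp f)) (hIJ : J.comap f = I) :
    Module.length R (R ⧸ I) = Module.length S (S ⧸ J) := by
  subst hIJ
  let := ((Ideal.Quotient.mk J).comp f).toAlgebra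
  have h1 : Module.length R (S ⧸ J) = Module.length (S ⧸ J) (S ⧸ J) :=
    Module.length_eq_of_surjective hf
  have h2 : Module.length S (S ⧸ J) = Module.length (S ⧸ J) (S ⧸ J) :=
    Module.length_eq_of_surjective Ideal.Quotient.mk_surjective
  rw [h2, ← h1]
  have hk : LinearMap.ker (Algebra.linearMap R (S ⧸ J)) = J.comap f := by
    ext a
    rw [LinearMap.mem_ker, Ideal.mem_comap]
    exact Ideal.Quotient.eq_zero_iff_mem
  rw [← hk]
  exact ((Algebra.linearMap R (S ⧸ J)).quotKerEquivOfSurjective hf).length_eq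

theorem length_quotient_X_pow (K : Type*) [Field K] (n : ℕ) :
    Module.length K⟦X⟧ (K⟦X⟧ ⧸ Ideal.span {(X : K⟦X⟧) ^ n}) = n := by
  have h : Ring.ord K⟦X⟧ ((X : K⟦X⟧) ^ n) = n := by
    rw [Ring.ord_pow (mem_nonZeroDivisors_of_ne_zero X_ne_zero), Ring.ord_of_irreducible]
    · simp
    · exact X_prime.irreducible
  exact h

/-- If all elements have an expansion in terms of `x`, then lengths are orders of vanishing. -/
theorem length_quotient_of_hasExpansion [IsLocalRing L] (φ : L →ₐ[K] K⟦X⟧) (hx : φ x = X)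
    (hφ : ∀ a, HasExpansion x a (φ a)) {n : ℕ} {u : K⟦X⟧} (ha : φ a = X ^ n * u)
    (hu : constantCoeff u ≠ 0) : Module.length L (L ⧸ Ideal.span {a}) = n := by
  have hxu : ¬ IsUnit x := by
    intro h
    have := h.map φ
    rw [hx] at this
    exact X_prime.not_isUnit this
  have hφp : ∀ p : Polynomial K, φ (Polynomial.aeval x p) = p := by
    intro p
    rw [← Polynomial.aeval_algHom_apply, hx]
    induction p using Polynomial.induction_on' with
    | add p q hp hq => rw [map_add, hp, hq, Polynomial.coe_add]
    | monomial n r =>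
      rw [Polynomial.aeval_monomial, Polynomial.coe_monomial, monomial_eq_C_mul_X_pow]
      rfl
  -- The expansion shows that `a` is `x ^ n` times a unit, so it suffices to compare `L` modulo `x ^
  -- n` with `K⟦X⟧` modulo `X ^ n`.
  obtain ⟨a', ha'⟩ := (hφ a).pow_dvd (Dvd.intro u ha.symm)
  have hu' : IsUnit a' := by
    refine (hφ a').isUnit hxu ?_
    rw [ha', map_mul, map_pow, hx] at ha
    rwa [mul_left_cancel₀ (pow_ne_zero n X_ne_zero) ha]
  have hspan : Ideal.span {a} = Ideal.span {x ^ n} := by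
    rw [ha', Ideal.span_singleton_mul_right_unit hu']
  rw [hspan, ← length_quotient_X_pow K n]
  refine length_quotient_eq φ.toRingHom ?_ ?_
  · intro b
    obtain ⟨g, rfl⟩ := Ideal.Quotient.mk_surjective b
    refine ⟨Polynomial.aeval x (trunc n g), ?_⟩
    refine Ideal.Quotient.eq.mpr ?_
    rw [Ideal.mem_span_singleton]
    change _ ∣ φ (Polynomial.aeval x (trunc n g)) - g
    rw [hφp, ← dvd_neg, neg_sub]
    exact X_pow_dvd_sub_trunc g n
  · ext b
    rw [Ideal.mem_comap, Ideal.mem_span_singleton, Ideal.mem_span_singleton]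
    refine ⟨fun h => (hφ b).pow_dvd h, fun ⟨c, hc⟩ => ⟨φ c, ?_⟩⟩
    change φ b = _
    rw [hc, map_mul, map_pow, hx]

end Expansion

end PlaneCurves

namespace PlaneCurves

/-! ### Elimination for relatively prime polynomials in two variables. -/

section Elimination

open Polynomial

/-- By Gauss's lemma `f` and `g` stay relatively prime over the fraction field, where there is a
Bézout relation; `r` comes from clearing its denominators. -/
theorem exists_C_mem_span_of_isRelPrime {R : Type*} [CommRing R] [IsDomain R]
    [UniqueFactorizationMonoid R] {f g : R[X]} (h : IsRelPrime f g) :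
    ∃ r : R, r ≠ 0 ∧ C r ∈ Ideal.span {f, g} := by
  classical
  let := Classical.choice (inferInstance : Nonempty (NormalizedGCDMonoid R))
  set Q := FractionRing R
  have hinj : Function.Injective (algebraMap R Q) := IsFractionRing.injective R Q
  have hrel : IsRelPrime (f.map (algebraMap R Q)) (g.map (algebraMap R Q)) := by
    intro d hf hg
    have hd : d ≠ 0 := by
      rintro rfl
      rw [zero_dvd_iff, Polynomial.map_eq_zero_iff hinj] at hf hg
      rw [hf, hg] at h
      exact not_isUnit_zero (h dvd_rfl dvd_rfl)
    refine isUnit_or_eq_zero_of_isUnit_integerNormalization_primPart (R := R) hd ?_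
    set p := IsLocalization.integerNormalization (nonZeroDivisors R) d with hp
    obtain ⟨c, hc0, hc⟩ := IsLocalization.integerNormalization_spec (nonZeroDivisors R) d
    have hc0' : c ≠ 0 := nonZeroDivisors.ne_zero hc0
    have hunit : IsUnit (C (algebraMap R Q c)) :=
      isUnit_C.mpr (isUnit_iff_ne_zero.mpr ((map_ne_zero_iff _ hinj).mpr hc0'))
    have hpd : p.map (algebraMap R Q) ∣ d := by
      obtain ⟨v, hv⟩ := hunit.exists_left_inv
      refine ⟨v, ?_⟩
      rw [hc]
      change d = (c • d) * v
      rw [Algebra.smul_def, mul_right_comm]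
      have : algebraMap R Q[X] c * v = 1 := by rw [mul_comm]; exact hv
      rw [this, one_mul]
    have hpp : p.primPart.map (algebraMap R Q) ∣ d := by
      refine dvd_trans ?_ hpd
      exact Polynomial.map_dvd _ p.primPart_dvd
    exact h (p.isPrimitive_primPart.dvd_of_fraction_map_dvd_fraction_map (hpp.trans hf))
      (p.isPrimitive_primPart.dvd_of_fraction_map_dvd_fraction_map (hpp.trans hg))
  obtain ⟨a, b, hab⟩ := hrel.isCoprime
  obtain ⟨c, hc0, hc⟩ := IsLocalization.integerNormalization_spec (nonZeroDivisors R) a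
  obtain ⟨d, hd0, hd⟩ := IsLocalization.integerNormalization_spec (nonZeroDivisors R) b
  set a' := IsLocalization.integerNormalization (nonZeroDivisors R) a
  set b' := IsLocalization.integerNormalization (nonZeroDivisors R) b
  refine ⟨c * d, mul_ne_zero (nonZeroDivisors.ne_zero hc0) (nonZeroDivisors.ne_zero hd0), ?_⟩
  rw [Ideal.mem_span_pair]
  refine ⟨C d * a', C c * b', Polynomial.map_injective _ hinj ?_⟩
  change a'.map _ = c • a at hc
  change b'.map _ = d • b at hd
  have e : ∀ (r : R) (p : Q[X]), r • p = C (algebraMap R Q r) * p := fun r p => by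
    rw [Algebra.smul_def]; rfl
  rw [e] at hc hd
  simp only [Polynomial.map_add, Polynomial.map_mul, Polynomial.map_C, hc, hd, map_mul]
  linear_combination (C (algebraMap R Q c) * C (algebraMap R Q d)) * hab

theorem exists_aeval_X_zero_eq {k : Type*} [Field k] (r : MvPolynomial (Fin 1) k) :
    ∃ P : k[X], aeval (MvPolynomial.X 0) P = r := by
  induction r using MvPolynomial.induction_on with
  | C a => exact ⟨C a, by simp [MvPolynomial.algebraMap_eq]⟩
  | add p q hp hq =>
    obtain ⟨P, rfl⟩ := hp
    obtain ⟨Q, rfl⟩ := hq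
    exact ⟨P + Q, map_add _ _ _⟩
  | mul_X p i hp =>
    obtain ⟨P, rfl⟩ := hp
    refine ⟨P * X, ?_⟩
    rw [map_mul, aeval_X, Subsingleton.elim i 0]

/-- Each coordinate of a common zero of `f` and `g`, with values in any domain over `k`, is a root
of a fixed nonzero polynomial. It serves both for the finiteness of the intersection and for arcs on
a curve. -/
theorem exists_aeval_X_mem_span {k : Type*} [Field k] {f g : MvPolynomial (Fin 2) k}
    (h : IsRelPrime f g) (a : Fin 2) :
    ∃ P : k[X], P ≠ 0 ∧ aeval (MvPolynomial.X a) P ∈ Ideal.span {f, g} := by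
  have key : ∀ {f g : MvPolynomial (Fin 2) k}, IsRelPrime f g →
      ∃ P : k[X], P ≠ 0 ∧ aeval (MvPolynomial.X 1) P ∈ Ideal.span {f, g} := by
    intro f g h
    let e := MvPolynomial.finSuccEquiv k 1
    have h' : IsRelPrime (e f) (e g) := by
      intro d hf hg
      rw [← e.apply_symm_apply d] at hf hg ⊢
      exact (h ((map_dvd_iff e).mp hf) ((map_dvd_iff e).mp hg)).map e
    obtain ⟨r, hr0, hr⟩ := exists_C_mem_span_of_isRelPrime h'
    obtain ⟨P, rfl⟩ := exists_aeval_X_zero_eq r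
    refine ⟨P, fun hP => hr0 (by rw [hP, map_zero]), ?_⟩
    rw [Ideal.mem_span_pair] at hr ⊢
    obtain ⟨u, v, huv⟩ := hr
    refine ⟨e.symm u, e.symm v, e.injective ?_⟩
    rw [map_add, map_mul, map_mul, e.apply_symm_apply, e.apply_symm_apply, huv]
    have : e (MvPolynomial.X 1) = C (MvPolynomial.X 0) := MvPolynomial.finSuccEquiv_X_succ (j := 0)
    have h1 := Polynomial.aeval_algHom_apply e.toAlgHom (MvPolynomial.X 1) P
    have h2 := Polynomial.aeval_algHom_apply
      (IsScalarTower.toAlgHom k (MvPolynomial (Fin 1) k) (MvPolynomial (Fin 1) k)[X])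
      (MvPolynomial.X 0) P
    change aeval (e (MvPolynomial.X 1)) P = e _ at h1
    change aeval (C (MvPolynomial.X 0)) P = C _ at h2
    rw [← h1, ← h2, this]
  fin_cases a
  · let e := MvPolynomial.renameEquiv k (Equiv.swap (0 : Fin 2) 1)
    have h' : IsRelPrime (e f) (e g) := by
      intro d hf hg
      rw [← e.apply_symm_apply d] at hf hg ⊢
      exact (h ((map_dvd_iff e).mp hf) ((map_dvd_iff e).mp hg)).map e
    obtain ⟨P, hP, hP'⟩ := key h'
    refine ⟨P, hP, ?_⟩
    rw [Ideal.mem_span_pair] at hP' ⊢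
    obtain ⟨u, v, huv⟩ := hP'
    refine ⟨e.symm u, e.symm v, e.injective ?_⟩
    rw [map_add, map_mul, map_mul, e.apply_symm_apply, e.apply_symm_apply, huv,
      ← Polynomial.aeval_algHom_apply]
    simp [e]
  · exact key h

end Elimination

/-! ### Divisibility in an integral closure. -/

section IntegralDivision

/-- Multiplication by `b` on the finite module `M` satisfies a monic equation; evaluating it at `1 ∈
M` gives one for `b`. -/
theorem isIntegral_of_mul_mem_span {A Q : Type*} [CommRing A] [CommRing Q] [Algebra A Q]
    {M : Submodule A Q} (hM : M.FG) (h1 : 1 ∈ M) {b : Q} (hb : ∀ x ∈ M, b * x ∈ M) :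
    IsIntegral A b := by
  have : Module.Finite A M := Module.Finite.iff_fg.mpr hM
  let f : Module.End A M := (LinearMap.mulLeft A b).restrict hb
  obtain ⟨p, hp, hp'⟩ := Module.End.isIntegral (R := A) (M := M) |>.isIntegral f
  refine ⟨p, hp, ?_⟩
  have key : ∀ q : Polynomial A, ((Polynomial.aeval f q) ⟨1, h1⟩ : Q) = Polynomial.aeval b q := by
    have hpow : ∀ n : ℕ, ((f ^ n) ⟨1, h1⟩ : Q) = b ^ n := by
      intro n
      induction n with
      | zero => simp
      | succ n ih =>
        rw [pow_succ', Module.End.mul_apply, pow_succ', ← ih]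
        rfl
    intro q
    induction q using Polynomial.induction_on' with
    | add p q hp hq => simp [hp, hq]
    | monomial n r =>
      rw [Polynomial.aeval_monomial, Polynomial.aeval_monomial, Module.End.mul_apply,
        Module.algebraMap_end_apply, Submodule.coe_smul, hpow, Algebra.smul_def]
  have h2 := key p
  rw [show Polynomial.aeval f p = 0 from hp'] at h2
  rw [← Polynomial.aeval_def, ← h2]
  rfl

/-- If `q / h` satisfies a polynomial equation with coefficients `a i`, then each `a j` is the
difference of two elements of the integral closure, one of which witnesses `h ∣ q` up to a factor
and the other one `q ∣ h`. -/
theorem exists_integralClosure_division {A Q : Type*} [CommRing A] [CommRing Q] [Algebra A Q]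
    (m : ℕ) (a : ℕ → A) {h q : A} (hh : IsUnit (algebraMap A Q h))
    (hrel : ∑ i ∈ Finset.range (m + 1), a i * h ^ (m - i) * q ^ i = 0) :
    ∃ b c : ℕ → integralClosure A Q, b 0 = 0 ∧
      (∀ j ≤ m, b j = c j + algebraMap A (integralClosure A Q) (a j)) ∧
      ∀ j, algebraMap A (integralClosure A Q) h * c j =
        algebraMap A (integralClosure A Q) q * b (j + 1) := by
  obtain ⟨v, hv⟩ := hh.exists_right_inv
  set ι := algebraMap A Q with hι
  set u := ι q * v with hu
  have hhu : ι h * u = ι q := by rw [hu]; linear_combination (ι q) * hv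
  -- Here `u = q / h`, and `b j` is the Horner tail `a j + a (j + 1) u + ... + a m u ^ (m - j)`.
  let b : ℕ → Q := fun j => ∑ i ∈ Finset.range (m + 1 - j), ι (a (i + j)) * u ^ i
  have hb : ∀ j ≤ m, b j = u * b (j + 1) + ι (a j) := by
    intro j hj
    simp only [b]
    rw [show m + 1 - j = (m + 1 - (j + 1)) + 1 by omega, Finset.sum_range_succ', zero_add, pow_zero,
      mul_one, Finset.mul_sum]
    congr 1
    refine Finset.sum_congr rfl fun i _ => ?_
    rw [show i + 1 + j = i + (j + 1) by ring]; ring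
  have hbig : ∀ j, m < j → b j = 0 := by
    intro j hj
    simp only [b]
    rw [show m + 1 - j = 0 by omega, Finset.sum_range_zero]
  have hb0 : b 0 = 0 := by
    have h1 : ι h ^ m * b 0 = 0 := by
      rw [← map_zero ι, ← hrel, map_sum]
      simp only [b]
      rw [Finset.mul_sum, Nat.sub_zero]
      refine Finset.sum_congr rfl fun i hi => ?_
      rw [Finset.mem_range] at hi
      rw [add_zero, map_mul, map_mul, map_pow, map_pow, ← hhu, mul_pow]
      have : ι h ^ m = ι h ^ (m - i) * ι h ^ i := by rw [← pow_add]; congr 1; omega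
      rw [this]; ring
    calc b 0 = (ι h * v) ^ m * b 0 := by rw [hv, one_pow, one_mul]
      _ = v ^ m * (ι h ^ m * b 0) := by ring
      _ = 0 := by rw [h1, mul_zero]
  -- Since the full sum `b 0` vanishes, `u ^ j * b j` is minus the head of the sum, which contains
  -- only powers of `u` below `j`.
  have hpow : ∀ j ≤ m + 1, u ^ j * b j = -∑ i ∈ Finset.range j, ι (a i) * u ^ i := by
    intro j
    induction j with
    | zero => intro _; simp [hb0]
    | succ j ih =>
      intro hj
      have h1 := ih (by omega)
      rw [hb j (by omega)] at h1
      rw [Finset.sum_range_succ]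
      linear_combination h1
  have hint : ∀ j, IsIntegral A (b j) := by
    intro j
    rcases Nat.eq_zero_or_pos j with rfl | hj
    · rw [hb0]; exact isIntegral_zero
    rcases lt_or_ge m j with hmj | hmj
    · rw [hbig j hmj]; exact isIntegral_zero
    -- The span of `1, u, ..., u ^ (m - 1)` is stable under `b j`: on `u ^ i` with `i < j` the tail
    -- has low enough degree as it stands, and for `i ≥ j` it is replaced by the head.
    set M : Submodule A Q := Submodule.span A ((fun i : ℕ => u ^ i) '' (Finset.range m : Set ℕ))
    have hmem : ∀ i < m, u ^ i ∈ M := fun i hi =>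
      Submodule.subset_span ⟨i, by simpa using hi, rfl⟩
    have hmem' : ∀ (r : A), ∀ i < m, ι r * u ^ i ∈ M := fun r i hi => by
      rw [← Algebra.smul_def]; exact M.smul_mem r (hmem i hi)
    refine isIntegral_of_mul_mem_span (M := M)
      (Submodule.fg_span ((Finset.range m).finite_toSet.image _))
      (by simpa using hmem 0 (by omega)) ?_
    intro x hx
    induction hx using Submodule.span_induction with
    | zero => rw [mul_zero]; exact M.zero_mem
    | add x y _ _ hx hy => rw [mul_add]; exact M.add_mem hx hy
    | smul r x _ hx => rw [mul_smul_comm]; exact M.smul_mem r hx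
    | mem x hx =>
      obtain ⟨i, hi, rfl⟩ := hx
      have hi' : i < m := by simpa using hi
      change b j * u ^ i ∈ M
      rcases lt_or_ge i j with hij | hij
      · simp only [b]
        rw [Finset.sum_mul]
        refine Submodule.sum_mem _ fun l hl => ?_
        rw [Finset.mem_range] at hl
        rw [mul_assoc, ← pow_add]
        exact hmem' _ _ (by omega)
      · obtain ⟨l, rfl⟩ := Nat.exists_eq_add_of_le hij
        rw [pow_add, ← mul_assoc, mul_comm (b j), hpow j (by omega), neg_mul, Finset.sum_mul]
        refine M.neg_mem (Submodule.sum_mem _ fun l' hl' => ?_)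
        rw [Finset.mem_range] at hl'
        rw [mul_assoc, ← pow_add]
        exact hmem' _ _ (by omega)
  have hint' : ∀ j, IsIntegral A (u * b (j + 1)) := by
    intro j
    rcases lt_or_ge m j with hmj | hmj
    · rw [hbig _ (by omega), mul_zero]; exact isIntegral_zero
    · rw [← add_sub_cancel_right (u * b (j + 1)) (ι (a j)), ← hb j hmj]
      exact (hint j).sub isIntegral_algebraMap
  refine ⟨fun j => ⟨b j, hint j⟩, fun j => ⟨u * b (j + 1), hint' j⟩, Subtype.ext hb0,
    fun j hj => Subtype.ext (hb j hj), fun j => Subtype.ext ?_⟩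
  change ι h * (u * b (j + 1)) = ι q * b (j + 1)
  rw [← mul_assoc, hhu]

end IntegralDivision

end PlaneCurves

namespace PlaneCurves

open MvPolynomial

/-! ### Taylor expansions at a point. -/

section Taylor

variable {K : Type*} [Field K] {L : Type*} [CommRing L] [Algebra K L]

theorem aeval_taylorAt (F : MvPolynomial (Fin 3) K) (s : Fin 3 → K) (w : Fin 3 → L) :
    aeval w (taylorAt F s) = aeval (fun j => algebraMap K L (s j) + w j) F := by
  rw [taylorAt, ← AlgHom.comp_apply, comp_aeval]
  simp

theorem aeval_mul_of_isHomogeneous {σ : Type*} {F : MvPolynomial σ K} {n : ℕ}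
    (hF : F.IsHomogeneous n) (z : L) (w : σ → L) :
    aeval (fun j => z * w j) F = z ^ n * aeval w F := by
  rw [aeval_def, aeval_def, eval₂_eq, eval₂_eq, Finset.mul_sum]
  refine Finset.sum_congr rfl fun d hd => ?_
  simp only [mul_pow]
  rw [Finset.prod_mul_distrib, Finset.prod_pow_eq_pow_sum]
  have : ∑ i ∈ d.support, d i = n := by
    have := hF (mem_support_iff.mp hd)
    rwa [Finsupp.weight_apply, Finsupp.sum, Finset.sum_congr rfl (fun i _ => by
      show d i • (1 : σ → ℕ) i = d i; simp)] at this
  rw [this]; ring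

/-- All terms of degree above `m` contribute multiples of `z ^ (m + 1)`, which `r` collects. It
isolates the leading form of a curve along directions scaled by `z`. -/
theorem exists_aeval_mul_eq {F : MvPolynomial (Fin 3) K} {m : ℕ}
    (hm : ∀ n < m, homogeneousComponent n F = 0) (z : L) (w : Fin 3 → L) :
    ∃ r : L, aeval (fun j => z * w j) F = z ^ m * (aeval w (homogeneousComponent m F) + z * r) := by
  have hsum : ∀ n, F = ∑ i ∈ Finset.range (F.totalDegree + 1 + n), homogeneousComponent i F := by
    intro n
    induction n with
    | zero => exact (sum_homogeneousComponent F).symm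
    | succ n ih =>
      rw [← add_assoc, Finset.sum_range_succ, homogeneousComponent_eq_zero _ _ (by omega), add_zero]
      exact ih
  have hdvd : z ^ (m + 1) ∣ aeval (fun j => z * w j) F -
      z ^ m * aeval w (homogeneousComponent m F) := by
    have h1 : aeval (fun j => z * w j) F = ∑ i ∈ Finset.range (F.totalDegree + 1 + m),
        z ^ i * aeval w (homogeneousComponent i F) := by
      conv_lhs => rw [hsum m, map_sum]
      exact Finset.sum_congr rfl fun i _ =>
        aeval_mul_of_isHomogeneous (homogeneousComponent_isHomogeneous i F) z w
    rw [h1, ← Finset.sum_erase_add _ _ (Finset.mem_range.mpr (by omega : m < F.totalDegree + 1 + m)),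
      add_sub_cancel_right]
    refine Finset.dvd_sum fun i hi => ?_
    rcases lt_or_gt_of_ne (Finset.ne_of_mem_erase hi) with h | h
    · rw [hm i h]; simp
    · exact (pow_dvd_pow z h).mul_right _
  obtain ⟨r, hr⟩ := hdvd
  exact ⟨r, by rw [sub_eq_iff_eq_add] at hr; rw [hr]; ring⟩

theorem pderiv_taylorAt (F : MvPolynomial (Fin 3) K) (s : Fin 3 → K) (j : Fin 3) :
    pderiv j (taylorAt F s) = taylorAt (pderiv j F) s := by
  induction F using MvPolynomial.induction_on with
  | C r => simp [taylorAt, algebraMap_eq]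
  | add p q hp hq =>
    simp only [taylorAt, map_add] at hp hq ⊢
    rw [hp, hq]
  | mul_X p i hp =>
    simp only [taylorAt, map_mul, aeval_X, pderiv_mul, map_add] at hp ⊢
    simp only [pderiv_C, zero_add, pderiv_X]
    rw [hp]
    congr 2
    by_cases h : i = j
    · subst h; simp
    · simp [Pi.single_eq_of_ne h]

theorem coeff_zero_taylorAt (F : MvPolynomial (Fin 3) K) (s : Fin 3 → K) :
    coeff 0 (taylorAt F s) = eval s F := by
  rw [← constantCoeff_eq, taylorAt]
  induction F using MvPolynomial.induction_on with
  | C r => simp [algebraMap_eq]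
  | add p q hp hq => rw [map_add, map_add, map_add, hp, hq]
  | mul_X p i hp => rw [map_mul, map_mul, map_mul, hp]; simp

theorem homogeneousComponent_zero_taylorAt (F : MvPolynomial (Fin 3) K) (s : Fin 3 → K) :
    homogeneousComponent 0 (taylorAt F s) = C (eval s F) := by
  rw [homogeneousComponent_zero, coeff_zero_taylorAt]

theorem coeff_single_taylorAt (F : MvPolynomial (Fin 3) K) (s : Fin 3 → K) (j : Fin 3) :
    coeff (Finsupp.single j 1) (taylorAt F s) = eval s (pderiv j F) := by
  rw [← coeff_zero_taylorAt, ← pderiv_taylorAt, coeff_pderiv]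
  simp

theorem homogeneousComponent_one_taylorAt (F : MvPolynomial (Fin 3) K) (s : Fin 3 → K) :
    homogeneousComponent 1 (taylorAt F s) = ∑ j, C (eval s (pderiv j F)) * X j := by
  ext d
  rw [coeff_homogeneousComponent, coeff_sum]
  split_ifs with h
  · obtain ⟨j, rfl⟩ : ∃ j, d = Finsupp.single j 1 := by
      rwa [Finsupp.degree_eq_sum, ← Finsupp.sum_fintype _ (fun _ n => n) (fun _ => rfl),
        Finsupp.sum_eq_one_iff] at h
    rw [coeff_single_taylorAt, Finset.sum_eq_single j]
    · simp
    · intro i _ hij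
      rw [coeff_C_mul, coeff_X, if_neg, mul_zero]
      intro h
      exact hij (Finsupp.single_left_injective one_ne_zero h)
    · simp
  · symm
    refine Finset.sum_eq_zero fun j _ => ?_
    rw [coeff_C_mul, coeff_X, if_neg, mul_zero]
    rintro rfl
    simp at h

/-- First order Taylor expansion. -/
theorem aeval_add_sub_mem_sq {σ : Type*} [Fintype σ] [DecidableEq σ] (I : Ideal L)
    (F : MvPolynomial σ K) (s : σ → K) {δ : σ → L} (hδ : ∀ j, δ j ∈ I) :
    aeval (fun j => algebraMap K L (s j) + δ j) F - algebraMap K L (eval s F) -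
      ∑ j, δ j * algebraMap K L (eval s (pderiv j F)) ∈ I ^ 2 := by
  induction F using MvPolynomial.induction_on with
  | C r => simp
  | add p q hp hq =>
    convert add_mem hp hq using 1
    simp only [map_add, mul_add, Finset.sum_add_distrib]
    ring
  | mul_X p i hp =>
    set A := aeval (fun j => algebraMap K L (s j) + δ j) p with hA
    set S := ∑ j, δ j * algebraMap K L (eval s (pderiv j p)) with hS
    have hSI : S ∈ I := Submodule.sum_mem _ fun j _ => Ideal.mul_mem_right _ _ (hδ j)
    have hAI : A - algebraMap K L (eval s p) ∈ I := by
      have := add_mem (Ideal.pow_le_self two_ne_zero hp) hSI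
      simpa using this
    have e : ∑ j, δ j * algebraMap K L (eval s (pderiv j (p * X i))) =
        S * algebraMap K L (s i) + δ i * algebraMap K L (eval s p) := by
      have : ∀ j, δ j * algebraMap K L (eval s (pderiv j (p * X i))) =
          δ j * algebraMap K L (eval s (pderiv j p)) * algebraMap K L (s i) +
          (if j = i then δ i * algebraMap K L (eval s p) else 0) := by
        intro j
        rw [pderiv_mul, pderiv_X]
        by_cases h : j = i
        · subst h; simp; ring
        · simp [h]; ring
      rw [Finset.sum_congr rfl fun j _ => this j, Finset.sum_add_distrib, ← Finset.sum_mul,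
        Finset.sum_ite_eq' Finset.univ i, if_pos (Finset.mem_univ i)]
    rw [e, map_mul, aeval_X, map_mul, eval_X, map_mul]
    have : A * (algebraMap K L (s i) + δ i) - algebraMap K L (eval s p) * algebraMap K L (s i) -
        (S * algebraMap K L (s i) + δ i * algebraMap K L (eval s p)) =
        (A - algebraMap K L (eval s p) - S) * algebraMap K L (s i) +
        (A - algebraMap K L (eval s p)) * δ i := by ring
    rw [this]
    refine add_mem (Ideal.mul_mem_right _ _ hp) ?_
    rw [pow_two]
    exact Ideal.mul_mem_mul hAI (hδ i)

theorem taylorAt_ne_zero {F : MvPolynomial (Fin 3) K} (hF : F ≠ 0) (s : Fin 3 → K) :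
    taylorAt F s ≠ 0 := by
  intro h
  apply hF
  have h1 := congrArg (aeval (fun j => X j - C (s j) : Fin 3 → MvPolynomial (Fin 3) K)) h
  rw [aeval_taylorAt, map_zero] at h1
  simpa [algebraMap_eq] using h1

end Taylor

/-! ### Hasse derivatives, in any characteristic. -/

section Hasse

variable {k : Type*} [Field k]

/-- The Hasse derivative of `F` of multiindex `α`. -/
noncomputable def hasseCoeff (α : Fin 3 →₀ ℕ) (F : MvPolynomial (Fin 3) k) : MvPolynomial (Fin 3) k :=
  coeff α (aeval (fun i => C (X i) + X i : Fin 3 → MvPolynomial (Fin 3) (MvPolynomial (Fin 3) k)) F)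

theorem hasseCoeff_add (α : Fin 3 →₀ ℕ) (F G : MvPolynomial (Fin 3) k) :
    hasseCoeff α (F + G) = hasseCoeff α F + hasseCoeff α G := by
  simp only [hasseCoeff, map_add, coeff_add]

theorem hasseCoeff_mul_X (α : Fin 3 →₀ ℕ) (F : MvPolynomial (Fin 3) k) (i : Fin 3) :
    hasseCoeff α (F * X i) = X i * hasseCoeff α F +
      if i ∈ α.support then hasseCoeff (α - Finsupp.single i 1) F else 0 := by
  simp only [hasseCoeff, map_mul, aeval_X]
  rw [mul_add, coeff_add, mul_comm _ (C (X i)), coeff_C_mul, coeff_mul_X']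

theorem hasseCoeff_C (α : Fin 3 →₀ ℕ) (r : k) :
    hasseCoeff α (C r) = C (if 0 = α then r else 0) := by
  rw [hasseCoeff, aeval_C, IsScalarTower.algebraMap_apply k (MvPolynomial (Fin 3) k),
    algebraMap_eq, algebraMap_eq, coeff_C]
  split_ifs <;> simp

/-- It allows the gradient of a Hasse derivative at a point to be read off from Taylor coefficients
one degree higher. -/
theorem pderiv_hasseCoeff (α : Fin 3 →₀ ℕ) (F : MvPolynomial (Fin 3) k) (j : Fin 3) :
    pderiv j (hasseCoeff α F) = hasseCoeff α (pderiv j F) := by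
  have hz : ∀ α : Fin 3 →₀ ℕ, hasseCoeff α (0 : MvPolynomial (Fin 3) k) = 0 := fun α => by
    simp [hasseCoeff]
  induction F using MvPolynomial.induction_on generalizing α with
  | C r => rw [hasseCoeff_C, pderiv_C, pderiv_C, hz]
  | add p q hp hq => rw [hasseCoeff_add, map_add, map_add, hasseCoeff_add, hp, hq]
  | mul_X p i hp =>
    have e : pderiv j (if i ∈ α.support then hasseCoeff (α - Finsupp.single i 1) p else 0) =
        if i ∈ α.support then hasseCoeff (α - Finsupp.single i 1) (pderiv j p) else 0 := by
      split_ifs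
      · exact hp _
      · exact map_zero _
    rw [hasseCoeff_mul_X, map_add, pderiv_mul, pderiv_mul, e, hp, hasseCoeff_add, hasseCoeff_mul_X,
      pderiv_X]
    by_cases h : i = j
    · subst h; simp; ring
    · simp [Pi.single_eq_of_ne h, hz]

/-- Taylor coefficients at a `K`-point are values of polynomials over `k`. For this reason an
auxiliary curve can be found over `k`, as needed in the normalisation over `k`. -/
theorem aeval_hasseCoeff {K : Type*} [Field K] [Algebra k K] (α : Fin 3 →₀ ℕ)
    (F : MvPolynomial (Fin 3) k) (s : Fin 3 → K) :
    aeval s (hasseCoeff α F) = coeff α (taylorAt (map (algebraMap k K) F) s) := by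
  have : taylorAt (map (algebraMap k K) F) s = map (aeval s : MvPolynomial (Fin 3) k →ₐ[k] K).toRingHom
      (aeval (fun i => C (X i) + X i : Fin 3 → MvPolynomial (Fin 3) (MvPolynomial (Fin 3) k)) F) := by
    rw [taylorAt, aeval_map_algebraMap]
    induction F using MvPolynomial.induction_on with
    | C r =>
      rw [aeval_C, aeval_C, IsScalarTower.algebraMap_apply k K,
        IsScalarTower.algebraMap_apply k (MvPolynomial (Fin 3) k)
          (MvPolynomial (Fin 3) (MvPolynomial (Fin 3) k))]
      simp only [algebraMap_eq, map_C]
      congr 1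
      exact (aeval_C s r).symm
    | add p q hp hq => rw [map_add, map_add, map_add, hp, hq]
    | mul_X p i hp => rw [map_mul, map_mul, map_mul, hp]; simp
  rw [this, coeff_map]
  rfl

end Hasse

end PlaneCurves

namespace PlaneCurves

open MvPolynomial

theorem homogeneousComponent_mul_of_isHomogeneous {σ R : Type*} [CommRing R]
    {F : MvPolynomial σ R} {d : ℕ} (hF : F.IsHomogeneous d) (G : MvPolynomial σ R) (n : ℕ) :
    homogeneousComponent n (F * G) =
      if d ≤ n then F * homogeneousComponent (n - d) G else 0 := by
  have h1 : F * G = ∑ j ∈ Finset.range (G.totalDegree + 1), F * homogeneousComponent j G := by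
    rw [← Finset.mul_sum, sum_homogeneousComponent]
  rw [h1, map_sum]
  have h2 : ∀ j, homogeneousComponent n (F * homogeneousComponent j G) =
      if d + j = n then F * homogeneousComponent j G else 0 := fun j =>
    homogeneousComponent_of_mem (hF.mul (homogeneousComponent_isHomogeneous j G)) |>.trans (by
      simp only [eq_comm])
  rw [Finset.sum_congr rfl fun j _ => h2 j]
  split_ifs with h
  · by_cases hn : n - d < G.totalDegree + 1
    · rw [Finset.sum_eq_single (n - d), if_pos (by omega)]
      · intro j _ hj
        rw [if_neg (by omega)]
      · intro h
        exact absurd (Finset.mem_range.mpr hn) h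
    · rw [homogeneousComponent_eq_zero _ _ (by omega), mul_zero]
      refine Finset.sum_eq_zero fun j hj => ?_
      rw [Finset.mem_range] at hj
      rw [if_neg (by omega)]
  · refine Finset.sum_eq_zero fun j _ => ?_
    rw [if_neg (by omega)]

/-! ### The local ring of the plane in an affine chart. -/

section LocalRing

variable {k K : Type*} [Field k] [Field K] [Algebra k K] {s : Fin 3 → K} {i : Fin 3}

instance (s : Fin 3 → K) : IsDomain (PlaneLocalRing k s) :=
  inferInstanceAs (IsDomain (planeFractions k s))

theorem toFractions_injective (s : Fin 3 → K) : Function.Injective (toFractions k s) :=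
  Subtype.val_injective

theorem X_mem_primeCompl (hi : s i ≠ 0) :
    (X i : MvPolynomial (Fin 3) k) ∈ (pointIdeal k s).primeCompl := by
  intro h
  apply hi
  have : aeval s (X i : MvPolynomial (Fin 3) k) = 0 := h
  rwa [aeval_X] at this

/-- The fraction `X j / X i`. -/
noncomputable def planeCoord (hi : s i ≠ 0) (j : Fin 3) : PlaneLocalRing k s :=
  ⟨IsLocalization.mk' _ (X j) ⟨X i, X_mem_primeCompl hi⟩,
    1, X j, X i, isHomogeneous_X _ _, isHomogeneous_X _ _, by rwa [aeval_X],
    IsLocalization.mk'_spec _ (X j) (⟨X i, X_mem_primeCompl hi⟩ : (pointIdeal k s).primeCompl)⟩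

/-- The homomorphism `G ↦ G(X / X i)`. -/
noncomputable def dehomogenize (k : Type*) [Field k] [Algebra k K] (hi : s i ≠ 0) :
    MvPolynomial (Fin 3) k →ₐ[k] PlaneLocalRing k s :=
  aeval (planeCoord hi)

theorem toFractions_planeCoord_mul (hi : s i ≠ 0) (j : Fin 3) :
    toFractions k s (planeCoord hi j) * algebraMap _ _ (X i : MvPolynomial (Fin 3) k) =
      algebraMap _ _ (X j : MvPolynomial (Fin 3) k) :=
  IsLocalization.mk'_spec _ (X j) (⟨X i, X_mem_primeCompl hi⟩ : (pointIdeal k s).primeCompl)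

theorem algebraMap_fractions_injective (s : Fin 3 → K) : Function.Injective
    (algebraMap (MvPolynomial (Fin 3) k) (Localization.AtPrime (pointIdeal k s))) :=
  IsLocalization.injective _ (pointIdeal k s).primeCompl_le_nonZeroDivisors

theorem dehomogenize_X_self (hi : s i ≠ 0) : dehomogenize k hi (X i) = 1 := by
  apply toFractions_injective
  have h := toFractions_planeCoord_mul (k := k) hi i
  rw [dehomogenize, aeval_X, map_one]
  refine mul_right_cancel₀ ?_ (h.trans (one_mul _).symm)
  rw [map_ne_zero_iff _ (algebraMap_fractions_injective s)]
  exact X_ne_zero i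

theorem toFractions_dehomogenize (hi : s i ≠ 0) {G : MvPolynomial (Fin 3) k} {n : ℕ}
    (hG : G.IsHomogeneous n) :
    toFractions k s (dehomogenize k hi G) *
      algebraMap (MvPolynomial (Fin 3) k) _ (X i ^ n) = algebraMap _ _ G := by
  set B := Localization.AtPrime (pointIdeal k s)
  have h1 : toFractions k s (dehomogenize k hi G) =
      aeval (fun j => toFractions k s (planeCoord hi j)) G := by
    rw [dehomogenize, ← AlgHom.comp_apply, comp_aeval]
  have h2 := aeval_mul_of_isHomogeneous (L := B) hG
    (algebraMap (MvPolynomial (Fin 3) k) B (X i)) (fun j => toFractions k s (planeCoord hi j))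
  rw [h1, map_pow, mul_comm, ← h2]
  have h3 : (fun j => algebraMap (MvPolynomial (Fin 3) k) B (X i) *
      toFractions k s (planeCoord hi j)) =
      fun j => (IsScalarTower.toAlgHom k (MvPolynomial (Fin 3) k) B) (X j) := by
    funext j
    rw [mul_comm, toFractions_planeCoord_mul]
    rfl
  rw [h3, ← comp_aeval, AlgHom.comp_apply, aeval_X_left_apply]
  rfl

theorem evalAt_mul_of_eq {a : PlaneLocalRing k s} {G H : MvPolynomial (Fin 3) k}
    (h : toFractions k s a * algebraMap _ _ H = algebraMap _ _ G) :
    evalAt k s a * aeval s H = aeval s G := by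
  have h1 : ∀ G : MvPolynomial (Fin 3) k, IsLocalization.liftAlgHom (M := (pointIdeal k s).primeCompl)
      (f := (aeval s : MvPolynomial (Fin 3) k →ₐ[k] K))
      (fun y => isUnit_iff_ne_zero.mpr fun h => y.2 h)
      (algebraMap _ (Localization.AtPrime (pointIdeal k s)) G) = aeval s G := by
    intro G
    exact IsLocalization.lift_eq _ G
  rw [← h1 H, ← h1 G, ← h, map_mul]
  rfl

theorem evalAt_dehomogenize (hi : s i ≠ 0) (G : MvPolynomial (Fin 3) k) :
    evalAt k s (dehomogenize k hi G) = aeval (fun j => s j / s i) G := by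
  rw [dehomogenize, ← AlgHom.comp_apply, comp_aeval]
  congr 2
  funext j
  have := evalAt_mul_of_eq (toFractions_planeCoord_mul (k := k) hi j)
  rw [aeval_X, aeval_X] at this
  exact eq_div_of_mul_eq hi this

theorem aeval_eq_pow_mul (hi : s i ≠ 0) {G : MvPolynomial (Fin 3) k} {n : ℕ}
    (hG : G.IsHomogeneous n) : aeval s G = s i ^ n * aeval (fun j => s j / s i) G := by
  rw [← aeval_mul_of_isHomogeneous hG]
  congr 2
  funext j
  rw [mul_div_cancel₀ _ hi]

theorem exists_mul_dehomogenize_eq (hi : s i ≠ 0) (a : PlaneLocalRing k s) :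
    ∃ G H : MvPolynomial (Fin 3) k, evalAt k s (dehomogenize k hi H) ≠ 0 ∧
      a * dehomogenize k hi H = dehomogenize k hi G := by
  obtain ⟨n, G, H, hG, hH, hs, e⟩ := a.2
  refine ⟨G, H, ?_, ?_⟩
  · rw [evalAt_dehomogenize]
    intro h
    rw [aeval_eq_pow_mul hi hH, h, mul_zero] at hs
    exact hs rfl
  · apply toFractions_injective
    have hX : algebraMap (MvPolynomial (Fin 3) k) (Localization.AtPrime (pointIdeal k s)) (X i ^ n) ≠ 0 := by
      rw [map_ne_zero_iff _ (algebraMap_fractions_injective s)]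
      exact pow_ne_zero _ (X_ne_zero i)
    refine mul_right_cancel₀ hX ?_
    rw [map_mul, mul_assoc, toFractions_dehomogenize hi hH, toFractions_dehomogenize hi hG]
    exact e

theorem isUnit_of_evalAt_ne_zero {a : PlaneLocalRing k s} (ha : evalAt k s a ≠ 0) : IsUnit a := by
  obtain ⟨n, G, H, hG, hH, hs, e⟩ := a.2
  have h1 : aeval s G ≠ 0 := by
    rw [← evalAt_mul_of_eq (a := a) e]
    exact mul_ne_zero ha hs
  let b : PlaneLocalRing k s := ⟨IsLocalization.mk' _ H (⟨G, h1⟩ : (pointIdeal k s).primeCompl),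
    n, H, G, hH, hG, h1, IsLocalization.mk'_spec _ H (⟨G, h1⟩ : (pointIdeal k s).primeCompl)⟩
  refine IsUnit.of_mul_eq_one b ?_
  apply toFractions_injective
  have h2 : toFractions k s b * algebraMap _ _ G = algebraMap _ _ H :=
    IsLocalization.mk'_spec _ H (⟨G, h1⟩ : (pointIdeal k s).primeCompl)
  have hH0 : algebraMap (MvPolynomial (Fin 3) k) (Localization.AtPrime (pointIdeal k s)) H ≠ 0 := by
    rw [map_ne_zero_iff _ (algebraMap_fractions_injective s)]
    rintro rfl
    exact hs (map_zero _)
  refine mul_right_cancel₀ hH0 ?_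
  have e' : toFractions k s a * algebraMap _ _ H = algebraMap _ _ G := e
  rw [map_mul, mul_right_comm, e', mul_comm, h2, map_one, one_mul]

theorem evalAt_ne_zero_of_isUnit {a : PlaneLocalRing k s} (ha : IsUnit a) : evalAt k s a ≠ 0 :=
  (ha.map (evalAt k s)).ne_zero

/-- `curveIdeal` allows arbitrary cofactors in the localisation. The point is to replace the
cofactor by a quotient of forms, so that division by `F` takes place in the local ring itself. -/
theorem curveIdeal_eq_span (hi : s i ≠ 0) {F : MvPolynomial (Fin 3) k} {d : ℕ}
    (hF : F.IsHomogeneous d) : curveIdeal F s = Ideal.span {dehomogenize k hi F} := by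
  set B := Localization.AtPrime (pointIdeal k s)
  set ι := algebraMap (MvPolynomial (Fin 3) k) B with hι
  have hinj : Function.Injective ι := algebraMap_fractions_injective s
  have hXu : ∀ n, IsUnit (ι (X i ^ n)) := fun n => by
    rw [map_pow]
    exact (IsLocalization.map_units B (⟨X i, X_mem_primeCompl hi⟩ : (pointIdeal k s).primeCompl)).pow n
  have hFX := toFractions_dehomogenize hi hF
  apply le_antisymm
  · intro a ha
    rw [curveIdeal, Ideal.mem_comap, Ideal.mem_span_singleton] at ha
    obtain ⟨c, hc⟩ := ha
    obtain ⟨n, G, H, hG, hH, hs, e⟩ := a.2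
    have e' : toFractions k s a * ι H = ι G := e
    obtain ⟨⟨G', H'⟩, hGH⟩ := IsLocalization.surj (pointIdeal k s).primeCompl c
    have e1 : G * H' = (F * H) * G' := by
      apply hinj
      change c * ι H' = ι G' at hGH
      change toFractions k s a = ι F * c at hc
      rw [map_mul, map_mul, map_mul, ← hGH, ← e', hc]
      ring
    -- A denominator that is nonzero at `s` has a homogeneous component that is nonzero at `s`;
    -- comparing components of degree `n + m` then gives a homogeneous relation.
    obtain ⟨m, hm⟩ : ∃ m, aeval s (homogeneousComponent m (H' : MvPolynomial (Fin 3) k)) ≠ 0 := by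
      by_contra! hcon
      apply H'.2
      change aeval s (H' : MvPolynomial (Fin 3) k) = 0
      rw [← sum_homogeneousComponent (H' : MvPolynomial (Fin 3) k), map_sum]
      exact Finset.sum_eq_zero fun j _ => hcon j
    set Hm := homogeneousComponent m (H' : MvPolynomial (Fin 3) k) with hHm
    have hHm' : Hm.IsHomogeneous m := homogeneousComponent_isHomogeneous m _
    have e2 := congrArg (homogeneousComponent (n + m)) e1
    rw [homogeneousComponent_mul_of_isHomogeneous hG,
      homogeneousComponent_mul_of_isHomogeneous (hF.mul hH), if_pos (by omega),
      Nat.add_sub_cancel_left] at e2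
    have hGdvd : ∃ Q : MvPolynomial (Fin 3) k, G * Hm = F * H * Q := by
      split_ifs at e2 with hle
      · exact ⟨_, e2⟩
      · exact ⟨0, by rw [hHm, e2, mul_zero]⟩
    obtain ⟨Q, hQ⟩ : ∃ Q : MvPolynomial (Fin 3) k, G * Hm = F * H * Q := hGdvd
    have hH1 : IsUnit (dehomogenize k hi H) := isUnit_of_evalAt_ne_zero (by
      rw [evalAt_dehomogenize]
      intro h
      rw [aeval_eq_pow_mul hi hH, h, mul_zero] at hs
      exact hs rfl)
    have hHm1 : IsUnit (dehomogenize k hi Hm) := isUnit_of_evalAt_ne_zero (by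
      rw [evalAt_dehomogenize]
      intro h
      rw [aeval_eq_pow_mul hi hHm', h, mul_zero] at hm
      exact hm rfl)
    have e3 : a * dehomogenize k hi H = dehomogenize k hi G := by
      apply toFractions_injective
      refine (hXu n).mul_right_cancel ?_
      rw [map_mul, mul_assoc, toFractions_dehomogenize hi hH, toFractions_dehomogenize hi hG]
      exact e
    have e4 : a * (dehomogenize k hi H * dehomogenize k hi Hm) =
        dehomogenize k hi F * (dehomogenize k hi H * dehomogenize k hi Q) := by
      rw [← mul_assoc, e3, ← map_mul, hQ, map_mul, map_mul, mul_assoc]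
    rw [Ideal.mem_span_singleton, ← (hH1.mul hHm1).dvd_mul_right, e4]
    exact dvd_mul_right _ _
  · rw [Ideal.span_singleton_le_iff_mem, curveIdeal, Ideal.mem_comap, Ideal.mem_span_singleton,
      ← (hXu d).dvd_mul_right]
    exact dvd_of_eq hFX.symm

-- A formal arc centred at the point defines a homomorphism on the local ring, because every
-- denominator acquires a nonzero constant term.
open PowerSeries in
theorem exists_arc (hi : s i ≠ 0) {c : Fin 3 → K⟦X⟧}
    (hc : ∀ j, constantCoeff (c j) = s j / s i) (hci : c i = 1) :
    ∃ φ : PlaneLocalRing k s →ₐ[k] K⟦X⟧,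
      (∀ G, φ (dehomogenize k hi G) = MvPolynomial.aeval c G) ∧
      ∀ a, constantCoeff (φ a) = evalAt k s a := by
  -- The factor `s i` rescales the chart coordinates, so that the arc starts at the vector `s`
  -- itself; `pointIdeal` contains inhomogeneous polynomials as well.
  set f : MvPolynomial (Fin 3) k →ₐ[k] K⟦X⟧ := MvPolynomial.aeval fun j => PowerSeries.C (s i) * c j with hf
  have hconst : ∀ G, constantCoeff (f G) = MvPolynomial.aeval s G := by
    intro G
    rw [hf]
    induction G using MvPolynomial.induction_on with
    | C r =>
      rw [MvPolynomial.aeval_C, MvPolynomial.aeval_C, IsScalarTower.algebraMap_apply k K K⟦X⟧]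
      exact PowerSeries.constantCoeff_C _
    | add p q hp hq => rw [map_add, map_add, map_add, hp, hq]
    | mul_X p j hp =>
      rw [map_mul, map_mul, map_mul, hp, MvPolynomial.aeval_X, MvPolynomial.aeval_X, map_mul, hc,
        PowerSeries.constantCoeff_C, mul_div_cancel₀ _ hi]
  have hunit : ∀ y : (pointIdeal k s).primeCompl, IsUnit (f y) := fun y => by
    rw [PowerSeries.isUnit_iff_constantCoeff, hconst, isUnit_iff_ne_zero]
    exact fun h => y.2 h
  set g := IsLocalization.liftAlgHom (S := Localization.AtPrime (pointIdeal k s)) (f := f) hunit with hg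
  have hgf : ∀ G, g (algebraMap _ _ G) = f G := fun G => IsLocalization.lift_eq _ G
  have hφ : ∀ {a : PlaneLocalRing k s} {G H : MvPolynomial (Fin 3) k},
      toFractions k s a * algebraMap _ _ H = algebraMap _ _ G →
      g (toFractions k s a) * f H = f G := by
    intro a G H h
    rw [← hgf H, ← hgf G, ← map_mul, h]
  have hne : PowerSeries.C (s i) ≠ (0 : K⟦X⟧) := by
    rw [map_ne_zero_iff _ C_injective]; exact hi
  refine ⟨g.comp (toFractions k s), ?_, ?_⟩
  · intro G
    rw [dehomogenize, ← AlgHom.comp_apply, MvPolynomial.comp_aeval]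
    congr 2
    funext j
    have := hφ (toFractions_planeCoord_mul (k := k) hi j)
    rw [hf, MvPolynomial.aeval_X, MvPolynomial.aeval_X, hci, mul_one, mul_comm] at this
    exact mul_left_cancel₀ hne this
  · intro a
    obtain ⟨n, G, H, hG, hH, hs, e⟩ := a.2
    have h1 := congrArg PowerSeries.constantCoeff (hφ (a := a) e)
    rw [map_mul, hconst, hconst, ← evalAt_mul_of_eq (a := a) e] at h1
    exact mul_right_cancel₀ hs h1

end LocalRing

end PlaneCurves

namespace PlaneCurves

open MvPolynomial

/-! ### Frames at a point of an affine chart. -/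

section Frame

variable {K : Type*} [Field K]

/-- The vectors `v` and `w` form a basis of the plane `u i = 0`, and `p` lies in the affine chart
given by the coordinate `i`. -/
structure IsFrame (i : Fin 3) (p v w : Fin 3 → K) : Prop where
  base : p i = 1
  fst : v i = 0
  snd : w i = 0
  exists_coord : ∃ f g : Fin 3 → K, ∀ j l, l ≠ i → (if j = l then 1 else 0) = f l * v j + g l * w j

theorem IsFrame.eq_zero {i : Fin 3} {p v w : Fin 3 → K} (h : IsFrame i p v w) {l : Fin 3 → K}
    (hp : ∑ j, l j * p j = 0) (hv : ∑ j, l j * v j = 0) (hw : ∑ j, l j * w j = 0) : l = 0 := by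
  obtain ⟨f, g, hfg⟩ := h.exists_coord
  have h1 : ∀ a, a ≠ i → l a = 0 := by
    intro a ha
    have : l a = ∑ j, l j * (if j = a then 1 else 0) := by simp
    rw [this, Finset.sum_congr rfl fun j _ => by rw [hfg j a ha]]
    have : ∑ j, l j * (f a * v j + g a * w j) = f a * ∑ j, l j * v j + g a * ∑ j, l j * w j := by
      rw [Finset.mul_sum, Finset.mul_sum, ← Finset.sum_add_distrib]
      exact Finset.sum_congr rfl fun j _ => by ring
    rw [this, hv, hw, mul_zero, mul_zero, add_zero]
  have h2 : l i = 0 := by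
    rw [Finset.sum_eq_single i (fun j _ hj => by rw [h1 j hj, zero_mul]) (by simp), h.base,
      mul_one] at hp
    exact hp
  funext a
  by_cases ha : a = i
  · rw [ha]; exact h2
  · exact h1 a ha

/-- The elements `x` and `y` are the coordinates of `ξ - p` in the frame. They are `K`-linear
combinations of these differences, hence lie in every ideal that contains them. -/
theorem IsFrame.exists_decomposition {i : Fin 3} {p v w : Fin 3 → K} (h : IsFrame i p v w)
    {L : Type*} [CommRing L] [Algebra K L] {ξ : Fin 3 → L} (hξ : ξ i = 1) :
    ∃ x y : L, (∀ j, ξ j = algebraMap K L (p j) +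
      (x * algebraMap K L (v j) + y * algebraMap K L (w j))) ∧
      ∀ I : Ideal L, (∀ j, ξ j - algebraMap K L (p j) ∈ I) → x ∈ I ∧ y ∈ I := by
  obtain ⟨f, g, hfg⟩ := h.exists_coord
  refine ⟨∑ l, algebraMap K L (f l) * (ξ l - algebraMap K L (p l)),
    ∑ l, algebraMap K L (g l) * (ξ l - algebraMap K L (p l)), fun j => ?_, fun I hI =>
      ⟨Submodule.sum_mem _ fun l _ => Ideal.mul_mem_left _ _ (hI l),
        Submodule.sum_mem _ fun l _ => Ideal.mul_mem_left _ _ (hI l)⟩⟩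
  have h1 : ξ j - algebraMap K L (p j) =
      ∑ l, algebraMap K L (if j = l then 1 else 0) * (ξ l - algebraMap K L (p l)) := by
    rw [Finset.sum_eq_single j]
    · simp
    · intro l _ hl
      rw [if_neg (Ne.symm hl), map_zero, zero_mul]
    · simp
  rw [← sub_eq_iff_eq_add', h1, Finset.sum_mul, Finset.sum_mul, ← Finset.sum_add_distrib]
  refine Finset.sum_congr rfl fun l _ => ?_
  by_cases hl : l = i
  · subst hl
    simp [hξ, h.base]
  · rw [hfg j l hl, map_add, map_mul, map_mul]
    ring

/-- Take `w = e₁ + r e₂` with `e₁, e₂` the unit vectors other than the one of index `i`. A nonzero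
form that vanishes at `p` is nonzero on the plane they span, so it excludes at most one value of
`r`. -/
theorem exists_isFrame [Infinite K] (i : Fin 3) {p : Fin 3 → K} (hp : p i = 1) {ι : Type*} [Fintype ι]
    {l : ι → Fin 3 → K} (hl : ∀ a, l a ≠ 0) (hlp : ∀ a, ∑ j, l a j * p j = 0) :
    ∃ v w : Fin 3 → K, IsFrame i p v w ∧ ∀ a, ∑ j, l a j * w j ≠ 0 := by
  set j₁ := i.succAbove 0 with hj₁
  set j₂ := i.succAbove 1 with hj₂
  have h1i : j₁ ≠ i := Fin.succAbove_ne i 0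
  have h2i : j₂ ≠ i := Fin.succAbove_ne i 1
  have h12 : j₁ ≠ j₂ := fun h => by simpa using Fin.succAbove_right_injective h
  have hcases : ∀ j, j = i ∨ j = j₁ ∨ j = j₂ := by
    intro j
    rcases eq_or_ne j i with h | h
    · exact Or.inl h
    · obtain ⟨a, rfl⟩ := Fin.exists_succAbove_eq h
      fin_cases a
      · exact Or.inr (Or.inl rfl)
      · exact Or.inr (Or.inr rfl)
  have hP : (∏ a, (Polynomial.C (l a j₁) + Polynomial.C (l a j₂) * Polynomial.X)) ≠ 0 := by
    rw [Finset.prod_ne_zero_iff]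
    intro a _ h0
    have e1 : l a j₁ = 0 := by simpa using congrArg (Polynomial.coeff · 0) h0
    have e2 : l a j₂ = 0 := by simpa using congrArg (Polynomial.coeff · 1) h0
    apply hl a
    have e3 : l a i = 0 := by
      have := hlp a
      rwa [Finset.sum_eq_single i _ (by simp), hp, mul_one] at this
      intro j _ hj
      rcases hcases j with h | h | h
      · exact absurd h hj
      · rw [h, e1, zero_mul]
      · rw [h, e2, zero_mul]
    funext j
    rcases hcases j with h | h | h
    · rw [h]; exact e3
    · rw [h]; exact e1
    · rw [h]; exact e2
  obtain ⟨r, hr⟩ : ∃ r : K, (∏ a, (Polynomial.C (l a j₁) + Polynomial.C (l a j₂) * Polynomial.X)).eval r ≠ 0 := by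
    by_contra! h
    exact hP (Polynomial.funext fun r => by rw [h r, Polynomial.eval_zero])
  rw [Polynomial.eval_prod, Finset.prod_ne_zero_iff] at hr
  refine ⟨Pi.single j₂ 1, Pi.single j₁ 1 + Pi.single j₂ r, ⟨hp, ?_, ?_,
    Pi.single j₂ 1 - Pi.single j₁ r, Pi.single j₁ 1, ?_⟩, ?_⟩
  · exact Pi.single_eq_of_ne (Ne.symm h2i) _
  · simp [h1i.symm, h2i.symm]
  · intro j a ha
    rcases hcases a with h | h | h
    · exact absurd h ha
    all_goals
      rcases hcases j with h' | h' | h' <;> subst h <;> subst h' <;>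
        simp [h12, h12.symm, h1i.symm, h2i.symm]
  · intro a
    have := hr a (Finset.mem_univ a)
    simp only [Polynomial.eval_add, Polynomial.eval_C, Polynomial.eval_mul, Polynomial.eval_X] at this
    intro h0
    apply this
    rw [← h0]
    simp [Pi.single_apply, mul_add, Finset.sum_add_distrib]

end Frame

/-! ### Branches at an ordinary point, by Hensel's lemma. -/

section Branches

open PowerSeries in
/-- The branches of the curve `F = 0` at an ordinary point `p` of multiplicity `m`, none of them
tangent to `w`, as roots of `F(p + t v + t Y w) / t ^ m`. -/
structure Branches {K : Type*} [Field K] (F : MvPolynomial (Fin 3) K) (p v w : Fin 3 → K) (m : ℕ) where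
  poly : Polynomial (Polynomial K)
  slope : Fin m → K
  series : Fin m → K⟦X⟧
  aeval_eq : MvPolynomial.aeval (fun j => algebraMap K (Polynomial (Polynomial K)) (p j) +
    (Polynomial.C Polynomial.X * algebraMap K (Polynomial (Polynomial K)) (v j) +
    Polynomial.C Polynomial.X * Polynomial.X * algebraMap K (Polynomial (Polynomial K)) (w j))) F =
      Polynomial.C Polynomial.X ^ m * poly
  slope_injective : Function.Injective slope
  constantCoeff_series : ∀ a, constantCoeff (series a) = slope a
  eval_series : ∀ a, poly.eval₂ Polynomial.coeToPowerSeries.ringHom (series a) = 0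
  exists_eq_slope : ∀ b, poly.eval₂ Polynomial.constantCoeff b = 0 → ∃ a, b = slope a
  derivative_ne_zero : ∀ a, poly.derivative.eval₂ Polynomial.constantCoeff (slope a) ≠ 0

variable {K : Type*} [Field K] {F : MvPolynomial (Fin 3) K} {p v w : Fin 3 → K} {m : ℕ}

/-- Modulo the parameter, `F(p + t v + t Y w) / t ^ m` is `c ∏ (β a + α a Y)`, where `β a` and `α a`
are the values of the tangent form `l a` at `v` and `w`. The conditions `hw` and `hdet` make this a
product of linear factors with distinct roots `-β a / α a`, each of which lifts. -/
theorem exists_branches (hlow : ∀ n < m, homogeneousComponent n (taylorAt F p) = 0) {c : K} (hc : c ≠ 0)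
    {l : Fin m → Fin 3 → K}
    (hlead : homogeneousComponent m (taylorAt F p) = C c * ∏ a, ∑ j, C (l a j) * X j)
    (hw : ∀ a, ∑ j, l a j * w j ≠ 0)
    (hdet : ∀ a b, a ≠ b →
      (∑ j, l a j * v j) * (∑ j, l b j * w j) ≠ (∑ j, l b j * v j) * (∑ j, l a j * w j)) :
    Nonempty (Branches F p v w m) := by
  obtain ⟨r, hr⟩ := exists_aeval_mul_eq hlow (L := Polynomial (Polynomial K))
    (Polynomial.C Polynomial.X) (fun j => algebraMap K (Polynomial (Polynomial K)) (v j) +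
      Polynomial.X * algebraMap K (Polynomial (Polynomial K)) (w j))
  rw [aeval_taylorAt] at hr
  set Φ := (aeval (fun j => algebraMap K (Polynomial (Polynomial K)) (v j) +
      Polynomial.X * algebraMap K (Polynomial (Polynomial K)) (w j)))
      (homogeneousComponent m (taylorAt F p)) + Polynomial.C Polynomial.X * r with hΦ
  set β : Fin m → K := fun a => ∑ j, l a j * v j with hβ
  set α : Fin m → K := fun a => ∑ j, l a j * w j with hα
  have hmap : Φ.map Polynomial.constantCoeff =
      Polynomial.C c * ∏ a, (Polynomial.C (β a) + Polynomial.C (α a) * Polynomial.X) := by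
    have e1 : ∀ x : K, algebraMap K (Polynomial (Polynomial K)) x = Polynomial.C (Polynomial.C x) :=
      fun _ => rfl
    rw [hΦ, hlead]
    simp only [map_mul, map_prod, map_sum, aeval_X, aeval_C, e1, Polynomial.map_add,
      Polynomial.map_mul, Polynomial.map_C, Polynomial.map_X, Polynomial.map_prod, Polynomial.map_sum]
    simp only [Polynomial.constantCoeff_apply, Polynomial.coeff_X_zero, Polynomial.coeff_C_zero,
      map_zero, zero_mul, add_zero]
    congr 1
    refine Finset.prod_congr rfl fun a _ => ?_
    rw [hβ, hα]
    simp only [map_sum, map_mul, Finset.sum_mul, ← Finset.sum_add_distrib]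
    exact Finset.sum_congr rfl fun j _ => by ring
  have heval : ∀ b, Φ.eval₂ Polynomial.constantCoeff b = c * ∏ a, (β a + α a * b) := by
    intro b
    rw [← Polynomial.eval_map, hmap]
    simp [Polynomial.eval_prod]
  have hslope : ∀ a, β a + α a * (-β a / α a) = 0 := fun a => by
    rw [mul_div_cancel₀ _ (hw a), add_neg_cancel]
  have hder : ∀ a, Φ.derivative.eval₂ Polynomial.constantCoeff (-β a / α a) ≠ 0 := by
    intro a
    rw [← Polynomial.eval_map, ← Polynomial.derivative_map, hmap,
      ← Finset.mul_prod_erase _ _ (Finset.mem_univ a)]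
    simp only [Polynomial.derivative_mul, Polynomial.derivative_C, Polynomial.derivative_add,
      Polynomial.derivative_X, Polynomial.eval_add, Polynomial.eval_mul, Polynomial.eval_C,
      Polynomial.eval_X, hslope, Polynomial.eval_prod]
    simp only [zero_mul, Polynomial.eval_zero, zero_add, Polynomial.eval_one, mul_one, add_zero]
    refine mul_ne_zero hc (mul_ne_zero (hw a) (Finset.prod_ne_zero_iff.mpr fun b hb h0 => ?_))
    refine hdet a b (Finset.ne_of_mem_erase hb).symm ?_
    have hα' := hw a
    change β a * α b = β b * α a
    change α a ≠ 0 at hα'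
    field_simp at h0
    linear_combination (-1 : K) * h0
  have hroot : ∀ a, ∃ γ : PowerSeries K, PowerSeries.constantCoeff γ = -β a / α a ∧
      Φ.eval₂ Polynomial.coeToPowerSeries.ringHom γ = 0 := by
    intro a
    have hcc : (PowerSeries.constantCoeff (R := K)).comp Polynomial.coeToPowerSeries.ringHom =
        Polynomial.constantCoeff := by
      ext <;> simp
    obtain ⟨γ, h1, h2⟩ := exists_powerSeries_root (Φ.map Polynomial.coeToPowerSeries.ringHom)
      (-β a / α a) (by rw [Polynomial.eval₂_map, hcc, heval,
        Finset.prod_eq_zero (Finset.mem_univ a) (hslope a), mul_zero])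
      (by rw [Polynomial.derivative_map, Polynomial.eval₂_map, hcc]; exact hder a)
    exact ⟨γ, h1, by rwa [Polynomial.eval_map] at h2⟩
  choose γ hγ hγ' using hroot
  refine ⟨⟨Φ, fun a => -β a / α a, γ, ?_, ?_, hγ, hγ', ?_, hder⟩⟩
  · rw [← hr]
    congr 2
    funext j
    ring
  · intro a b hab
    by_contra hne
    apply hdet a b hne
    have h1 : α a ≠ 0 := hw a
    have h2 : α b ≠ 0 := hw b
    change -β a / α a = -β b / α b at hab
    change β a * α b = β b * α a
    rw [div_eq_div_iff h1 h2] at hab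
    linear_combination (-1 : K) * hab
  · intro b hb
    rw [heval, mul_eq_zero, or_iff_right hc, Finset.prod_eq_zero_iff] at hb
    obtain ⟨a, _, ha⟩ := hb
    refine ⟨a, ?_⟩
    rw [eq_div_iff (hw a)]
    linear_combination ha

theorem toRingHom_aeval_X (K : Type*) [Field K] :
    (Polynomial.aeval (PowerSeries.X : PowerSeries K) : Polynomial K →ₐ[K] PowerSeries K).toRingHom =
      Polynomial.coeToPowerSeries.ringHom := by
  refine Polynomial.ringHom_ext (fun r => ?_) ?_
  · change Polynomial.aeval _ (Polynomial.C r) = _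
    rw [Polynomial.aeval_C, Polynomial.coeToPowerSeries.ringHom_apply, Polynomial.coe_C]
    rfl
  · change Polynomial.aeval _ Polynomial.X = _
    rw [Polynomial.aeval_X, Polynomial.coeToPowerSeries.ringHom_apply, Polynomial.coe_X]

namespace Branches

variable (B : Branches F p v w m) {L : Type*} [CommRing L] [Algebra K L]

theorem aeval_eq_pow_mul (x ℓ : L) :
    aeval (fun j => algebraMap K L (p j) + (x * algebraMap K L (v j) + x * ℓ * algebraMap K L (w j))) F =
      x ^ m * B.poly.eval₂ (Polynomial.aeval x : Polynomial K →ₐ[K] L).toRingHom ℓ := by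
  let ψ : Polynomial (Polynomial K) →ₐ[K] L :=
    { Polynomial.eval₂RingHom (Polynomial.aeval x : Polynomial K →ₐ[K] L).toRingHom ℓ with
      commutes' := fun r => by
        change Polynomial.eval₂ _ _ (Polynomial.C (Polynomial.C r)) = _
        rw [Polynomial.eval₂_C]
        exact Polynomial.aeval_C x r }
  have hC : ∀ q, ψ (Polynomial.C q) = Polynomial.aeval x q := fun q => Polynomial.eval₂_C _ _
  have hX : ψ Polynomial.X = ℓ := Polynomial.eval₂_X _ _
  have h := congrArg ψ B.aeval_eq
  rw [← AlgHom.comp_apply, comp_aeval, map_mul, map_pow, hC, Polynomial.aeval_X] at h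
  refine Eq.trans ?_ h
  congr 2
  funext j
  simp only [map_add, map_mul, hC, hX, Polynomial.aeval_X, AlgHom.commutes]

theorem aeval_eq_zero_series (a : Fin m) :
    aeval (fun j => algebraMap K (PowerSeries K) (p j) + (PowerSeries.X * algebraMap K _ (v j) +
      PowerSeries.X * B.series a * algebraMap K _ (w j))) F = 0 := by
  rw [B.aeval_eq_pow_mul, toRingHom_aeval_X, B.eval_series, mul_zero]

end Branches

end Branches

/-! ### The slope of a point and its expansion along a branch. -/

section Slope

variable {K : Type*} [Field K] {F : MvPolynomial (Fin 3) K} {p v w : Fin 3 → K} {m : ℕ}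
  {L : Type*} [CommRing L] [Algebra K L]

theorem aeval_sub_mem {σ : Type*} (I : Ideal L) (G : MvPolynomial σ K) {ξ : σ → L} {q : σ → K}
    (h : ∀ j, ξ j - algebraMap K L (q j) ∈ I) : aeval ξ G - algebraMap K L (eval q G) ∈ I := by
  induction G using MvPolynomial.induction_on with
  | C r => simp
  | add a b ha hb =>
    convert add_mem ha hb using 1
    simp only [map_add]
    ring
  | mul_X a j ha =>
    have := add_mem (Ideal.mul_mem_right (ξ j) _ ha)
      (Ideal.mul_mem_left _ (algebraMap K L (eval q a)) (h j))
    convert this using 1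
    simp only [map_mul, aeval_X, eval_X]
    ring

theorem algebraMap_notMem_maximalIdeal [IsLocalRing L] {r : K} (hr : r ≠ 0) :
    algebraMap K L r ∉ IsLocalRing.maximalIdeal L := fun h =>
  h ((isUnit_iff_ne_zero.mpr hr).map (algebraMap K L))

/-- At a smooth point, the tangent coordinate generates the maximal ideal of the curve. -/
theorem exists_eq_mul_of_smooth [IsLocalRing L] {x y : L}
    (hx : x ∈ IsLocalRing.maximalIdeal L) (hy : y ∈ IsLocalRing.maximalIdeal L)
    (h0 : eval p F = 0) (hw : ∑ j, eval p (pderiv j F) * w j ≠ 0)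
    (hF : aeval (fun j => algebraMap K L (p j) +
      (x * algebraMap K L (v j) + y * algebraMap K L (w j))) F = 0) : ∃ ℓ, y = x * ℓ := by
  classical
  set I : Ideal L := Ideal.span {x, y} with hI
  have hδ : ∀ j, x * algebraMap K L (v j) + y * algebraMap K L (w j) ∈ I := fun j =>
    add_mem (Ideal.mul_mem_right _ _ (Ideal.subset_span (by simp)))
      (Ideal.mul_mem_right _ _ (Ideal.subset_span (by simp)))
  have h1 := aeval_add_sub_mem_sq I F p hδ
  rw [hF, h0, map_zero, sub_zero, zero_sub, neg_mem_iff] at h1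
  have h2 : ∑ j, (x * algebraMap K L (v j) + y * algebraMap K L (w j)) *
      algebraMap K L (eval p (pderiv j F)) =
      x * algebraMap K L (∑ j, eval p (pderiv j F) * v j) +
      y * algebraMap K L (∑ j, eval p (pderiv j F) * w j) := by
    simp only [map_sum, map_mul, Finset.mul_sum, ← Finset.sum_add_distrib]
    exact Finset.sum_congr rfl fun j _ => by ring
  rw [h2, pow_two, hI] at h1
  have h3 : ∃ a ∈ IsLocalRing.maximalIdeal L, ∃ b ∈ IsLocalRing.maximalIdeal L,
      x * algebraMap K L (∑ j, eval p (pderiv j F) * v j) +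
      y * algebraMap K L (∑ j, eval p (pderiv j F) * w j) = x * a + y * b := by
    rw [Ideal.span_pair_mul_span_pair] at h1
    simp only [Ideal.mem_span_insert, Ideal.mem_span_singleton'] at h1
    obtain ⟨a, z, ⟨b, z', ⟨c, z'', ⟨d, rfl⟩, rfl⟩, rfl⟩, e⟩ := h1
    refine ⟨a * x + b * y + c * y, ?_, d * y, Ideal.mul_mem_left _ _ hy, by rw [e]; ring⟩
    exact add_mem (add_mem (Ideal.mul_mem_left _ _ hx) (Ideal.mul_mem_left _ _ hy))
      (Ideal.mul_mem_left _ _ hy)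
  obtain ⟨a, ha, b, hb, hab⟩ := h3
  -- The terms of second order only perturb the coefficient of `y` by `b` in the maximal ideal, so
  -- it stays a unit and the relation can be solved for `y`.
  have hu : IsUnit (algebraMap K L (∑ j, eval p (pderiv j F) * w j) - b) := by
    by_contra hu
    have : _ ∈ IsLocalRing.maximalIdeal L := hu
    have := add_mem this hb
    rw [sub_add_cancel] at this
    exact algebraMap_notMem_maximalIdeal hw this
  obtain ⟨u, hu⟩ := hu.exists_right_inv
  refine ⟨(a - algebraMap K L (∑ j, eval p (pderiv j F) * v j)) * u, ?_⟩
  linear_combination (-y) * hu + u * hab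

/-- If the ideal of the base point becomes principal, then it is generated by the first
coordinate, as the direction `w` is not tangent to the curve. -/
theorem exists_eq_mul_of_principal [IsLocalRing L] {x y z : L}
    (hx : x ∈ IsLocalRing.maximalIdeal L) (hy : y ∈ IsLocalRing.maximalIdeal L)
    (hlow : ∀ n < m, homogeneousComponent n (taylorAt F p) = 0)
    (hw : eval w (homogeneousComponent m (taylorAt F p)) ≠ 0)
    (hF : aeval (fun j => algebraMap K L (p j) +
      (x * algebraMap K L (v j) + y * algebraMap K L (w j))) F = 0)
    (hz : IsLeftRegular z) (hxz : z ∣ x) (hyz : z ∣ y) (hzxy : z ∈ Ideal.span {x, y}) :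
    ∃ ℓ, y = x * ℓ := by
  obtain ⟨x', rfl⟩ := hxz
  obtain ⟨y', rfl⟩ := hyz
  rw [Ideal.mem_span_pair] at hzxy
  obtain ⟨a, b, hab⟩ := hzxy
  have h1 : a * x' + b * y' = 1 := hz (by
    change z * _ = z * _
    linear_combination hab)
  by_cases hx' : IsUnit x'
  · obtain ⟨u, hu⟩ := hx'.exists_right_inv
    exact ⟨u * y', by linear_combination (-z * y') * hu⟩
  -- Otherwise `x` is small compared with `y = z y'`, so the point would approach `p` in the
  -- direction `w`. Dividing the Taylor expansion of `F` by `(z y') ^ m` then forces the leading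
  -- form to vanish at `w`.
  exfalso
  have hy' : IsUnit y' := by
    rcases IsLocalRing.isUnit_or_isUnit_of_add_one h1 with h | h
    · exact absurd (isUnit_of_mul_isUnit_right h) hx'
    · exact isUnit_of_mul_isUnit_right h
  obtain ⟨u, hu⟩ := hy'.exists_right_inv
  have hreg : IsLeftRegular (z * y') := hz.mul hy'.isRegular.left
  obtain ⟨r, hr⟩ := exists_aeval_mul_eq hlow (z * y')
    (fun j => x' * u * algebraMap K L (v j) + algebraMap K L (w j))
  rw [aeval_taylorAt] at hr
  have h2 : (fun j => algebraMap K L (p j) + z * y' * (x' * u * algebraMap K L (v j) +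
      algebraMap K L (w j))) = fun j => algebraMap K L (p j) +
      (z * x' * algebraMap K L (v j) + z * y' * algebraMap K L (w j)) := by
    funext j
    linear_combination (z * x' * algebraMap K L (v j)) * hu
  rw [h2, hF] at hr
  have h3 : aeval (fun j => x' * u * algebraMap K L (v j) + algebraMap K L (w j))
      (homogeneousComponent m (taylorAt F p)) + z * y' * r = 0 := (hreg.pow m) (by
    change (z * y') ^ m * _ = (z * y') ^ m * 0
    rw [mul_zero]
    exact hr.symm)
  have h4 : aeval (fun j => x' * u * algebraMap K L (v j) + algebraMap K L (w j))
      (homogeneousComponent m (taylorAt F p)) ∈ IsLocalRing.maximalIdeal L := by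
    rw [eq_neg_of_add_eq_zero_left h3, neg_mem_iff]
    exact Ideal.mul_mem_right _ _ hy
  have h5 := aeval_sub_mem (IsLocalRing.maximalIdeal L) (homogeneousComponent m (taylorAt F p))
    (ξ := fun j => x' * u * algebraMap K L (v j) + algebraMap K L (w j)) (q := w) (by
      intro j
      rw [add_sub_cancel_right]
      exact Ideal.mul_mem_right _ _ (Ideal.mul_mem_right _ _ hx'))
  have h6 := sub_mem h4 h5
  rw [sub_sub_cancel] at h6
  exact algebraMap_notMem_maximalIdeal hw h6

open PowerSeries in
/-- A point with given first coordinate and slope expands along one of the branches. -/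
theorem Branches.exists_hasExpansion (B : Branches F p v w m) [IsLocalRing L] {x ℓ : L}
    (hx : x ∈ IsLocalRing.maximalIdeal L) (hreg : IsLeftRegular x)
    (hres : ∀ a : L, ∃ r : K, a - algebraMap K L r ∈ IsLocalRing.maximalIdeal L)
    (hF : MvPolynomial.aeval (fun j => algebraMap K L (p j) +
      (x * algebraMap K L (v j) + x * ℓ * algebraMap K L (w j))) F = 0) :
    ∃ a, ℓ - algebraMap K L (B.slope a) ∈ IsLocalRing.maximalIdeal L ∧
      HasExpansion x ℓ (B.series a) := by
  rw [B.aeval_eq_pow_mul] at hF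
  have h1 : B.poly.eval₂ (Polynomial.aeval x : Polynomial K →ₐ[K] L).toRingHom ℓ = 0 :=
    (hreg.pow m) (by change x ^ m * _ = x ^ m * 0; rw [hF, mul_zero])
  obtain ⟨r, hr⟩ := hres ℓ
  -- In the residue field `x` becomes `0`, so the residue of `ℓ` is a root of the reduced
  -- polynomial.
  have h2 : B.poly.eval₂ Polynomial.constantCoeff r = 0 := by
    by_contra h2
    refine algebraMap_notMem_maximalIdeal (L := L) h2 ?_
    rw [← Ideal.Quotient.eq_zero_iff_mem]
    have e1 : (Ideal.Quotient.mk (IsLocalRing.maximalIdeal L)).comp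
        (Polynomial.aeval x : Polynomial K →ₐ[K] L).toRingHom =
        ((Ideal.Quotient.mk (IsLocalRing.maximalIdeal L)).comp (algebraMap K L)).comp
          Polynomial.constantCoeff := by
      refine Polynomial.ringHom_ext (fun r => ?_) ?_
      · change Ideal.Quotient.mk _ (Polynomial.aeval x (Polynomial.C r)) = _
        simp
      · change Ideal.Quotient.mk _ (Polynomial.aeval x Polynomial.X) = _
        simpa [Ideal.Quotient.eq_zero_iff_mem] using hx
    have e2 := congrArg (Ideal.Quotient.mk (IsLocalRing.maximalIdeal L)) h1
    rw [Polynomial.hom_eval₂, e1, Ideal.Quotient.eq.mpr hr, map_zero] at e2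
    change ((Ideal.Quotient.mk (IsLocalRing.maximalIdeal L)).comp (algebraMap K L)) _ = 0
    rw [Polynomial.hom_eval₂]
    exact e2
  obtain ⟨a, rfl⟩ := B.exists_eq_slope r h2
  refine ⟨a, hr, HasExpansion.of_root hx h1 (B.eval_series a) ?_ ?_⟩
  · rw [B.constantCoeff_series]
    exact hr
  · rw [B.constantCoeff_series]
    exact B.derivative_ne_zero a

end Slope

end PlaneCurves

namespace PlaneCurves

open MvPolynomial

/-! ### Arcs on a plane curve and common zeros of two curves. -/

section Chart

variable {k K : Type*} [Field k] [Field K] [Algebra k K] {s : Fin 3 → K} {i : Fin 3}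

/-- Restriction of polynomials to the affine chart `X i = 1`. -/
noncomputable def chart (k : Type*) [Field k] (i : Fin 3) :
    MvPolynomial (Fin 3) k →ₐ[k] MvPolynomial (Fin 2) k :=
  aeval (i.insertNth (α := fun _ => MvPolynomial (Fin 2) k) 1 X)

/-- The map from the coordinate ring of the affine chart to the local ring. -/
noncomputable def chartToLocal (k : Type*) [Field k] [Algebra k K] (hi : s i ≠ 0) :
    MvPolynomial (Fin 2) k →ₐ[k] PlaneLocalRing k s :=
  (dehomogenize k hi).comp (rename i.succAbove)

theorem chartToLocal_chart (hi : s i ≠ 0) (G : MvPolynomial (Fin 3) k) :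
    chartToLocal k hi (chart k i G) = dehomogenize k hi G := by
  rw [← AlgHom.comp_apply]
  congr 1
  ext j
  rw [AlgHom.comp_apply, chart, aeval_X, chartToLocal, AlgHom.comp_apply]
  rcases eq_or_ne j i with h | h
  · subst h
    rw [Fin.insertNth_apply_same, map_one, map_one, dehomogenize_X_self]
  · obtain ⟨a, rfl⟩ := Fin.exists_succAbove_eq h
    rw [Fin.insertNth_apply_succAbove, rename_X]

theorem dehomogenize_ne_zero (hi : s i ≠ 0) {F : MvPolynomial (Fin 3) k} {d : ℕ}
    (hF : F.IsHomogeneous d) (h0 : F ≠ 0) : dehomogenize k hi F ≠ 0 := by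
  intro h
  have := toFractions_dehomogenize hi hF
  rw [h, map_zero, zero_mul] at this
  exact h0 ((map_eq_zero_iff _ (algebraMap_fractions_injective s)).mp this.symm)

-- Over `K` the polynomial `P` splits, and since `K⟦X⟧` is a domain one of the factors `g - r`
-- vanishes.
open PowerSeries in
theorem exists_eq_C_of_aeval_eq_zero [IsAlgClosed K] {P : Polynomial k} (hP : P ≠ 0) {g : K⟦X⟧}
    (hg : Polynomial.aeval g P = 0) : ∃ r : K, g = PowerSeries.C r := by
  have hsplit := IsAlgClosed.splits (P.map (algebraMap k K))
  have h1 : Polynomial.aeval g (P.map (algebraMap k K)) = 0 := by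
    rwa [Polynomial.aeval_map_algebraMap]
  rw [hsplit.eq_prod_roots, map_mul, Polynomial.aeval_C, map_multiset_prod, Multiset.map_map,
    mul_eq_zero] at h1
  rcases h1 with h1 | h1
  · exfalso
    rw [map_eq_zero_iff _ (FaithfulSMul.algebraMap_injective K K⟦X⟧),
      Polynomial.leadingCoeff_eq_zero, Polynomial.map_eq_zero] at h1
    exact hP h1
  · rw [Multiset.prod_eq_zero_iff, Multiset.mem_map] at h1
    obtain ⟨r, _, hr⟩ := h1
    refine ⟨r, ?_⟩
    simp only [Function.comp_apply, map_sub, Polynomial.aeval_X, Polynomial.aeval_C] at hr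
    exact sub_eq_zero.mp hr

open PowerSeries in
/-- A function on a curve that vanishes along a nonconstant arc of the curve is a zero divisor. -/
theorem exists_mul_mem_curveIdeal [IsAlgClosed K] (hi : s i ≠ 0) {F : MvPolynomial (Fin 3) k} {d : ℕ}
    (hF : F.IsHomogeneous d) (hF0 : F ≠ 0) {c : Fin 3 → K⟦X⟧} (hci : c i = 1)
    {φ : PlaneLocalRing k s →ₐ[k] K⟦X⟧}
    (hφ : ∀ G, φ (dehomogenize k hi G) = MvPolynomial.aeval c G)
    (hconst : ∃ j, ∀ r : K, c j ≠ PowerSeries.C r)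
    (hφF : φ (dehomogenize k hi F) = 0) {b : PlaneLocalRing k s} (hb : φ b = 0) :
    ∃ e, e ∉ curveIdeal F s ∧ b * e ∈ curveIdeal F s := by
  set ρ := chartToLocal k hi with hρ
  have hcoord : ∀ a, φ (ρ (MvPolynomial.X a)) = c (i.succAbove a) := by
    intro a
    rw [hρ, chartToLocal, AlgHom.comp_apply, rename_X, hφ, MvPolynomial.aeval_X]
  set Q : Ideal (MvPolynomial (Fin 2) k) := RingHom.ker (φ.comp ρ) with hQ
  have hQp : Q.IsPrime := RingHom.ker_isPrime _
  have hmem : ∀ g, g ∈ Q ↔ φ (ρ g) = 0 := fun g => RingHom.mem_ker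
  have hρF : ρ (chart k i F) = dehomogenize k hi F := chartToLocal_chart hi F
  have hF1 := dehomogenize_ne_zero hi hF hF0
  have hfQ : chart k i F ∈ Q := by rw [hmem, hρF, hφF]
  have hQ0 : Q ≠ ⊥ := by
    intro h
    rw [h, Ideal.mem_bot] at hfQ
    rw [hfQ, map_zero] at hρF
    exact hF1 hρF.symm
  obtain ⟨f₀, hf₀Q, hf₀⟩ := Ideal.IsPrime.exists_mem_prime_of_ne_bot hQp hQ0
  -- The prime `Q` of functions vanishing along the arc is generated by the prime `f₀`: an element
  -- of `Q` not divisible by `f₀` would, by elimination, make the nonconstant coordinate of the arc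
  -- algebraic over `k`, hence constant.
  have hdvd : ∀ g ∈ Q, f₀ ∣ g := by
    intro g hg
    by_contra hng
    have hrel : IsRelPrime f₀ g := (hf₀.irreducible.isRelPrime_iff_not_dvd).mpr hng
    obtain ⟨j, hj⟩ := hconst
    rcases eq_or_ne j i with h | h
    · exact hj 1 (by rw [h, hci, map_one])
    obtain ⟨a, rfl⟩ := Fin.exists_succAbove_eq h
    obtain ⟨P, hP, hPmem⟩ := exists_aeval_X_mem_span hrel a
    have h1 : Polynomial.aeval (MvPolynomial.X a) P ∈ Q :=
      (Ideal.span_le.mpr (by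
        rintro _ (rfl | rfl)
        · exact hf₀Q
        · exact hg)) hPmem
    rw [hmem, ← Polynomial.aeval_algHom_apply, ← Polynomial.aeval_algHom_apply, hcoord] at h1
    obtain ⟨r, hr⟩ := exists_eq_C_of_aeval_eq_zero hP h1
    exact hj r hr
  obtain ⟨f₁, hf₁⟩ := hdvd _ hfQ
  obtain ⟨G, H, hH, hGH⟩ := exists_mul_dehomogenize_eq hi b
  have hGQ : chart k i G ∈ Q := by
    rw [hmem, hρ, chartToLocal_chart, ← hGH, map_mul, hb, zero_mul]
  obtain ⟨g₁, hg₁⟩ := hdvd _ hGQ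
  rw [curveIdeal_eq_span hi hF]
  -- The witness is the cofactor of `f₀` in `F`. Up to a unit `b` is a multiple of `f₀`, so `b f₁`
  -- is a multiple of `F`. If `f₁` were one, `f₀` would be a unit, but it vanishes along the arc.
  refine ⟨ρ f₁, ?_, ?_⟩
  · intro h
    rw [Ideal.mem_span_singleton] at h
    obtain ⟨t, ht⟩ := h
    rw [← hρF, hf₁, map_mul] at ht
    have hf₁0 : ρ f₁ ≠ 0 := by
      intro h0
      rw [hf₁, map_mul, h0, mul_zero] at hρF
      exact hF1 hρF.symm
    have h1 : ρ f₀ * t = 1 := mul_left_cancel₀ hf₁0 (by linear_combination -ht)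
    have h2 := congrArg φ h1
    rw [map_mul, (hmem f₀).mp hf₀Q, zero_mul, map_one] at h2
    exact zero_ne_one h2
  · rw [Ideal.mem_span_singleton, ← (isUnit_of_evalAt_ne_zero hH).dvd_mul_right, mul_right_comm, hGH,
      ← chartToLocal_chart hi G, hg₁, ← hρF, hf₁]
    exact ⟨ρ g₁, by rw [map_mul, map_mul]; ring⟩

/-- A curve without common component with `F = 0` has a regular local equation on `F = 0`. -/
theorem mem_curveIdeal_of_mul_mem (hi : s i ≠ 0) {F F' : MvPolynomial (Fin 3) k} {d' : ℕ}
    (hF' : F'.IsHomogeneous d') (hrel : IsRelPrime F F') {a : PlaneLocalRing k s}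
    (ha : dehomogenize k hi F' * a ∈ curveIdeal F s) : a ∈ curveIdeal F s := by
  set B := Localization.AtPrime (pointIdeal k s)
  set ι := algebraMap (MvPolynomial (Fin 3) k) B with hι
  have hinj : Function.Injective ι := algebraMap_fractions_injective s
  rw [curveIdeal, Ideal.mem_comap, Ideal.mem_span_singleton] at ha ⊢
  obtain ⟨c, hc⟩ := ha
  obtain ⟨⟨G, H⟩, hGH⟩ := IsLocalization.surj (pointIdeal k s).primeCompl (toFractions k s a)
  obtain ⟨⟨P, Q⟩, hPQ⟩ := IsLocalization.surj (pointIdeal k s).primeCompl c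
  change toFractions k s a * ι H = ι G at hGH
  change c * ι Q = ι P at hPQ
  have h1 := toFractions_dehomogenize hi hF'
  have h2 : F' * (G * Q.1) = F * (P * H.1 * X i ^ d') := by
    apply hinj
    change _ = ι F' at h1
    rw [map_mul] at hc
    change _ = ι F * c at hc
    simp only [map_mul]
    rw [← h1, ← hGH, ← hPQ]
    linear_combination (ι (X i ^ d') * ι H * ι Q) * hc
  have h3 : F ∣ G * Q.1 := hrel.dvd_of_dvd_mul_left ⟨_, h2⟩
  have hu : IsUnit (ι H * ι Q) := (IsLocalization.map_units B H).mul (IsLocalization.map_units B Q)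
  rw [← hu.dvd_mul_right, ← mul_assoc, hGH, ← map_mul]
  exact map_dvd ι h3

theorem aeval_chart_eq_zero (hi : s i ≠ 0) {F : MvPolynomial (Fin 3) k} {d : ℕ} (hF : F.IsHomogeneous d)
    (h : aeval s F = 0) : evalAt k s (dehomogenize k hi F) = 0 := by
  rw [evalAt_dehomogenize]
  rw [aeval_eq_pow_mul hi hF] at h
  exact (mul_eq_zero.mp h).resolve_left (pow_ne_zero _ hi)

theorem evalAt_chartToLocal (hi : s i ≠ 0) (g : MvPolynomial (Fin 2) k) :
    evalAt k s (chartToLocal k hi g) = aeval (fun a => s (i.succAbove a) / s i) g := by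
  rw [chartToLocal, AlgHom.comp_apply, evalAt_dehomogenize, aeval_rename]
  rfl

/-- In the chart the two equations are `f g` and `f' g` with `f, f'` relatively prime. Locally `f F'
= f' F`, and `F'` is regular modulo `F`, so `g` is invertible at every point with `s i ≠ 0`. Common
zeros are therefore zeros of `f` and `f'`, to which elimination applies. -/
theorem exists_finite_coordinates (i : Fin 3) {F F' : MvPolynomial (Fin 3) k} {d d' : ℕ}
    (hF : F.IsHomogeneous d) (hF' : F'.IsHomogeneous d') (hF0 : F ≠ 0) (hrel : IsRelPrime F F') :
    ∃ Z : Set K, Z.Finite ∧ ∀ s : Fin 3 → K, s i ≠ 0 → aeval s F = 0 → aeval s F' = 0 →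
      ∀ j, s j / s i ∈ Z := by
  classical
  by_cases hex : ∃ s : Fin 3 → K, s i ≠ 0
  swap
  · exact ⟨∅, Set.finite_empty, fun s hs => absurd ⟨s, hs⟩ hex⟩
  have hchart0 : chart k i F ≠ 0 := by
    obtain ⟨s, hs⟩ := hex
    intro h
    have := dehomogenize_ne_zero hs hF hF0
    rw [← chartToLocal_chart, h, map_zero] at this
    exact this rfl
  let := Classical.choice (inferInstance : Nonempty (NormalizedGCDMonoid (MvPolynomial (Fin 2) k)))
  obtain ⟨f, f', hf, hf', hff'⟩ := extract_gcd (chart k i F) (chart k i F')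
  rw [gcd_isUnit_iff_isRelPrime] at hff'
  set g := gcd (chart k i F) (chart k i F') with hg
  choose P hP hPmem using exists_aeval_X_mem_span hff'
  -- The value `1` accounts for the coordinate of index `i`.
  refine ⟨{1} ∪ ⋃ a : Fin 2, {r | Polynomial.aeval r (P a) = 0}, ?_, ?_⟩
  · refine (Set.finite_singleton _).union (Set.finite_iUnion fun a => ?_)
    refine ((P a).map (algebraMap k K)).roots.toFinset.finite_toSet.subset fun r hr => ?_
    rw [Finset.mem_coe, Multiset.mem_toFinset, Polynomial.mem_roots (by
      rw [Ne, Polynomial.map_eq_zero]; exact hP a), Polynomial.IsRoot, Polynomial.eval_map_algebraMap]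
    exact hr
  · intro s hs h1 h2 j
    rcases eq_or_ne j i with h | h
    · left
      rw [h, div_self hs]
      rfl
    right
    obtain ⟨a, rfl⟩ := Fin.exists_succAbove_eq h
    refine Set.mem_iUnion.mpr ⟨a, ?_⟩
    have hF1 := dehomogenize_ne_zero hs hF hF0
    set ρ := chartToLocal k hs with hρ
    have hρF : ρ f * ρ g = dehomogenize k hs F := by
      rw [mul_comm, ← map_mul, ← hf, hρ, chartToLocal_chart]
    have hρF' : ρ f' * ρ g = dehomogenize k hs F' := by
      rw [mul_comm, ← map_mul, ← hf', hρ, chartToLocal_chart]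
    have hgu : evalAt k s (ρ g) ≠ 0 := by
      have h3 : ρ f ∈ curveIdeal F s := by
        refine mem_curveIdeal_of_mul_mem hs hF' hrel ?_
        rw [curveIdeal_eq_span hs hF, Ideal.mem_span_singleton, ← hρF, ← hρF']
        exact ⟨ρ f', by ring⟩
      rw [curveIdeal_eq_span hs hF, Ideal.mem_span_singleton, ← hρF] at h3
      obtain ⟨t, ht⟩ := h3
      have hf0 : ρ f ≠ 0 := fun h => hF1 (by rw [← hρF, h, zero_mul])
      have h4 : ρ g * t = 1 := mul_left_cancel₀ hf0 (by linear_combination -ht)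
      exact evalAt_ne_zero_of_isUnit (IsUnit.of_mul_eq_one t h4)
    have hz : ∀ q ∈ Ideal.span {f, f'}, evalAt k s (ρ q) = 0 := by
      intro q hq
      rw [Ideal.mem_span_pair] at hq
      obtain ⟨u, v, rfl⟩ := hq
      have e1 := aeval_chart_eq_zero hs hF h1
      have e2 := aeval_chart_eq_zero hs hF' h2
      rw [← hρF, map_mul, mul_eq_zero, or_iff_left hgu] at e1
      rw [← hρF', map_mul, mul_eq_zero, or_iff_left hgu] at e2
      rw [map_add, map_mul, map_mul, map_add, map_mul, map_mul, e1, e2, mul_zero, mul_zero, add_zero]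
    have h5 := hz _ (hPmem a)
    rw [hρ, evalAt_chartToLocal, ← Polynomial.aeval_algHom_apply, aeval_X] at h5
    exact h5

end Chart

end PlaneCurves

namespace PlaneCurves

/-! ### Arcs and fractions on the normalisation. -/

section Normalized

variable {k K : Type*} [Field k] [Field K] [Algebra k K] {s : Fin 3 → K}
  {F : MvPolynomial (Fin 3) k}

open PowerSeries in
/-- An arc of a curve on which nonzerodivisors do not vanish lifts to the normalisation. -/
theorem exists_normalized_extension (φ : PlaneLocalRing k s →ₐ[k] K⟦X⟧)
    (h0 : ∀ a ∈ curveIdeal F s, φ a = 0)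
    (hreg : ∀ b, Ideal.Quotient.mk (curveIdeal F s) b ∈ nonZeroDivisors (CurveLocalRing F s) → φ b ≠ 0) :
    ∃ Ψ : NormalizedLocalRing F s →ₐ[k] K⟦X⟧, ∀ a, Ψ (toNormalized F s a) = φ a := by
  let φA : CurveLocalRing F s →ₐ[k] K⟦X⟧ := Ideal.Quotient.liftₐ (curveIdeal F s) φ h0
  have hφA : ∀ a, φA (Ideal.Quotient.mk _ a) = φ a := fun _ => rfl
  set E := FractionRing K⟦X⟧
  have hinj : Function.Injective (algebraMap K⟦X⟧ E) := IsFractionRing.injective _ _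
  let g₀ : CurveLocalRing F s →+* E := (algebraMap K⟦X⟧ E).comp φA.toRingHom
  have hunit : ∀ b : nonZeroDivisors (CurveLocalRing F s), IsUnit (g₀ b) := by
    rintro ⟨b, hb⟩
    obtain ⟨b, rfl⟩ := Ideal.Quotient.mk_surjective b
    rw [isUnit_iff_ne_zero]
    exact (map_ne_zero_iff _ hinj).mpr (hreg b hb)
  let g : FractionRing (CurveLocalRing F s) →+* E := IsLocalization.lift hunit
  have hg : ∀ a, g (algebraMap _ _ a) = algebraMap _ _ (φA a) := fun a => IsLocalization.lift_eq hunit a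
  -- The image of an integral element in the fraction field is integral over `K⟦X⟧`, which is
  -- integrally closed.
  have hex : ∀ n : NormalizedLocalRing F s, ∃ y : K⟦X⟧, algebraMap K⟦X⟧ E y = g n := by
    intro n
    refine IsIntegrallyClosed.isIntegral_iff.mp ?_
    refine IsIntegral.map_of_comp_eq φA.toRingHom g ?_ n.2
    ext a
    exact (hg _).symm
  choose f hf using hex
  refine ⟨⟨⟨⟨⟨f, ?_⟩, ?_⟩, ?_, ?_⟩, ?_⟩, ?_⟩
  · exact hinj (by rw [hf, map_one]; exact map_one g)
  · exact fun a b => hinj (by rw [hf, map_mul, hf, hf]; exact map_mul g _ _)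
  · exact hinj (by dsimp only; rw [hf, map_zero]; exact map_zero g)
  · exact fun a b => hinj (by dsimp only; rw [hf, map_add, hf, hf]; exact map_add g _ _)
  · intro r
    apply hinj
    dsimp only
    rw [hf, ← φA.commutes r, ← hg]
    rfl
  · intro a
    apply hinj
    change algebraMap _ _ (f _) = _
    rw [hf, ← hφA, ← hg]
    rfl

theorem exists_toNormalized_mul_eq (n : NormalizedLocalRing F s) :
    ∃ a b : PlaneLocalRing k s,
      Ideal.Quotient.mk (curveIdeal F s) b ∈ nonZeroDivisors (CurveLocalRing F s) ∧
      toNormalized F s b * n = toNormalized F s a := by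
  obtain ⟨⟨a, b, hb⟩, h⟩ := IsLocalization.surj (nonZeroDivisors (CurveLocalRing F s))
    (n : FractionRing (CurveLocalRing F s))
  obtain ⟨a, rfl⟩ := Ideal.Quotient.mk_surjective a
  obtain ⟨b, rfl⟩ := Ideal.Quotient.mk_surjective b
  refine ⟨a, b, hb, Subtype.ext ?_⟩
  rw [mul_comm]
  exact h

theorem toNormalized_mul_cancel {b : PlaneLocalRing k s}
    (hb : Ideal.Quotient.mk (curveIdeal F s) b ∈ nonZeroDivisors (CurveLocalRing F s))
    {n : NormalizedLocalRing F s} (h : toNormalized F s b * n = 0) : n = 0 := by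
  have hu : IsUnit (algebraMap _ (FractionRing (CurveLocalRing F s))
    (Ideal.Quotient.mk (curveIdeal F s) b)) := IsLocalization.map_units _ ⟨_, hb⟩
  apply Subtype.ext
  have := congrArg Subtype.val h
  exact hu.mul_right_eq_zero.mp this

end Normalized

/-- Injectivity of multiplication by `n₀` survives the flat base change to `K` and the localisation.
-/
theorem isLeftRegular_algebraMap_one_tmul {k K N L : Type*} [Field k] [Field K] [Algebra k K]
    [CommRing N] [Algebra k N] [CommRing L] [Algebra (K ⊗[k] N) L] (I : Ideal (K ⊗[k] N)) [I.IsPrime]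
    [IsLocalization.AtPrime L I] {n₀ : N} (h : ∀ n, n₀ * n = 0 → n = 0) :
    IsLeftRegular (algebraMap (K ⊗[k] N) L (1 ⊗ₜ n₀)) := by
  have h1 : Function.Injective (LinearMap.mulLeft k n₀) := by
    rw [injective_iff_map_eq_zero]
    exact h
  have h2 := Module.Flat.lTensor_preserves_injective_linearMap (M := K) _ h1
  have aux : ∀ z : K ⊗[k] N, (LinearMap.lTensor K (LinearMap.mulLeft k n₀)) z =
      (1 ⊗ₜ[k] n₀) * z := by
    intro z
    induction z using TensorProduct.induction_on with
    | zero => simp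
    | tmul x y => simp
    | add x y hx hy => rw [mul_add, map_add, hx, hy]
  have h3 : ∀ α : K ⊗[k] N, (1 ⊗ₜ[k] n₀) * α = 0 → α = 0 := by
    intro α hα
    apply h2
    rw [map_zero, aux, hα]
  intro z z' hzz
  rw [← sub_eq_zero]
  have hzz' : algebraMap (K ⊗[k] N) L (1 ⊗ₜ n₀) * (z - z') = 0 := by
    rw [mul_sub, sub_eq_zero]; exact hzz
  obtain ⟨⟨α, σ⟩, h⟩ := IsLocalization.surj I.primeCompl (z - z')
  change (z - z') * algebraMap _ L σ.1 = algebraMap _ L α at h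
  have h4 : algebraMap (K ⊗[k] N) L ((1 ⊗ₜ[k] n₀) * α) = 0 := by
    rw [map_mul, ← h, ← mul_assoc, hzz', zero_mul]
  rw [IsLocalization.map_eq_zero_iff I.primeCompl] at h4
  obtain ⟨c, hc⟩ := h4
  have h5 : c.1 * α = 0 := h3 _ (by rw [← hc]; ring)
  have h6 : algebraMap (K ⊗[k] N) L α = 0 := by
    rw [IsLocalization.map_eq_zero_iff I.primeCompl]
    exact ⟨c, h5⟩
  rw [h6] at h
  exact (IsLocalization.map_units L σ).mul_left_eq_zero.mp h

/-! ### Local rings of the base change to `K`. -/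

section BaseChange

open PowerSeries

variable {k K N L : Type*} [Field k] [Field K] [Algebra k K] [CommRing N] [Algebra k N] [CommRing L]
  [Algebra (K ⊗[k] N) L] [Algebra K L] [IsScalarTower K (K ⊗[k] N) L] [IsLocalRing L]
  {χ : N →ₐ[k] K} {I : Ideal (K ⊗[k] N)} [I.IsPrime] [IsLocalization.AtPrime L I]

theorem algebraMap_sub_mem_maximalIdeal {χ' : K ⊗[k] N →ₐ[K] K} (hI : ∀ α, α ∈ I ↔ χ' α = 0)
    (α : K ⊗[k] N) :
    algebraMap (K ⊗[k] N) L α - algebraMap K L (χ' α) ∈ IsLocalRing.maximalIdeal L := by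
  rw [IsScalarTower.algebraMap_apply K (K ⊗[k] N) L, ← map_sub,
    IsLocalization.AtPrime.to_map_mem_maximal_iff L I, hI, map_sub, AlgHom.commutes]
  exact sub_self _

theorem exists_sub_mem_maximalIdeal {χ' : K ⊗[k] N →ₐ[K] K} (hI : ∀ α, α ∈ I ↔ χ' α = 0) (z : L) :
    ∃ r : K, z - algebraMap K L r ∈ IsLocalRing.maximalIdeal L := by
  obtain ⟨⟨a, σ⟩, h⟩ := IsLocalization.surj I.primeCompl z
  change z * algebraMap _ L σ.1 = algebraMap _ L a at h
  have hσ : χ' σ.1 ≠ 0 := fun h => σ.2 ((hI _).mpr h)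
  refine ⟨χ' a / χ' σ.1, ?_⟩
  have h1 : z - algebraMap K L (χ' a / χ' σ.1) = (algebraMap K L (χ' σ.1)⁻¹) *
      ((algebraMap _ L a - algebraMap K L (χ' a)) -
        z * (algebraMap _ L σ.1 - algebraMap K L (χ' σ.1))) := by
    have e1 : algebraMap K L (χ' σ.1)⁻¹ * algebraMap K L (χ' σ.1) = 1 := by
      rw [← map_mul, inv_mul_cancel₀ hσ, map_one]
    rw [div_eq_mul_inv, map_mul, ← h]
    linear_combination (-z) * e1
  rw [h1]
  exact Ideal.mul_mem_left _ _ (sub_mem (algebraMap_sub_mem_maximalIdeal hI a)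
    (Ideal.mul_mem_left _ _ (algebraMap_sub_mem_maximalIdeal hI σ.1)))

theorem eq_of_sub_mem_maximalIdeal {z : L} {r r' : K}
    (h : z - algebraMap K L r ∈ IsLocalRing.maximalIdeal L)
    (h' : z - algebraMap K L r' ∈ IsLocalRing.maximalIdeal L) : r = r' := by
  by_contra hne
  have := sub_mem h h'
  rw [sub_sub_sub_cancel_left, ← map_sub] at this
  exact algebraMap_notMem_maximalIdeal (sub_ne_zero.mpr (Ne.symm hne)) this

/-- The constant term of the induced map on `K ⊗ N` is `χ'`, so elements outside `I` become units
and the map extends to `L`. For expansions it is then enough to know those of elements of `N`, as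
products, sums and unit denominators follow. -/
theorem exists_extension {χ' : K ⊗[k] N →ₐ[K] K} (hI : ∀ α, α ∈ I ↔ χ' α = 0)
    {Ψ : N →ₐ[k] K⟦X⟧} (h : ∀ n : N, χ' (1 ⊗ₜ[k] n) = constantCoeff (Ψ n)) :
    ∃ Φ : L →ₐ[K] K⟦X⟧, (∀ n : N, Φ (algebraMap (K ⊗[k] N) L (1 ⊗ₜ[k] n)) = Ψ n) ∧
      ∀ x : L, x ∈ IsLocalRing.maximalIdeal L →
        (∀ n : N, HasExpansion x (algebraMap (K ⊗[k] N) L (1 ⊗ₜ[k] n)) (Ψ n)) →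
          ∀ z, HasExpansion x z (Φ z) := by
  let ΨK : K ⊗[k] N →ₐ[K] K⟦X⟧ :=
    Algebra.TensorProduct.lift (Algebra.ofId K K⟦X⟧) Ψ fun _ _ => Commute.all _ _
  have hΨ : ∀ r n, ΨK (r ⊗ₜ n) = PowerSeries.C r * Ψ n := fun r n =>
    Algebra.TensorProduct.lift_tmul _ _ _ _ _
  have hsmul : ∀ (r : K) (n : N), r ⊗ₜ[k] n = algebraMap K (K ⊗[k] N) r * (1 ⊗ₜ[k] n) := by
    intro r n
    simp [Algebra.TensorProduct.algebraMap_apply]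
  have hconst : ∀ α, constantCoeff (ΨK α) = χ' α := by
    intro α
    induction α using TensorProduct.induction_on with
    | zero => simp
    | tmul r n =>
      have e := congrArg χ' (hsmul r n)
      rw [map_mul, AlgHom.commutes] at e
      rw [hΨ, map_mul, constantCoeff_C, ← h, e]
      rfl
    | add a b ha hb => rw [map_add, map_add, map_add, ha, hb]
  have hunit : ∀ σ : I.primeCompl, IsUnit (ΨK σ.1) := by
    intro σ
    rw [PowerSeries.isUnit_iff_constantCoeff, hconst, isUnit_iff_ne_zero]
    exact fun h => σ.2 ((hI _).mpr h)
  let Φ₀ : L →+* K⟦X⟧ := IsLocalization.lift (M := I.primeCompl) (g := ΨK.toRingHom) hunit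
  have hΦ₀ : ∀ α, Φ₀ (algebraMap _ _ α) = ΨK α := fun α => IsLocalization.lift_eq hunit α
  let Φ : L →ₐ[K] K⟦X⟧ := { Φ₀ with
    commutes' := fun r => by
      change Φ₀ (algebraMap K L r) = _
      rw [IsScalarTower.algebraMap_apply K (K ⊗[k] N) L, hΦ₀, AlgHom.commutes] }
  have hΦ : ∀ α, Φ (algebraMap _ _ α) = ΨK α := hΦ₀
  refine ⟨Φ, fun n => ?_, fun x hx hexp z => ?_⟩
  · rw [hΦ, hΨ, map_one, one_mul]
  · have h1 : ∀ α : K ⊗[k] N, HasExpansion x (algebraMap _ L α) (ΨK α) := by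
      intro α
      induction α using TensorProduct.induction_on with
      | zero =>
        rw [map_zero, map_zero]
        exact HasExpansion.zero x
      | tmul r n =>
        rw [hΨ, hsmul, map_mul, ← IsScalarTower.algebraMap_apply]
        exact (HasExpansion.const x r).mul (hexp n)
      | add a b ha hb => rw [map_add, map_add]; exact ha.add hb
    obtain ⟨⟨α, σ⟩, hz⟩ := IsLocalization.surj I.primeCompl z
    change z * algebraMap _ _ σ.1 = algebraMap _ _ α at hz
    refine (h1 σ.1).of_isUnit_mul hx ?_ ?_
    · rw [hconst]
      exact fun h => σ.2 ((hI _).mpr h)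
    · rw [mul_comm, hz, ← hΦ, ← map_mul, mul_comm, hz, hΦ]
      exact h1 α

end BaseChange

open PowerSeries in
/-- Expansions of numerator and denominator give one of the quotient. -/
theorem HasExpansion.of_mul_eq {K N L : Type*} [Field K] [CommRing N] [CommRing L] [Algebra K L]
    [IsLocalRing L] {x : L} (hx : x ∈ IsLocalRing.maximalIdeal L) (hreg : IsLeftRegular x)
    {ψ : N →+* L} {Ψ : N →+* K⟦X⟧} {a b n : N} (ha : HasExpansion x (ψ a) (Ψ a))
    (hb : HasExpansion x (ψ b) (Ψ b)) (hne : Ψ b ≠ 0) (hab : b * n = a) :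
    HasExpansion x (ψ n) (Ψ n) := by
  subst hab
  set g := Ψ b with hg
  -- The denominator is a power of `x` times an element with invertible expansion; the power is
  -- cancelled by regularity and the rest by inversion.
  have h2 : X ^ g.order.toNat * g.divXPowOrder = g := X_pow_order_mul_divXPowOrder
  have hu : constantCoeff g.divXPowOrder ≠ 0 := by
    rw [constantCoeff_divXPowOrder]
    exact coeff_order hne
  obtain ⟨b', hb'⟩ := hb.pow_dvd (Dvd.intro _ h2)
  have h3 : HasExpansion x b' g.divXPowOrder := by
    refine HasExpansion.of_pow_mul_left hreg g.order.toNat ?_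
    rw [← hb', h2]
    exact hb
  refine h3.of_isUnit_mul hx hu (HasExpansion.of_pow_mul_left hreg g.order.toNat ?_)
  rw [← mul_assoc, ← mul_assoc, ← hb', h2, hg, ← map_mul, ← map_mul]
  exact ha

end PlaneCurves

namespace PlaneCurves

open MvPolynomial

/-! ### Descent of ideal membership from `K` to `k`. -/

section Descent

variable {k K R : Type*} [Field k] [Field K] [Algebra k K] [CommRing R] [Algebra k R]

/-- Membership in an extended ideal descends from `K ⊗ R`, up to a factor that does not vanish at a
given point. -/
theorem exists_mul_mem_of_mul_mem_map (ev : R →ₐ[k] K) (I : Ideal R) {δ : K ⊗[k] R}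
    (hδ : Algebra.TensorProduct.lift (AlgHom.id K K) ev (fun _ _ => Commute.all _ _) δ ≠ 0) {a : R}
    (h : δ * (1 ⊗ₜ[k] a) ∈
      I.map (Algebra.TensorProduct.includeRight : R →ₐ[k] K ⊗[k] R)) :
    ∃ r, ev r ≠ 0 ∧ r * a ∈ I := by
  let b := Module.Basis.ofVectorSpace k K
  -- A `k`-linear functional on `K` induces an `R`-linear map to `R` that sends the extended ideal
  -- into `I`. Every coordinate of `δ` thus multiplies `a` into `I`, and they cannot all vanish at
  -- the point.
  let lam : (K →ₗ[k] k) → K ⊗[k] R →ₗ[k] R := fun f =>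
    (TensorProduct.lid k R).toLinearMap ∘ₗ f.rTensor R
  have hlam : ∀ f r a, lam f (r ⊗ₜ a) = f r • a := fun f r a => by
    simp [lam]
  have hmul : ∀ f α a, lam f (α * (1 ⊗ₜ[k] a)) = lam f α * a := by
    intro f α a
    induction α using TensorProduct.induction_on with
    | zero => simp
    | tmul r c => rw [Algebra.TensorProduct.tmul_mul_tmul, mul_one, hlam, hlam, smul_mul_assoc]
    | add x y hx hy => rw [add_mul, map_add, map_add, hx, hy, add_mul]
  have hmem : ∀ f, ∀ z ∈ I.map (Algebra.TensorProduct.includeRight : R →ₐ[k] K ⊗[k] R),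
      ∀ α, lam f (α * z) ∈ I := by
    intro f z hz
    refine Submodule.span_induction ?_ ?_ ?_ ?_ hz
    · rintro _ ⟨a, ha, rfl⟩ α
      change lam f (α * (1 ⊗ₜ a)) ∈ I
      rw [hmul]
      exact Ideal.mul_mem_left _ _ ha
    · intro α
      simp
    · intro x y _ _ hx hy α
      rw [mul_add, map_add]
      exact add_mem (hx α) (hy α)
    · intro c x _ hx α
      rw [smul_eq_mul, ← mul_assoc]
      exact hx _
  obtain ⟨c, hc⟩ := TensorProduct.eq_repr_basis_left b δ
  have hcoef : ∀ i, lam (b.coord i) δ = c i := by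
    intro i
    rw [← hc, Finsupp.sum, map_sum]
    simp only [hlam]
    by_cases hi : i ∈ c.support
    · rw [Finset.sum_eq_single_of_mem i hi]
      · simp
      · intro j _ hj
        simp [hj]
    · rw [Finset.sum_eq_zero]
      · exact (Finsupp.notMem_support_iff.mp hi).symm
      · intro j hj
        have : j ≠ i := fun e => hi (e ▸ hj)
        simp [this]
  by_contra! hcon
  apply hδ
  rw [← hc, Finsupp.sum, map_sum]
  refine Finset.sum_eq_zero fun i _ => ?_
  have h1 : lam (b.coord i) δ * a ∈ I := by
    rw [← hmul, ← one_mul (δ * _)]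
    exact hmem _ _ h 1
  have h2 : ev (c i) = 0 := by
    rw [hcoef] at h1
    by_contra h2
    exact hcon _ h2 h1
  rw [Algebra.TensorProduct.lift_tmul, h2, mul_zero]

end Descent

section Powers

variable {K L : Type*} [Field K] [CommRing L] [Algebra K L]

theorem aeval_mem_pow_of_isHomogeneous {σ : Type*} {H : MvPolynomial σ K} {n : ℕ}
    (hH : H.IsHomogeneous n) {I : Ideal L} {δ : σ → L} (hδ : ∀ j, δ j ∈ I) : aeval δ H ∈ I ^ n := by
  rw [aeval_def, eval₂_eq]
  refine Submodule.sum_mem _ fun d hd => Ideal.mul_mem_left _ _ ?_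
  have h1 : ∑ i ∈ d.support, d i = n := by
    rw [← hH (mem_support_iff.mp hd), Finsupp.weight_apply, Finsupp.sum]
    simp
  rw [← h1, ← Finset.prod_pow_eq_pow_sum]
  exact Ideal.prod_mem_prod fun i _ => Ideal.pow_mem_pow (hδ i) _

theorem aeval_mem_pow_of_homogeneousComponent_eq_zero {σ : Type*} {H : MvPolynomial σ K} {m : ℕ}
    (hlow : ∀ n < m, homogeneousComponent n H = 0) {I : Ideal L} {δ : σ → L} (hδ : ∀ j, δ j ∈ I) :
    aeval δ H ∈ I ^ m := by
  rw [← sum_homogeneousComponent H, map_sum]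
  refine Submodule.sum_mem _ fun n _ => ?_
  rcases lt_or_ge n m with h | h
  · rw [hlow n h, map_zero]
    exact zero_mem _
  · exact Ideal.pow_le_pow_right h
      (aeval_mem_pow_of_isHomogeneous (homogeneousComponent_isHomogeneous n H) hδ)

theorem exists_sum_eq_of_mem_span_pair_pow {R : Type*} [CommRing R] {h q z : R} {m : ℕ}
    (hz : z ∈ Ideal.span {h, q} ^ m) :
    ∃ a : ℕ → R, z = ∑ j ∈ Finset.range (m + 1), a j * h ^ (m - j) * q ^ j := by
  induction m generalizing z with
  | zero => exact ⟨fun _ => z, by simp⟩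
  | succ m ih =>
    rw [pow_succ] at hz
    refine Submodule.mul_induction_on hz ?_ ?_
    · intro u hu w hw
      obtain ⟨a, ha⟩ := ih hu
      obtain ⟨r, t, rfl⟩ := Ideal.mem_span_pair.mp hw
      refine ⟨fun j => (if j ≤ m then a j * r else 0) + (if j = 0 then 0 else a (j - 1) * t), ?_⟩
      simp only [add_mul, Finset.sum_add_distrib]
      rw [Finset.sum_range_succ _ (m + 1), if_neg (by omega), Finset.sum_range_succ' _ (m + 1),
        mul_add, ha, Finset.sum_mul, Finset.sum_mul]
      simp only [if_true, zero_mul, add_zero, Nat.add_sub_cancel, if_neg (Nat.succ_ne_zero _)]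
      congr 1
      · refine Finset.sum_congr rfl fun j hj => ?_
        rw [Finset.mem_range] at hj
        rw [if_pos (by omega), show m + 1 - j = m - j + 1 by omega]
        ring
      · refine Finset.sum_congr rfl fun j hj => ?_
        rw [show m + 1 - (j + 1) = m - j by omega]
        ring
    · rintro _ _ ⟨a, rfl⟩ ⟨b, rfl⟩
      exact ⟨a + b, by simp only [Pi.add_apply, add_mul, Finset.sum_add_distrib]⟩

/-- The terms of second order are absorbed into `A` and `B`, so the expansion is exact. Two such
equations with independent linear parts can be solved for `x` and `y`. -/
theorem exists_aeval_eq_first_order {p v w : Fin 3 → K} {G : MvPolynomial (Fin 3) K}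
    (h0 : eval p G = 0) {I : Ideal L} {x y : L} (hx : x ∈ I) (hy : y ∈ I) :
    ∃ A B : L, A - algebraMap K L (∑ j, eval p (pderiv j G) * v j) ∈ I ∧
      B - algebraMap K L (∑ j, eval p (pderiv j G) * w j) ∈ I ∧
      aeval (fun j => algebraMap K L (p j) + (x * algebraMap K L (v j) + y * algebraMap K L (w j))) G =
        x * A + y * B := by
  classical
  have hδ : ∀ j, x * algebraMap K L (v j) + y * algebraMap K L (w j) ∈ Ideal.span {x, y} := fun j =>
    add_mem (Ideal.mul_mem_right _ _ (Ideal.subset_span (by simp)))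
      (Ideal.mul_mem_right _ _ (Ideal.subset_span (by simp)))
  have h1 := aeval_add_sub_mem_sq _ G p hδ
  have h2 : ∑ j, (x * algebraMap K L (v j) + y * algebraMap K L (w j)) *
      algebraMap K L (eval p (pderiv j G)) =
      x * algebraMap K L (∑ j, eval p (pderiv j G) * v j) +
      y * algebraMap K L (∑ j, eval p (pderiv j G) * w j) := by
    simp only [map_sum, map_mul, Finset.mul_sum, ← Finset.sum_add_distrib]
    exact Finset.sum_congr rfl fun j _ => by ring
  rw [h2, h0, map_zero, sub_zero, pow_two, Ideal.span_pair_mul_span_pair] at h1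
  simp only [Ideal.mem_span_insert, Ideal.mem_span_singleton'] at h1
  obtain ⟨a, z, ⟨b, z', ⟨c, z'', ⟨d, rfl⟩, rfl⟩, rfl⟩, e⟩ := h1
  refine ⟨algebraMap K L (∑ j, eval p (pderiv j G) * v j) + (a * x + b * y + c * y),
    algebraMap K L (∑ j, eval p (pderiv j G) * w j) + d * y, ?_, ?_, ?_⟩
  · rw [add_sub_cancel_left]
    exact add_mem (add_mem (Ideal.mul_mem_left _ _ hx) (Ideal.mul_mem_left _ _ hy))
      (Ideal.mul_mem_left _ _ hy)
  · rw [add_sub_cancel_left]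
    exact Ideal.mul_mem_left _ _ hy
  · linear_combination e

end Powers

/-! ### An auxiliary curve over `k` that is transversal to `C'`. -/

section Polar

variable {k K : Type*} [Field k] [Field K] [Algebra k K]

/-- The candidates are the Hasse derivatives of `F` of order `m - 1`. With `hv, hw` the derivatives
of `F'` along `v, w`, the vector `d = hw v - hv w` is the tangent direction of `F'`. If all
candidates were tangent to `d`, the derivative along `d` of the leading form of `F` would be zero;
then `d` would lie on all tangent lines of `F`, of which there are at least two. -/
theorem exists_hasseCoeff_transversal {F : MvPolynomial (Fin 3) k} {p v w : Fin 3 → K} {m : ℕ}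
    (hm : 2 ≤ m) (hlow : ∀ n < m, homogeneousComponent n (taylorAt (map (algebraMap k K) F) p) = 0)
    {c : K} (hc : c ≠ 0) {l : Fin m → Fin 3 → K}
    (hlead : homogeneousComponent m (taylorAt (map (algebraMap k K) F) p) =
      C c * ∏ a, ∑ j, C (l a j) * X j)
    (hdet : ∀ a b, a ≠ b →
      (∑ j, l a j * v j) * (∑ j, l b j * w j) ≠ (∑ j, l b j * v j) * (∑ j, l a j * w j))
    (hv hw : K) (hne : hw ≠ 0) :
    ∃ q : MvPolynomial (Fin 3) k, eval p (map (algebraMap k K) q) = 0 ∧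
      hw * (∑ j, eval p (pderiv j (map (algebraMap k K) q)) * v j) ≠
      hv * (∑ j, eval p (pderiv j (map (algebraMap k K) q)) * w j) := by
  classical
  set τ := taylorAt (map (algebraMap k K) F) p with hτ
  set d : Fin 3 → K := fun j => hw * v j - hv * w j with hd
  have hpd : ∀ α j, eval p (pderiv j (map (algebraMap k K) (hasseCoeff α F))) =
      coeff α (pderiv j τ) := by
    intro α j
    rw [hτ, pderiv_taylorAt, pderiv_map, pderiv_map, ← aeval_hasseCoeff, ← pderiv_hasseCoeff,
      eval_map, aeval_def]
  have hzero : ∀ α : Fin 3 →₀ ℕ, α.degree < m → coeff α τ = 0 := by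
    intro α hα
    have := congrArg (coeff α) (hlow _ hα)
    rwa [coeff_homogeneousComponent, if_pos rfl, coeff_zero] at this
  by_contra! hcon
  have h1 : ∀ α : Fin 3 →₀ ℕ, α.degree = m - 1 → ∑ j, d j * coeff α (pderiv j τ) = 0 := by
    intro α hα
    have := hcon (hasseCoeff α F) (by
      rw [eval_map, ← aeval_def, aeval_hasseCoeff]
      exact hzero α (by omega))
    simp only [hpd] at this
    rw [← sub_eq_zero, Finset.mul_sum, Finset.mul_sum, ← Finset.sum_sub_distrib] at this
    rw [← this]
    exact Finset.sum_congr rfl fun j _ => by rw [hd]; ring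
  set H := homogeneousComponent m τ with hH
  have h2 : ∑ j, C (d j) * pderiv j H = 0 := by
    ext α
    rw [coeff_sum, coeff_zero]
    simp only [coeff_C_mul]
    have h3 : ∀ j, coeff α (pderiv j H) = if α.degree + 1 = m then coeff α (pderiv j τ) else 0 := by
      intro j
      rw [coeff_pderiv, coeff_pderiv, hH, coeff_homogeneousComponent]
      simp
    simp only [h3]
    split_ifs with h
    · exact h1 α (by omega)
    · simp
  have h4 : ∀ a, ∑ j, l a j * d j = 0 := by
    intro a
    -- The direction of the tangent line `a`: the form `l a` vanishes at `e` and the other tangent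
    -- forms do not, so only one term of the product rule survives.
    set e : Fin 3 → K := fun j => (∑ j, l a j * w j) * v j - (∑ j, l a j * v j) * w j with he
    have hle : ∀ b, ∑ j, l b j * e j =
        (∑ j, l a j * w j) * (∑ j, l b j * v j) - (∑ j, l a j * v j) * (∑ j, l b j * w j) := by
      intro b
      rw [Finset.mul_sum, Finset.mul_sum, ← Finset.sum_sub_distrib]
      exact Finset.sum_congr rfl fun j _ => by rw [he]; ring
    have hpl : ∀ b j, pderiv j (∑ i, C (l b i) * X i) = C (l b j) := by
      intro b j
      rw [map_sum, Finset.sum_eq_single j]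
      · simp
      · intro i _ hij
        simp [pderiv_X_of_ne hij]
      · simp
    have h5 : ∀ j, eval e (pderiv j H) =
        c * (l a j * ∏ b ∈ Finset.univ.erase a, ∑ i, l b i * e i) := by
      intro j
      rw [hlead, pderiv_C_mul, ← Finset.mul_prod_erase _ _ (Finset.mem_univ a), pderiv_mul, hpl]
      simp only [map_mul, map_add, map_prod, map_sum, eval_C, eval_X]
      rw [hle a, mul_comm (∑ j, l a j * w j), sub_self, zero_mul, add_zero]
    have h6 := congrArg (eval e) h2
    simp only [map_sum, map_mul, eval_C, map_zero, h5] at h6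
    have h7 : (∑ j, l a j * d j) * (c * ∏ b ∈ Finset.univ.erase a, ∑ i, l b i * e i) = 0 := by
      rw [← h6, Finset.sum_mul]
      exact Finset.sum_congr rfl fun j _ => by ring
    refine (mul_eq_zero.mp h7).resolve_right (mul_ne_zero hc (Finset.prod_ne_zero_iff.mpr ?_))
    intro b hb
    rw [hle, sub_ne_zero, mul_comm]
    exact (hdet a b (Finset.ne_of_mem_erase hb).symm).symm
  have h8 : ∀ a, hw * (∑ j, l a j * v j) = hv * (∑ j, l a j * w j) := by
    intro a
    rw [← sub_eq_zero, ← h4 a, Finset.mul_sum, Finset.mul_sum, ← Finset.sum_sub_distrib]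
    exact Finset.sum_congr rfl fun j _ => by rw [hd]; ring
  refine hdet ⟨0, by omega⟩ ⟨1, by omega⟩ (by simp) (mul_left_cancel₀ hne ?_)
  rw [← mul_assoc, h8, ← mul_assoc, h8]
  ring

end Polar

end PlaneCurves

namespace PlaneCurves

open MvPolynomial

/-! ### The ideal of the point becomes principal on the normalisation. -/

section Principal

variable {k K : Type*} [Field k] [Field K] [Algebra k K] {s : Fin 3 → K} {i : Fin 3}

theorem map_dehomogenize {L : Type*} [CommRing L] [Algebra K L] (hi : s i ≠ 0)
    {θ : PlaneLocalRing k s →+* L}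
    (hθ : ∀ r : k, θ (algebraMap k _ r) = algebraMap K L (algebraMap k K r))
    (G : MvPolynomial (Fin 3) k) :
    θ (dehomogenize k hi G) = aeval (fun j => θ (planeCoord hi j)) (map (algebraMap k K) G) := by
  rw [dehomogenize, aeval_def, aeval_def, eval₂_map, hom_eval₂]
  congr 1
  ext r
  exact hθ r

theorem planeCoord_self (hi : s i ≠ 0) : planeCoord (k := k) hi i = 1 := by
  have := dehomogenize_X_self (k := k) hi
  rwa [dehomogenize, aeval_X] at this

theorem evalAt_planeCoord (hi : s i ≠ 0) (j : Fin 3) :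
    evalAt k s (planeCoord hi j) = s j / s i := by
  have := evalAt_dehomogenize (k := k) hi (X j)
  rwa [dehomogenize, aeval_X, aeval_X] at this

variable {v w : Fin 3 → K} {m : ℕ} {F F' q : MvPolynomial (Fin 3) k}

-- Over `K` the functions `F'` and `q` have independent linear terms, so near the point they
-- generate the ideal of the point, whose `m`-th power contains `F`; descent gives coefficients over
-- `k`. They are not all in the maximal ideal because `F` vanishes to order exactly `m` along the
-- line `p + t w`.
open PowerSeries in
theorem exists_dehomogenize_eq_sum (hi : s i ≠ 0) (hfr : IsFrame i (fun j => s j / s i) v w)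
    (hlow : ∀ n < m, homogeneousComponent n
      (taylorAt (MvPolynomial.map (algebraMap k K) F) fun j => s j / s i) = 0)
    (hw : eval w (homogeneousComponent m
      (taylorAt (MvPolynomial.map (algebraMap k K) F) fun j => s j / s i)) ≠ 0)
    (hF' : eval (fun j => s j / s i) (MvPolynomial.map (algebraMap k K) F') = 0)
    (hq : eval (fun j => s j / s i) (MvPolynomial.map (algebraMap k K) q) = 0)
    (hdet : (∑ j, eval (fun j => s j / s i) (pderiv j (MvPolynomial.map (algebraMap k K) F')) * w j) *
        (∑ j, eval (fun j => s j / s i) (pderiv j (MvPolynomial.map (algebraMap k K) q)) * v j) ≠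
      (∑ j, eval (fun j => s j / s i) (pderiv j (MvPolynomial.map (algebraMap k K) F')) * v j) *
        (∑ j, eval (fun j => s j / s i) (pderiv j (MvPolynomial.map (algebraMap k K) q)) * w j)) :
    ∃ a : ℕ → PlaneLocalRing k s, dehomogenize k hi F =
      ∑ j ∈ Finset.range (m + 1), a j * dehomogenize k hi F' ^ (m - j) * dehomogenize k hi q ^ j ∧
      ∃ j ≤ m, evalAt k s (a j) ≠ 0 := by
  set p : Fin 3 → K := fun j => s j / s i with hp
  have hmem : dehomogenize k hi F ∈ Ideal.span {dehomogenize k hi F', dehomogenize k hi q} ^ m := by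
    let θ : PlaneLocalRing k s →ₐ[k] K ⊗[k] PlaneLocalRing k s := Algebra.TensorProduct.includeRight
    have hθ : ∀ r : k, θ (algebraMap k _ r) =
        algebraMap K (K ⊗[k] PlaneLocalRing k s) (algebraMap k K r) := by
      intro r
      rw [AlgHom.commutes, ← IsScalarTower.algebraMap_apply]
    let χ : K ⊗[k] PlaneLocalRing k s →ₐ[K] K :=
      Algebra.TensorProduct.lift (AlgHom.id K K) (evalAt k s) fun _ _ => Commute.all _ _
    have hχ : ∀ a, χ (θ a) = evalAt k s a := fun a => by
      change χ (1 ⊗ₜ a) = _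
      rw [Algebra.TensorProduct.lift_tmul, map_one, one_mul]
    set I := RingHom.ker χ with hI
    have hg : ∀ G, θ (dehomogenize k hi G) = _ := map_dehomogenize (θ := θ.toRingHom) hi hθ
    obtain ⟨x, y, hξ, hxy⟩ := hfr.exists_decomposition (L := K ⊗[k] PlaneLocalRing k s)
      (ξ := fun j => θ (planeCoord hi j)) (by rw [planeCoord_self, map_one])
    obtain ⟨hx, hy⟩ := hxy I fun j => by
      rw [hI, RingHom.mem_ker, map_sub, hχ, evalAt_planeCoord, AlgHom.commutes]
      exact sub_self _
    have hξ' : (fun j => θ.toRingHom (planeCoord hi j)) = _ := funext hξ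
    simp only [hξ'] at hg
    obtain ⟨A₁, B₁, hA₁, hB₁, e₁⟩ := exists_aeval_eq_first_order (v := v) (w := w) hF' hx hy
    obtain ⟨A₂, B₂, hA₂, hB₂, e₂⟩ := exists_aeval_eq_first_order (v := v) (w := w) hq hx hy
    rw [← hg] at e₁ e₂
    have hχval : ∀ {A : K ⊗[k] PlaneLocalRing k s} {r : K}, A - algebraMap K _ r ∈ I → χ A = r := by
      intro A r h
      rw [hI, RingHom.mem_ker, map_sub, AlgHom.commutes, sub_eq_zero] at h
      exact h
    set J := Ideal.span {dehomogenize k hi F', dehomogenize k hi q} with hJ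
    -- The determinant of Cramer's rule. It does not vanish at the point, but `K ⊗ R` need not be
    -- local, so it is carried as the factor `D ^ m` until the descent removes it.
    set D := A₁ * B₂ - A₂ * B₁ with hD
    have hχD : χ D ≠ 0 := by
      rw [hD, map_sub, map_mul, map_mul, hχval hA₁, hχval hB₁, hχval hA₂, hχval hB₂]
      intro h0
      apply hdet
      linear_combination -h0
    have h1 : θ (dehomogenize k hi F') ∈ J.map θ := Ideal.mem_map_of_mem _ (Ideal.subset_span (by simp))
    have h2 : θ (dehomogenize k hi q) ∈ J.map θ := Ideal.mem_map_of_mem _ (Ideal.subset_span (by simp))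
    have hDI : Ideal.span {D} * Ideal.span {x, y} ≤ J.map θ := by
      rw [Ideal.span_mul_span', Ideal.span_le]
      rintro _ ⟨_, rfl, z, hz, rfl⟩
      change D * z ∈ J.map θ
      rcases hz with rfl | rfl
      · have : D * z = B₂ * θ (dehomogenize k hi F') - B₁ * θ (dehomogenize k hi q) := by
          rw [e₁, e₂]; ring
        rw [this]
        exact sub_mem (Ideal.mul_mem_left _ _ h1) (Ideal.mul_mem_left _ _ h2)
      · have : D * z = A₁ * θ (dehomogenize k hi q) - A₂ * θ (dehomogenize k hi F') := by
          rw [e₁, e₂]; ring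
        rw [this]
        exact sub_mem (Ideal.mul_mem_left _ _ h2) (Ideal.mul_mem_left _ _ h1)
    have h3 : θ (dehomogenize k hi F) ∈ Ideal.span {x, y} ^ m := by
      rw [hg, ← aeval_taylorAt]
      exact aeval_mem_pow_of_homogeneousComponent_eq_zero hlow fun j =>
        add_mem (Ideal.mul_mem_right _ _ (Ideal.subset_span (by simp)))
          (Ideal.mul_mem_right _ _ (Ideal.subset_span (by simp)))
    have h4 : D ^ m * θ (dehomogenize k hi F) ∈ (J ^ m).map θ := by
      rw [Ideal.map_pow]
      refine Ideal.pow_right_mono hDI m ?_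
      rw [mul_pow]
      exact Ideal.mul_mem_mul (Ideal.pow_mem_pow (Ideal.mem_span_singleton_self D) m) h3
    obtain ⟨r, hr, hr'⟩ := exists_mul_mem_of_mul_mem_map (evalAt k s) (J ^ m) (δ := D ^ m) (by
      change χ (D ^ m) ≠ 0
      rw [map_pow]
      exact pow_ne_zero m hχD) h4
    obtain ⟨u, hu⟩ := (isUnit_of_evalAt_ne_zero hr).exists_left_inv
    have := Ideal.mul_mem_left _ u hr'
    rwa [← mul_assoc, hu, one_mul] at this
  obtain ⟨a, ha⟩ := exists_sum_eq_of_mem_span_pair_pow hmem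
  refine ⟨a, ha, ?_⟩
  -- If all `a j` vanish at the point, every summand has order at least `m + 1` along `p + t w`.
  by_contra! hcon
  let c : Fin 3 → K⟦X⟧ := fun j => algebraMap K K⟦X⟧ (p j) + PowerSeries.X * algebraMap K K⟦X⟧ (w j)
  have hcc : ∀ j, constantCoeff (c j) = p j := by
    intro j
    change PowerSeries.constantCoeff (PowerSeries.C (p j) + PowerSeries.X * PowerSeries.C (w j)) = _
    simp
  obtain ⟨φ, hφ, hφ'⟩ := exists_arc (k := k) hi hcc (by
    simp only [c]
    rw [hfr.base, hfr.snd, map_one, map_zero, mul_zero, add_zero])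
  have hφm : ∀ G, φ (dehomogenize k hi G) =
      MvPolynomial.aeval c (MvPolynomial.map (algebraMap k K) G) := by
    intro G
    rw [hφ, aeval_map_algebraMap]
  have hX : ∀ b, evalAt k s b = 0 → PowerSeries.X ∣ φ b := by
    intro b hb
    rw [X_dvd_iff, hφ', hb]
  have hdvd : PowerSeries.X ^ (m + 1) ∣ φ (dehomogenize k hi F) := by
    rw [ha, map_sum]
    refine Finset.dvd_sum fun j hj => ?_
    rw [Finset.mem_range, Nat.lt_succ_iff] at hj
    rw [map_mul, map_mul, map_pow, map_pow, mul_assoc, pow_succ']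
    have e : (PowerSeries.X : K⟦X⟧) ^ m = PowerSeries.X ^ (m - j) * PowerSeries.X ^ j := by rw [← pow_add, Nat.sub_add_cancel hj]
    rw [e]
    refine mul_dvd_mul (hX _ (hcon j hj)) (mul_dvd_mul (pow_dvd_pow_of_dvd (hX _ ?_) _)
      (pow_dvd_pow_of_dvd (hX _ ?_) _))
    · rwa [evalAt_dehomogenize, aeval_def, ← eval_map]
    · rwa [evalAt_dehomogenize, aeval_def, ← eval_map]
  obtain ⟨r, hr⟩ := exists_aeval_mul_eq hlow (PowerSeries.X : K⟦X⟧) (fun j => algebraMap K _ (w j))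
  rw [aeval_taylorAt] at hr
  rw [hφm, hr, pow_succ, mul_dvd_mul_iff_left (pow_ne_zero m PowerSeries.X_ne_zero), X_dvd_iff, map_add, map_mul,
    PowerSeries.constantCoeff_X, zero_mul, add_zero] at hdvd
  apply hw
  have e := aeval_algebraMap_apply (A := K) K⟦X⟧ w (homogeneousComponent m
    (taylorAt (MvPolynomial.map (algebraMap k K) F) p))
  have h0 := (congrArg PowerSeries.constantCoeff e).symm.trans hdvd
  exact h0

/-- On the integral closure, a curve with multiplicity `m` given by a form of degree `m` in `h` and
`q` separates: locally one of `h` and `q` divides the other. -/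
theorem dvd_or_dvd_of_eq_sum {L : Type*} [CommRing L] [IsLocalRing L]
    (θ : NormalizedLocalRing F s →+* L) {f h q : PlaneLocalRing k s} (hf : f ∈ curveIdeal F s)
    (hh : Ideal.Quotient.mk (curveIdeal F s) h ∈ nonZeroDivisors (CurveLocalRing F s))
    {a : ℕ → PlaneLocalRing k s}
    (ha : f = ∑ j ∈ Finset.range (m + 1), a j * h ^ (m - j) * q ^ j)
    (hu : ∃ j ≤ m, evalAt k s (a j) ≠ 0) :
    θ (toNormalized F s h) ∣ θ (toNormalized F s q) ∨
      θ (toNormalized F s q) ∣ θ (toNormalized F s h) := by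
  have h0 := Ideal.Quotient.eq_zero_iff_mem.mpr hf
  rw [ha, map_sum] at h0
  simp only [map_mul, map_pow] at h0
  obtain ⟨b, c, hb0, hbc, hmul⟩ := exists_integralClosure_division (Q := FractionRing (CurveLocalRing F s))
    m (fun j => Ideal.Quotient.mk (curveIdeal F s) (a j)) (IsLocalization.map_units _ ⟨_, hh⟩) h0
  obtain ⟨j, hj, haj⟩ := hu
  have hunit : IsUnit (θ (toNormalized F s (a j))) :=
    ((isUnit_of_evalAt_ne_zero haj).map (toNormalized F s)).map θ
  have hmul' : ∀ j, θ (toNormalized F s h) * θ (c j) = θ (toNormalized F s q) * θ (b (j + 1)) := by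
    intro j
    rw [← map_mul, ← map_mul]
    exact congrArg θ (hmul j)
  -- The unit `a j` equals `b j - c j`, so in the local ring one of `b j` and `c j` is a unit. In
  -- the first case `h ∣ q`, from the relation of index `j - 1`; in the second `q ∣ h`.
  have e : θ (b j) + -θ (c j) = θ (toNormalized F s (a j)) := by
    rw [hbc j hj, map_add, add_neg_cancel_comm]
    rfl
  rw [← e] at hunit
  rcases IsLocalRing.isUnit_or_isUnit_of_isUnit_add hunit with h1 | h1
  · left
    cases j with
    | zero =>
      rw [hb0, map_zero] at h1
      exact absurd h1 not_isUnit_zero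
    | succ j =>
      rw [← h1.dvd_mul_right (b := θ (toNormalized F s q)), ← hmul']
      exact Dvd.intro _ rfl
  · right
    rw [IsUnit.neg_iff] at h1
    rw [← h1.dvd_mul_right (b := θ (toNormalized F s h)), hmul']
    exact Dvd.intro _ rfl

/-- Since `F'` vanishes at `p`, its value at the point is a multiple of `x`, and a factor of a
regular element is regular. -/
theorem isLeftRegular_of_first_order {L : Type*} [CommRing L]
    [Algebra K L] {p : Fin 3 → K} {x ℓ : L} {F' : MvPolynomial (Fin 3) K}
    (hF' : eval p F' = 0)
    (hreg : IsLeftRegular (aeval (fun j => algebraMap K L (p j) +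
      (x * algebraMap K L (v j) + x * ℓ * algebraMap K L (w j))) F')) : IsLeftRegular x := by
  obtain ⟨A, B, -, -, e⟩ := exists_aeval_eq_first_order (v := v) (w := w) (L := L) hF' (I := ⊤)
    (x := x) (y := x * ℓ) trivial trivial
  rw [e, show x * A + x * ℓ * B = (A + ℓ * B) * x by ring] at hreg
  exact hreg.of_mul

variable {L : Type*} [CommRing L] [IsLocalRing L] [Algebra K L]

/-- By Cramer's rule `x` and `y` are combinations of the values of `F'` and `q`. The one of these
two that divides the other therefore generates `(x, y)`, and it is regular since it is, or divides,
the value of `F'`. -/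
theorem exists_eq_mul_of_dvd_or_dvd {p : Fin 3 → K} {x y : L} {F F' q : MvPolynomial (Fin 3) K}
    (hx : x ∈ IsLocalRing.maximalIdeal L) (hy : y ∈ IsLocalRing.maximalIdeal L)
    (hlow : ∀ n < m, homogeneousComponent n (taylorAt F p) = 0)
    (hw : eval w (homogeneousComponent m (taylorAt F p)) ≠ 0)
    (hF' : eval p F' = 0) (hq : eval p q = 0)
    (hdet : (∑ j, eval p (pderiv j F') * w j) * (∑ j, eval p (pderiv j q) * v j) ≠
      (∑ j, eval p (pderiv j F') * v j) * (∑ j, eval p (pderiv j q) * w j)) {ξ : Fin 3 → L}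
    (hξ : ξ = fun j => algebraMap K L (p j) + (x * algebraMap K L (v j) + y * algebraMap K L (w j)))
    (hF : aeval ξ F = 0) (hreg : IsLeftRegular (aeval ξ F'))
    (hdvd : aeval ξ F' ∣ aeval ξ q ∨ aeval ξ q ∣ aeval ξ F') : ∃ ℓ, y = x * ℓ := by
  subst hξ
  obtain ⟨A₁, B₁, hA₁, hB₁, e₁⟩ := exists_aeval_eq_first_order (v := v) (w := w) hF' hx hy
  obtain ⟨A₂, B₂, hA₂, hB₂, e₂⟩ := exists_aeval_eq_first_order (v := v) (w := w) hq hx hy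
  have hD : IsUnit (A₁ * B₂ - A₂ * B₁) := by
    by_contra hD
    set a₁ := ∑ j, eval p (pderiv j F') * v j
    set b₁ := ∑ j, eval p (pderiv j F') * w j
    set a₂ := ∑ j, eval p (pderiv j q) * v j
    set b₂ := ∑ j, eval p (pderiv j q) * w j
    have hD' : A₁ * B₂ - A₂ * B₁ ∈ IsLocalRing.maximalIdeal L := hD
    have h1 : (A₁ * B₂ - A₂ * B₁) - algebraMap K L (a₁ * b₂ - a₂ * b₁) ∈
        IsLocalRing.maximalIdeal L := by
      have : (A₁ * B₂ - A₂ * B₁) - algebraMap K L (a₁ * b₂ - a₂ * b₁) =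
          (B₂ * (A₁ - algebraMap K L a₁) + algebraMap K L a₁ * (B₂ - algebraMap K L b₂)) -
          (B₁ * (A₂ - algebraMap K L a₂) + algebraMap K L a₂ * (B₁ - algebraMap K L b₁)) := by
        rw [map_sub, map_mul, map_mul]
        ring
      rw [this]
      exact sub_mem (add_mem (Ideal.mul_mem_left _ _ hA₁) (Ideal.mul_mem_left _ _ hB₂))
        (add_mem (Ideal.mul_mem_left _ _ hA₂) (Ideal.mul_mem_left _ _ hB₁))
    have h2 := sub_mem hD' h1
    rw [sub_sub_cancel] at h2
    refine algebraMap_notMem_maximalIdeal (fun h0 => hdet ?_) h2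
    linear_combination -h0
  obtain ⟨u, hu⟩ := hD.exists_left_inv
  rw [e₁, e₂] at hdvd
  rw [e₁] at hreg
  have ex : x = u * B₂ * (x * A₁ + y * B₁) - u * B₁ * (x * A₂ + y * B₂) := by
    linear_combination -x * hu
  have ey : y = u * A₁ * (x * A₂ + y * B₂) - u * A₂ * (x * A₁ + y * B₁) := by
    linear_combination -y * hu
  have hmem : ∀ A B, x * A + y * B ∈ Ideal.span {x, y} := fun A B =>
    Ideal.mem_span_pair.mpr ⟨A, B, by ring⟩
  rcases hdvd with h | h
  · refine exists_eq_mul_of_principal hx hy hlow hw hF hreg ?_ ?_ (hmem A₁ B₁)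
    · nth_rewrite 2 [ex]
      exact dvd_sub (Dvd.dvd.mul_left dvd_rfl _) (Dvd.dvd.mul_left h _)
    · nth_rewrite 2 [ey]
      exact dvd_sub (Dvd.dvd.mul_left h _) (Dvd.dvd.mul_left dvd_rfl _)
  · have hreg' : IsLeftRegular (x * A₂ + y * B₂) := by
      obtain ⟨z, hz⟩ := h
      rw [hz, mul_comm] at hreg
      exact hreg.of_mul
    refine exists_eq_mul_of_principal hx hy hlow hw hF hreg' ?_ ?_ (hmem A₂ B₂)
    · nth_rewrite 2 [ex]
      exact dvd_sub (Dvd.dvd.mul_left h _) (Dvd.dvd.mul_left dvd_rfl _)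
    · nth_rewrite 2 [ey]
      exact dvd_sub (Dvd.dvd.mul_left dvd_rfl _) (Dvd.dvd.mul_left h _)

/-- On the normalisation, the second coordinate at an ordinary point is a multiple of the first. -/
theorem exists_eq_mul_of_normalized (hi : s i ≠ 0) {d : ℕ} (hF : F.IsHomogeneous d)
    (hfr : IsFrame i (fun j => s j / s i) v w) (hm : m ≠ 0)
    (hlow : ∀ n < m, homogeneousComponent n
      (taylorAt (MvPolynomial.map (algebraMap k K) F) fun j => s j / s i) = 0)
    {c : K} (hc : c ≠ 0) {l : Fin m → Fin 3 → K}
    (hlead : homogeneousComponent m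
      (taylorAt (MvPolynomial.map (algebraMap k K) F) fun j => s j / s i) =
      C c * ∏ a, ∑ j, C (l a j) * X j)
    (hw : ∀ a, ∑ j, l a j * w j ≠ 0)
    (hdet : ∀ a b, a ≠ b →
      (∑ j, l a j * v j) * (∑ j, l b j * w j) ≠ (∑ j, l b j * v j) * (∑ j, l a j * w j))
    (hF' : eval (fun j => s j / s i) (MvPolynomial.map (algebraMap k K) F') = 0)
    (hw' : ∑ j, eval (fun j => s j / s i) (pderiv j (MvPolynomial.map (algebraMap k K) F')) * w j ≠ 0)
    (hh : Ideal.Quotient.mk (curveIdeal F s) (dehomogenize k hi F') ∈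
      nonZeroDivisors (CurveLocalRing F s))
    {θ : NormalizedLocalRing F s →+* L}
    (hθ : ∀ r : k, θ (toNormalized F s (algebraMap k _ r)) = algebraMap K L (algebraMap k K r))
    (hreg : IsLeftRegular (θ (toNormalized F s (dehomogenize k hi F'))))
    {x y : L} (hx : x ∈ IsLocalRing.maximalIdeal L) (hy : y ∈ IsLocalRing.maximalIdeal L)
    (hξ : ∀ j, θ (toNormalized F s (planeCoord hi j)) = algebraMap K L (s j / s i) +
      (x * algebraMap K L (v j) + y * algebraMap K L (w j))) : ∃ ℓ, y = x * ℓ := by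
  have hmem : dehomogenize k hi F ∈ curveIdeal F s := by
    rw [curveIdeal_eq_span hi hF]
    exact Ideal.mem_span_singleton_self _
  have hθ0 : ∀ a ∈ curveIdeal F s, θ (toNormalized F s a) = 0 := by
    intro a ha
    rw [toNormalized, RingHom.comp_apply, Ideal.Quotient.eq_zero_iff_mem.mpr ha, map_zero, map_zero]
  have hdeh : ∀ G, θ (toNormalized F s (dehomogenize k hi G)) = _ :=
    map_dehomogenize (θ := θ.comp (toNormalized F s)) hi hθ
  have hξ' : (fun j => (θ.comp (toNormalized F s)) (planeCoord hi j)) = _ := funext hξ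
  have hwF : eval w (homogeneousComponent m
      (taylorAt (MvPolynomial.map (algebraMap k K) F) fun j => s j / s i)) ≠ 0 := by
    rw [hlead]
    simp only [map_mul, map_prod, map_sum, eval_C, eval_X]
    exact mul_ne_zero hc (Finset.prod_ne_zero_iff.mpr fun a _ => hw a)
  have hF0 := hθ0 _ hmem
  rw [hdeh] at hF0 hreg
  -- For `m = 1` the implicit function argument is enough; the auxiliary curve `q` requires two
  -- distinct tangent lines.
  rcases Nat.lt_or_ge m 2 with h2 | h2
  · obtain rfl : m = 1 := by omega
    have hs := hlow 0 one_pos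
    rw [homogeneousComponent_zero_taylorAt, C_eq_zero] at hs
    rw [homogeneousComponent_one_taylorAt] at hwF
    simp only [map_sum, map_mul, eval_C, eval_X] at hwF
    rw [hξ'] at hF0
    exact exists_eq_mul_of_smooth hx hy hs hwF hF0
  · obtain ⟨q, hq, hqdet⟩ := exists_hasseCoeff_transversal h2 hlow hc hlead hdet
      (∑ j, eval (fun j => s j / s i) (pderiv j (MvPolynomial.map (algebraMap k K) F')) * v j) _ hw'
    obtain ⟨a, ha, hu⟩ := exists_dehomogenize_eq_sum hi hfr hlow hwF hF' hq hqdet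
    have hdvd := dvd_or_dvd_of_eq_sum θ hmem hh ha hu
    rw [hdeh, hdeh] at hdvd
    exact exists_eq_mul_of_dvd_or_dvd hx hy hlow hwF hF' hq hqdet hξ' hF0 hreg hdvd

end Principal

end PlaneCurves

namespace PlaneCurves

/-! ### Arcs written in a frame. -/

section Frame

variable {K : Type*} [Field K] {i : Fin 3} {p v w : Fin 3 → K}

theorem IsFrame.eq_zero_of_mul_add_mul (h : IsFrame i p v w) {L : Type*} [CommRing L] [Algebra K L]
    {x y : L} (hxy : ∀ j, x * algebraMap K L (v j) + y * algebraMap K L (w j) = 0) :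
    x = 0 ∧ y = 0 := by
  obtain ⟨f, g, hfg⟩ := h.exists_coord
  set j₁ := i.succAbove 0
  set j₂ := i.succAbove 1
  have h12 : j₁ ≠ j₂ := fun h => by simpa using Fin.succAbove_right_injective h
  have e11 := hfg j₁ j₁ (Fin.succAbove_ne i 0)
  have e12 := hfg j₁ j₂ (Fin.succAbove_ne i 1)
  have e21 := hfg j₂ j₁ (Fin.succAbove_ne i 0)
  have e22 := hfg j₂ j₂ (Fin.succAbove_ne i 1)
  rw [if_pos rfl] at e11 e22
  rw [if_neg h12] at e12
  rw [if_neg h12.symm] at e21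
  -- The two determinants belong to mutually inverse matrices.
  have hD : (f j₁ * g j₂ - f j₂ * g j₁) * (v j₁ * w j₂ - v j₂ * w j₁) = 1 := by
    linear_combination -(f j₂ * v j₂ + g j₂ * w j₂) * e11 - e22 + (f j₂ * v j₁ + g j₂ * w j₁) * e21
  have hD' := congrArg (algebraMap K L) hD
  simp only [map_mul, map_sub, map_one] at hD'
  constructor
  · linear_combination (-x) * hD' + (algebraMap K L (f j₁) * algebraMap K L (g j₂) -
      algebraMap K L (f j₂) * algebraMap K L (g j₁)) *
      (algebraMap K L (w j₂) * hxy j₁ - algebraMap K L (w j₁) * hxy j₂)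
  · linear_combination (-y) * hD' + (algebraMap K L (f j₁) * algebraMap K L (g j₂) -
      algebraMap K L (f j₂) * algebraMap K L (g j₁)) *
      (algebraMap K L (v j₁) * hxy j₂ - algebraMap K L (v j₂) * hxy j₁)

open PowerSeries

/-- The arc `p + t v + t γ w`. -/
noncomputable def arc (p v w : Fin 3 → K) (γ : K⟦X⟧) (j : Fin 3) : K⟦X⟧ :=
  algebraMap K K⟦X⟧ (p j) + (X * algebraMap K K⟦X⟧ (v j) + X * γ * algebraMap K K⟦X⟧ (w j))

theorem constantCoeff_arc (p v w : Fin 3 → K) (γ : K⟦X⟧) (j : Fin 3) :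
    constantCoeff (arc p v w γ j) = p j := by
  change constantCoeff (C (p j) + (X * C (v j) + X * γ * C (w j))) = _
  simp

theorem constantCoeff_aeval_arc {k : Type*} [Field k] [Algebra k K] (p v w : Fin 3 → K) (γ : K⟦X⟧)
    (G : MvPolynomial (Fin 3) k) :
    constantCoeff (MvPolynomial.aeval (arc p v w γ) G) = MvPolynomial.aeval p G := by
  induction G using MvPolynomial.induction_on with
  | C r =>
    rw [MvPolynomial.aeval_C, MvPolynomial.aeval_C]
    change constantCoeff (C (algebraMap k K r)) = _
    simp
  | add a b ha hb => rw [map_add, map_add, map_add, ha, hb]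
  | mul_X a j ha =>
    rw [map_mul, map_mul, map_mul, ha, MvPolynomial.aeval_X, MvPolynomial.aeval_X, constantCoeff_arc]

theorem IsFrame.arc_self (h : IsFrame i p v w) (γ : K⟦X⟧) : arc p v w γ i = 1 := by
  simp [arc, h.base, h.fst, h.snd]

/-- The linear coefficient of the arc is `v` plus a multiple of `w`, which is nonzero in a frame. -/
theorem IsFrame.exists_arc_ne_C (h : IsFrame i p v w) (γ : K⟦X⟧) :
    ∃ j, ∀ r : K, arc p v w γ j ≠ PowerSeries.C r := by
  by_contra! hcon
  have h1 : ∀ j, (1 : K) * algebraMap K K (v j) + constantCoeff γ * algebraMap K K (w j) = 0 := by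
    intro j
    obtain ⟨r, hr⟩ := hcon j
    have := congrArg (coeff 1) hr
    change coeff 1 (C (p j) + (X * C (v j) + X * γ * C (w j))) = _ at this
    rw [show X * C (v j) + X * γ * C (w j) = X * (C (v j) + γ * C (w j)) by ring, map_add,
      show (1 : ℕ) = 0 + 1 from rfl, coeff_succ_X_mul] at this
    simpa [coeff_C] using this
  exact one_ne_zero (h.eq_zero_of_mul_add_mul h1).1

theorem IsFrame.eq_of_arc_eq (h : IsFrame i p v w) {γ a b : K⟦X⟧}
    (hab : ∀ j, arc p v w γ j = algebraMap K K⟦X⟧ (p j) +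
      (a * algebraMap K K⟦X⟧ (v j) + b * algebraMap K K⟦X⟧ (w j))) : a = X ∧ b = X * γ := by
  obtain ⟨h1, h2⟩ := h.eq_zero_of_mul_add_mul (x := a - X) (y := b - X * γ) (fun j => by
    have := hab j
    rw [arc] at this
    linear_combination -this)
  exact ⟨sub_eq_zero.mp h1, sub_eq_zero.mp h2⟩

theorem HasExpansion.arc {L : Type*} [CommRing L] [Algebra K L] {x y : L} {γ : K⟦X⟧}
    (hy : HasExpansion x y (X * γ)) (j : Fin 3) :
    HasExpansion x (algebraMap K L (p j) + (x * algebraMap K L (v j) + y * algebraMap K L (w j)))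
      (PlaneCurves.arc p v w γ j) :=
  (const x _).add (((self x).mul (const x _)).add (hy.mul (const x _)))

end Frame

/-! ### Orders of contact between branches. -/

section Contact

open PowerSeries

variable {K : Type*} [Field K] {F F' : MvPolynomial (Fin 3) K} {p v w : Fin 3 → K} {m : ℕ}

theorem Branches.aeval_arc (B : Branches F p v w m) (γ : K⟦X⟧) :
    MvPolynomial.aeval (arc p v w γ) F =
      X ^ m * B.poly.eval₂ Polynomial.coeToPowerSeries.ringHom γ := by
  rw [← toRingHom_aeval_X]
  exact B.aeval_eq_pow_mul X γ

theorem constantCoeff_eval₂_coeToPowerSeries (P : Polynomial (Polynomial K)) (γ : K⟦X⟧) :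
    constantCoeff (P.eval₂ Polynomial.coeToPowerSeries.ringHom γ) =
      P.eval₂ Polynomial.constantCoeff (constantCoeff γ) := by
  have hcc : (PowerSeries.constantCoeff (R := K)).comp Polynomial.coeToPowerSeries.ringHom =
      Polynomial.constantCoeff := by
    ext <;> simp
  rw [Polynomial.hom_eval₂, hcc]

/-- Divide the polynomial by its root `series a`, with cofactor `Q`. If `γ` starts at the slope of
`a`, the constant term of `Q(γ)` is the derivative at a simple root; otherwise `γ` starts at no
slope and the whole polynomial is nonzero there. -/
theorem Branches.exists_eval₂_eq (B : Branches F p v w m) (a : Fin m) (γ : K⟦X⟧)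
    (ha : ∀ b, constantCoeff γ = B.slope b → b = a) :
    ∃ u, constantCoeff u ≠ 0 ∧
      B.poly.eval₂ Polynomial.coeToPowerSeries.ringHom γ = (γ - B.series a) * u := by
  set P := B.poly.map Polynomial.coeToPowerSeries.ringHom with hP
  have hroot : P.IsRoot (B.series a) := by
    rw [Polynomial.IsRoot, hP, Polynomial.eval_map]
    exact B.eval_series a
  obtain ⟨Q, hQ⟩ := Polynomial.dvd_iff_isRoot.mpr hroot
  have h1 : ∀ γ, B.poly.eval₂ Polynomial.coeToPowerSeries.ringHom γ = (γ - B.series a) * Q.eval γ := by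
    intro γ
    rw [← Polynomial.eval_map, ← hP, hQ]
    simp
  refine ⟨Q.eval γ, ?_, h1 γ⟩
  by_cases hγ : constantCoeff γ = B.slope a
  · have h2 : B.poly.derivative.eval₂ Polynomial.coeToPowerSeries.ringHom (B.series a) =
        Q.eval (B.series a) := by
      rw [← Polynomial.eval_map, ← Polynomial.derivative_map, ← hP, hQ]
      simp
    have h3 := B.derivative_ne_zero a
    rw [← B.constantCoeff_series, ← constantCoeff_eval₂_coeToPowerSeries, h2] at h3
    have h4 : ∀ γ, constantCoeff (Q.eval γ) = (Q.map constantCoeff).eval (constantCoeff γ) := by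
      intro γ
      rw [← Polynomial.eval₂_hom, Polynomial.eval_map]
    rw [h4, hγ, ← B.constantCoeff_series, ← h4]
    exact h3
  · intro h0
    have h2 : B.poly.eval₂ Polynomial.constantCoeff (constantCoeff γ) = 0 := by
      rw [← constantCoeff_eval₂_coeToPowerSeries, h1, map_mul, h0, mul_zero]
    obtain ⟨b, hb⟩ := B.exists_eq_slope _ h2
    exact hγ (by rw [hb, ha b hb])

/-- The order of contact of two distinct series. -/
theorem exists_sub_eq_X_pow_mul {γ γ' : K⟦X⟧} (h : γ ≠ γ') :
    ∃ u, constantCoeff u ≠ 0 ∧ γ - γ' = X ^ (γ - γ').order.toNat * u := by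
  refine ⟨(γ - γ').divXPowOrder, ?_, X_pow_order_mul_divXPowOrder.symm⟩
  rw [constantCoeff_divXPowOrder]
  exact coeff_order (sub_ne_zero.mpr h)

end Contact

/-! ### Each point of the normalisation lies on one branch. -/

section Points

open PowerSeries

variable {k K N L : Type*} [Field k] [Field K] [Algebra k K] [CommRing N] [Algebra k N] [CommRing L]
  [Algebra (K ⊗[k] N) L] [Algebra K L] [IsScalarTower K (K ⊗[k] N) L] [IsLocalRing L]
  {χ : N →ₐ[k] K} {I : Ideal (K ⊗[k] N)} [I.IsPrime] [IsLocalization.AtPrime L I]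

/-- If the constant term `r` were nonzero, `z - r` would be a unit whose image has constant term
`0`. -/
theorem constantCoeff_eq_zero_of_mem_maximalIdeal (Φ : L →ₐ[K] K⟦X⟧) {z : L}
    (hz : z ∈ IsLocalRing.maximalIdeal L) : constantCoeff (Φ z) = 0 := by
  by_contra h
  have h1 : IsUnit (z - algebraMap K L (constantCoeff (Φ z))) := by
    by_contra h1
    have h2 : _ ∈ IsLocalRing.maximalIdeal L := h1
    have h3 := sub_mem hz h2
    rw [sub_sub_cancel] at h3
    exact algebraMap_notMem_maximalIdeal h h3
  have h2 := ((h1.map Φ).map (constantCoeff (R := K))).ne_zero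
  rw [map_sub, AlgHom.commutes, map_sub] at h2
  exact h2 (sub_self (constantCoeff (Φ z)))

/-- Every point over an ordinary point lies on exactly one of the branches, and the
elements of its local ring are power series along that branch. -/
theorem exists_branch {s v w : Fin 3 → K} {i : Fin 3} (hi : s i ≠ 0)
    (hfr : IsFrame i (fun j => s j / s i) v w) {m : ℕ} {F : MvPolynomial (Fin 3) k}
    (B : Branches (MvPolynomial.map (algebraMap k K) F) (fun j => s j / s i) v w m)
    {ι : PlaneLocalRing k s →+* N} (hιk : ∀ r : k, ι (algebraMap k _ r) = algebraMap k N r)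
    (hχ : ∀ a, χ (ι a) = evalAt k s a)
    (hF : ι (dehomogenize k hi F) = 0) {Ψ : Fin m → N →ₐ[k] K⟦X⟧}
    (hΨ : ∀ a G, Ψ a (ι (dehomogenize k hi G)) =
      MvPolynomial.aeval (arc (fun j => s j / s i) v w (B.series a)) G)
    (hfrac : ∀ n, ∃ a b, (∀ j, Ψ j (ι b) ≠ 0) ∧ ι b * n = ι a)
    {χ' : K ⊗[k] N →ₐ[K] K} (hχ' : ∀ n, χ' (1 ⊗ₜ n) = χ n) (hI : ∀ α, α ∈ I ↔ χ' α = 0)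
    (hprin : ∀ x ∈ IsLocalRing.maximalIdeal L, ∀ y ∈ IsLocalRing.maximalIdeal L,
      (∀ j, algebraMap (K ⊗[k] N) L (1 ⊗ₜ ι (planeCoord hi j)) = algebraMap K L (s j / s i) +
        (x * algebraMap K L (v j) + y * algebraMap K L (w j))) →
      IsLeftRegular x ∧ ∃ ℓ, y = x * ℓ) :
    ∃ a, (∀ b, (∀ n, χ n = constantCoeff (Ψ b n)) → b = a) ∧ (∀ n, χ n = constantCoeff (Ψ a n)) ∧
      ∃ (Φ : L →ₐ[K] K⟦X⟧) (x : L), Φ x = X ∧ (∀ z, HasExpansion x z (Φ z)) ∧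
        ∀ n, Φ (algebraMap (K ⊗[k] N) L (1 ⊗ₜ n)) = Ψ a n := by
  let ψ : N →+* L := (algebraMap (K ⊗[k] N) L).comp
    (Algebra.TensorProduct.includeRight : N →ₐ[k] K ⊗[k] N).toRingHom
  have hψ : ∀ n, ψ n = algebraMap (K ⊗[k] N) L (1 ⊗ₜ n) := fun _ => rfl
  have hΨX : ∀ b j, Ψ b (ι (planeCoord hi j)) = arc (fun j => s j / s i) v w (B.series b) j := by
    intro b j
    have h2 := hΨ b (MvPolynomial.X j)
    rwa [dehomogenize, MvPolynomial.aeval_X, MvPolynomial.aeval_X] at h2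
  clear_value ψ
  have hψk : ∀ r : k, ψ (algebraMap k N r) = algebraMap K L (algebraMap k K r) := by
    intro r
    rw [IsScalarTower.algebraMap_apply K (K ⊗[k] N) L, hψ]
    congr 1
    exact ((Algebra.TensorProduct.includeRight : N →ₐ[k] K ⊗[k] N).commutes r).trans
      (IsScalarTower.algebraMap_apply k K _ r)
  have hψχ : ∀ n, ψ n - algebraMap K L (χ n) ∈ IsLocalRing.maximalIdeal L := by
    intro n
    rw [← hχ', hψ]
    exact algebraMap_sub_mem_maximalIdeal hI (1 ⊗ₜ n)
  obtain ⟨x, y, hξ, hxy⟩ := hfr.exists_decomposition (L := L)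
    (ξ := fun j => ψ (ι (planeCoord hi j))) (by rw [planeCoord_self, map_one, map_one])
  obtain ⟨hx, hy⟩ := hxy (IsLocalRing.maximalIdeal L) fun j => by
    rw [← evalAt_planeCoord (k := k) hi, ← hχ]
    exact hψχ _
  obtain ⟨hreg, ℓ, rfl⟩ := hprin x hx y hy (fun j => (hψ _).symm.trans (hξ j))
  have hdeh : ∀ G, ψ (ι (dehomogenize k hi G)) = _ :=
    map_dehomogenize (θ := ψ.comp ι) hi (fun r => by
      rw [RingHom.comp_apply, hιk, hψk])
  have hξ' : (fun j => (ψ.comp ι) (planeCoord hi j)) = _ := funext hξ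
  have hF0 := hdeh F
  rw [hF, map_zero, hξ'] at hF0
  obtain ⟨a, hslope, hexp⟩ := B.exists_hasExpansion hx hreg (exists_sub_mem_maximalIdeal hI) hF0.symm
  have hΦx : ∀ (b : Fin m) (Φ : L →ₐ[K] K⟦X⟧),
      (∀ n, Φ (algebraMap (K ⊗[k] N) L (1 ⊗ₜ n)) = Ψ b n) → Φ x = X ∧ Φ ℓ = B.series b := by
    intro b Φ hΦ
    obtain ⟨h1, h2⟩ := hfr.eq_of_arc_eq (γ := B.series b) (a := Φ x) (b := Φ (x * ℓ)) (fun j => by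
      have h1 := congrArg Φ (hξ j)
      simp only [map_add, map_mul, AlgHom.commutes] at h1 ⊢
      rw [← h1, hψ, hΦ, hΨX])
    refine ⟨h1, ?_⟩
    rw [map_mul, h1] at h2
    exact mul_left_cancel₀ X_ne_zero h2
  have hexp' := HasExpansion.arc (p := fun j => s j / s i) (v := v) (w := w)
    ((HasExpansion.self x).mul hexp)
  -- Expansions spread from the coordinates to polynomials and then to fractions whose denominator
  -- is nonzero at the point.
  have hplane : ∀ c, HasExpansion x (ψ (ι c)) (Ψ a (ι c)) := by
    have h1 : ∀ G, HasExpansion x (ψ (ι (dehomogenize k hi G))) (Ψ a (ι (dehomogenize k hi G))) := by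
      intro G
      have e := MvPolynomial.aeval_map_algebraMap K
        (arc (fun j => s j / s i) v w (B.series a)) G
      rw [hdeh, hΨ, hξ', ← e]
      exact HasExpansion.aeval hexp' _
    have h2 : ∀ G, constantCoeff (Ψ a (ι (dehomogenize k hi G))) =
        evalAt k s (dehomogenize k hi G) := by
      intro G
      rw [hΨ, evalAt_dehomogenize, constantCoeff_aeval_arc]
    intro c
    obtain ⟨G, H, hH, hGH⟩ := exists_mul_dehomogenize_eq hi c
    refine (h1 H).of_isUnit_mul hx (by rwa [h2]) ?_
    have e : ι (dehomogenize k hi H) * ι c = ι (dehomogenize k hi G) := by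
      rw [← map_mul, mul_comm, hGH]
    rw [← map_mul ψ, ← map_mul (Ψ a), e]
    exact h1 G
  -- An element of `N` is a fraction whose denominator may vanish at the point, but not identically
  -- along the branch.
  have hall : ∀ n, HasExpansion x (ψ n) (Ψ a n) := by
    intro n
    obtain ⟨c, b, hb, hbn⟩ := hfrac n
    exact HasExpansion.of_mul_eq (ψ := ψ) (Ψ := (Ψ a).toRingHom) hx hreg (hplane c) (hplane b) (hb a) hbn
  have hχa : ∀ n, χ n = constantCoeff (Ψ a n) := fun n =>
    eq_of_sub_mem_maximalIdeal (hψχ n) (Ideal.mem_of_dvd _ (hall n).dvd_sub hx)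
  refine ⟨a, fun b hb => ?_, hχa, ?_⟩
  -- A branch `b` centred at the same point also gives a map from `L`. It sends `ℓ` to `series b`,
  -- while `ℓ` has residue `slope a`; so the slopes agree.
  · obtain ⟨Φ, hΦ, -⟩ := exists_extension (L := L) hI (Ψ := Ψ b) (fun n => by rw [hχ', hb])
    have h1 := constantCoeff_eq_zero_of_mem_maximalIdeal Φ hslope
    rw [map_sub, AlgHom.commutes, (hΦx b Φ hΦ).2, map_sub, B.constantCoeff_series] at h1
    exact B.slope_injective (sub_eq_zero.mp h1)
  · obtain ⟨Φ, hΦ, hΦ'⟩ := exists_extension (L := L) hI (Ψ := Ψ a) (fun n => by rw [hχ', hχa])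
    exact ⟨Φ, x, (hΦx a Φ hΦ).1, hΦ' x hx fun n => by rw [← hψ]; exact hall n, hΦ⟩

end Points

end PlaneCurves

namespace PlaneCurves

open MvPolynomial

/-! ### From homogeneous coordinates to the chart, and multiplicities. -/

section Rescaling

variable {K : Type*} [Field K]

theorem coeff_aeval_C_mul_X (G : MvPolynomial (Fin 3) K) (r : K) (α : Fin 3 →₀ ℕ) :
    coeff α (aeval (fun j => C r * X j : Fin 3 → MvPolynomial (Fin 3) K) G) =
      r ^ α.degree * coeff α G := by
  induction G using MvPolynomial.induction_on generalizing α with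
  | C t =>
    rw [aeval_C, algebraMap_eq, coeff_C]
    split_ifs with h
    · subst h
      simp
    · simp
  | add a b ha hb => rw [map_add, coeff_add, coeff_add, ha, hb, mul_add]
  | mul_X a j ha =>
    rw [map_mul, aeval_X, ← mul_assoc, coeff_mul_X', coeff_mul_X']
    split_ifs with h
    · have hd : α.degree = (α - Finsupp.single j 1).degree + 1 := by
        have h1 : α - Finsupp.single j 1 + Finsupp.single j 1 = α :=
          tsub_add_cancel_of_le (by
            rw [Finsupp.single_le_iff]
            exact Nat.one_le_iff_ne_zero.mpr (Finsupp.mem_support_iff.mp h))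
        conv_lhs => rw [← h1]
        simp
      rw [mul_comm _ (C r), coeff_C_mul, ha, hd]
      ring
    · simp

/-- Homogeneity gives `F(s / s i + X) = F(s + s i X) / s i ^ d`. Hence multiplicity and tangent
lines may be computed at the normalised point of the chart. -/
theorem homogeneousComponent_taylorAt_div {F : MvPolynomial (Fin 3) K} {d : ℕ}
    (hF : F.IsHomogeneous d) {s : Fin 3 → K} {i : Fin 3} (hi : s i ≠ 0) (n : ℕ) :
    homogeneousComponent n (taylorAt F fun j => s j / s i) =
      C (s i ^ n / s i ^ d) * homogeneousComponent n (taylorAt F s) := by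
  have h1 : C (s i ^ d) * taylorAt F (fun j => s j / s i) =
      aeval (fun j => C (s i) * X j : Fin 3 → MvPolynomial (Fin 3) K) (taylorAt F s) := by
    rw [aeval_taylorAt, taylorAt, C_pow, ← aeval_mul_of_isHomogeneous hF]
    congr 2
    funext j
    rw [mul_add, ← C_mul, mul_div_cancel₀ _ hi, algebraMap_eq]
  ext α
  rw [coeff_C_mul, coeff_homogeneousComponent, coeff_homogeneousComponent]
  split_ifs with h
  · have h2 := congrArg (coeff α) h1
    rw [coeff_C_mul, coeff_aeval_C_mul_X, h] at h2
    rw [div_mul_eq_mul_div, eq_div_iff (pow_ne_zero d hi), ← h2]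
    ring
  · simp

theorem sum_mul_eval_pderiv {F : MvPolynomial (Fin 3) K} {d : ℕ} (hF : F.IsHomogeneous d)
    {s : Fin 3 → K} (h0 : eval s F = 0) : ∑ j, eval s (pderiv j F) * s j = 0 := by
  have h := congrArg (eval s) hF.sum_X_mul_pderiv
  simp only [map_sum, map_mul, eval_X, map_nsmul, h0, smul_zero] at h
  rw [← h]
  exact Finset.sum_congr rfl fun j _ => mul_comm _ _

theorem multiplicityAt_eq_one {F : MvPolynomial (Fin 3) K} {s : Fin 3 → K} (h0 : eval s F = 0)
    (hs : ∃ j, eval s (pderiv j F) ≠ 0) : multiplicityAt F s = 1 := by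
  have h1 : homogeneousComponent 1 (taylorAt F s) ≠ 0 := by
    obtain ⟨j, hj⟩ := hs
    intro h
    apply hj
    rw [← coeff_single_taylorAt]
    have := congrArg (coeff (Finsupp.single j 1)) h
    rwa [coeff_homogeneousComponent, if_pos (by simp), coeff_zero] at this
  refine le_antisymm (Nat.sInf_le h1) (Nat.one_le_iff_ne_zero.mpr fun h => ?_)
  have h2 : multiplicityAt F s ∈ {n | homogeneousComponent n (taylorAt F s) ≠ 0} :=
    Nat.sInf_mem ⟨1, h1⟩
  rw [h] at h2
  apply h2
  rw [homogeneousComponent_zero_taylorAt, h0, C_0]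

theorem exists_pderiv_ne_zero_of_multiplicityAt_eq_one {F : MvPolynomial (Fin 3) K} {s : Fin 3 → K}
    (h1 : multiplicityAt F s = 1) : ∃ j, eval s (pderiv j F) ≠ 0 := by
  by_contra! h
  have h2 : multiplicityAt F s ∈ {n | homogeneousComponent n (taylorAt F s) ≠ 0} := by
    -- As `sInf ∅ = 0`, the value `1` shows that the set is not empty.
    refine Nat.sInf_mem ?_
    by_contra hne
    rw [Set.not_nonempty_iff_eq_empty] at hne
    rw [multiplicityAt, hne, Nat.sInf_empty] at h1
    exact zero_ne_one h1
  rw [h1] at h2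
  apply h2
  rw [homogeneousComponent_one_taylorAt]
  exact Finset.sum_eq_zero fun j _ => by rw [h j, C_0, zero_mul]

theorem multiplicityAt_ne_zero {F : MvPolynomial (Fin 3) K} (hF : F ≠ 0) {s : Fin 3 → K}
    (h0 : eval s F = 0) : multiplicityAt F s ≠ 0 := by
  intro h
  have h2 : multiplicityAt F s ∈ {n | homogeneousComponent n (taylorAt F s) ≠ 0} := by
    refine Nat.sInf_mem ?_
    by_contra hne
    rw [Set.not_nonempty_iff_eq_empty, Set.eq_empty_iff_forall_notMem] at hne
    apply taylorAt_ne_zero hF s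
    rw [← sum_homogeneousComponent (taylorAt F s)]
    exact Finset.sum_eq_zero fun n _ => not_not.mp (hne n)
  rw [h] at h2
  apply h2
  rw [homogeneousComponent_zero_taylorAt, h0, C_0]

theorem isOrdinaryAt_of_smooth {F : MvPolynomial (Fin 3) K} {d : ℕ} (hF : F.IsHomogeneous d)
    {s : Fin 3 → K} (h0 : eval s F = 0) (hs : ∃ j, eval s (pderiv j F) ≠ 0) : IsOrdinaryAt F s := by
  unfold IsOrdinaryAt
  rw [multiplicityAt_eq_one h0 hs]
  refine ⟨fun _ j => eval s (pderiv j F), fun _ => sum_mul_eval_pderiv hF h0,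
    fun a b hab => absurd (Subsingleton.elim a b) hab, ?_⟩
  rw [homogeneousComponent_one_taylorAt]
  simp

/-- A frame at an ordinary point of `F`, generic with respect to the tangent lines
of `F` and of a smooth curve `F'`. -/
structure IsAdapted (F F' : MvPolynomial (Fin 3) K) (i : Fin 3) (p v w : Fin 3 → K) (m : ℕ) (c : K)
    (l : Fin m → Fin 3 → K) : Prop extends IsFrame i p v w where
  ne_zero : m ≠ 0
  low : ∀ n < m, homogeneousComponent n (taylorAt F p) = 0
  const_ne_zero : c ≠ 0
  lead : homogeneousComponent m (taylorAt F p) = C c * ∏ a, ∑ j, C (l a j) * X j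
  transversal : ∀ a, ∑ j, l a j * w j ≠ 0
  det_ne : ∀ a b, a ≠ b →
    (∑ j, l a j * v j) * (∑ j, l b j * w j) ≠ (∑ j, l b j * v j) * (∑ j, l a j * w j)
  eval_eq_zero : eval p F' = 0
  transversal' : ∑ j, eval p (pderiv j F') * w j ≠ 0

/-- A generic frame is chosen for the tangent forms of `F` together with the gradient of `F'`, the
latter being the value at `none`. -/
theorem exists_isAdapted [Infinite K] {F F' : MvPolynomial (Fin 3) K} {d d' : ℕ}
    (hF : F.IsHomogeneous d) (hF' : F'.IsHomogeneous d') (hne : F ≠ 0) {s : Fin 3 → K} {i : Fin 3}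
    (hi : s i ≠ 0) (h0 : eval s F = 0) (h0' : eval s F' = 0) (hord : IsOrdinaryAt F s)
    (hs' : ∃ j, eval s (pderiv j F') ≠ 0) :
    ∃ v w c, ∃ l : Fin (multiplicityAt F s) → Fin 3 → K,
      IsAdapted F F' i (fun j => s j / s i) v w (multiplicityAt F s) c l := by
  have hm := multiplicityAt_ne_zero hne h0
  set m := multiplicityAt F s with hm_def
  obtain ⟨l, hls, hind, hlead⟩ : ∃ l : Fin m → Fin 3 → K, (∀ i, ∑ j, l i j * s j = 0) ∧
    (∀ i i', i ≠ i' → LinearIndependent K ![l i, l i']) ∧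
    homogeneousComponent m (taylorAt F s) = ∏ i, ∑ j, C (l i j) * X j := hord
  have hlow : ∀ n < m, homogeneousComponent n (taylorAt F s) = 0 := fun n hn =>
    not_not.mp (Nat.notMem_of_lt_sInf hn)
  have hlead0 : homogeneousComponent m (taylorAt F s) ≠ 0 := by
    refine Nat.sInf_mem (s := {n | homogeneousComponent n (taylorAt F s) ≠ 0}) ?_
    by_contra hemp
    rw [Set.not_nonempty_iff_eq_empty] at hemp
    rw [hm_def, multiplicityAt, hemp, Nat.sInf_empty] at hm
    exact hm rfl
  have hl0 : ∀ a, l a ≠ 0 := by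
    intro a ha
    apply hlead0
    rw [hlead]
    refine Finset.prod_eq_zero (Finset.mem_univ a) ?_
    rw [ha]
    simp
  have hdiv : ∀ l : Fin 3 → K, ∑ j, l j * s j = 0 → ∑ j, l j * (s j / s i) = 0 := by
    intro l hl
    simp only [mul_div_assoc']
    rw [← Finset.sum_div, hl, zero_div]
  let g : Fin 3 → K := fun j => eval s (pderiv j F')
  have hg0 : g ≠ 0 := by
    obtain ⟨j, hj⟩ := hs'
    exact fun h => hj (congrFun h j)
  obtain ⟨v, w, hfr, hw⟩ := exists_isFrame i (p := fun j => s j / s i) (div_self hi)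
    (l := fun o : Option (Fin m) => o.elim g l) (by rintro (_ | a); exacts [hg0, hl0 a])
    (by rintro (_ | a); exacts [hdiv _ (sum_mul_eval_pderiv hF' h0'), hdiv _ (hls a)])
  have hwl : ∀ a, ∑ j, l a j * w j ≠ 0 := fun a => hw (some a)
  have hcomp := homogeneousComponent_taylorAt_div hF hi
  have hcomp' := homogeneousComponent_taylorAt_div hF' hi
  refine ⟨v, w, s i ^ m / s i ^ d, l, hfr, hm, fun n hn => ?_, ?_, ?_, hwl, ?_, ?_, ?_⟩
  · rw [hcomp, hlow n hn, mul_zero]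
  · exact div_ne_zero (pow_ne_zero _ hi) (pow_ne_zero _ hi)
  · rw [hcomp, hlead]
  · intro a b hab h
    -- This combination vanishes at `p` and at `w` by construction, and at `v` by `h`, hence it is
    -- zero, against independence.
    have h1 : (∑ j, l b j * w j) • l a + (-∑ j, l a j * w j) • l b = 0 := by
      refine hfr.eq_zero ?_ ?_ ?_
      all_goals
        simp only [Pi.add_apply, Pi.smul_apply, smul_eq_mul, add_mul, Finset.sum_add_distrib,
          mul_assoc, ← Finset.mul_sum]
      · rw [hdiv _ (hls a), hdiv _ (hls b), mul_zero, mul_zero, add_zero]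
      · linear_combination h
      · ring
    exact hwl b (LinearIndependent.pair_iff.mp (hind a b hab) _ _ h1).1
  · have := hcomp' 0
    rw [homogeneousComponent_zero_taylorAt, homogeneousComponent_zero_taylorAt, h0', C_0, mul_zero,
      C_eq_zero] at this
    exact this
  · have h1 : ∀ j, eval (fun j => s j / s i) (pderiv j F') = s i ^ 1 / s i ^ d' * g j := by
      intro j
      have := congrArg (coeff (Finsupp.single j 1)) (hcomp' 1)
      rw [coeff_C_mul, coeff_homogeneousComponent, coeff_homogeneousComponent, if_pos (by simp),
        coeff_single_taylorAt, coeff_single_taylorAt, if_pos (by simp)] at this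
      exact this
    simp only [h1, mul_assoc, ← Finset.mul_sum]
    exact mul_ne_zero (div_ne_zero (pow_ne_zero _ hi) (pow_ne_zero _ hi)) (hw none)

variable {F F' : MvPolynomial (Fin 3) K} {i : Fin 3} {p v w : Fin 3 → K} {m : ℕ} {c : K}
  {l : Fin m → Fin 3 → K}

theorem IsAdapted.nonempty_branches (h : IsAdapted F F' i p v w m c l) :
    Nonempty (Branches F p v w m) :=
  exists_branches h.low h.const_ne_zero h.lead h.transversal h.det_ne

theorem IsAdapted.nonempty_branches' (h : IsAdapted F F' i p v w m c l) :
    Nonempty (Branches F' p v w 1) := by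
  refine exists_branches (fun n hn => ?_) one_ne_zero (l := fun _ j => eval p (pderiv j F')) ?_
    (fun _ => h.transversal') (fun a b hab => absurd (Subsingleton.elim a b) hab)
  · obtain rfl : n = 0 := by omega
    rw [homogeneousComponent_zero_taylorAt, h.eval_eq_zero, C_0]
  · rw [homogeneousComponent_one_taylorAt]
    simp

end Rescaling

end PlaneCurves

namespace PlaneCurves

open PowerSeries

/-! ### Branches of `C` on the normalisation and their contact with `C'`. -/

section Normalization

variable {k K : Type*} [Field k] [Field K] [Algebra k K] {s v w : Fin 3 → K} {i : Fin 3}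
  {F F' : MvPolynomial (Fin 3) k} {d d' m : ℕ} {c : K} {l : Fin m → Fin 3 → K}

theorem dehomogenize_mem_curveIdeal (hi : s i ≠ 0) (hF : F.IsHomogeneous d) :
    dehomogenize k hi F ∈ curveIdeal F s := by
  rw [curveIdeal_eq_span hi hF]
  exact Ideal.mem_span_singleton_self _

theorem toNormalized_eq_zero {a : PlaneLocalRing k s} (ha : a ∈ curveIdeal F s) :
    toNormalized F s a = 0 := by
  rw [toNormalized, RingHom.comp_apply, Ideal.Quotient.eq_zero_iff_mem.mpr ha, map_zero]

theorem mk_dehomogenize_mem_nonZeroDivisors (hi : s i ≠ 0) (hF' : F'.IsHomogeneous d')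
    (hrel : IsRelPrime F F') : Ideal.Quotient.mk (curveIdeal F s) (dehomogenize k hi F') ∈
      nonZeroDivisors (CurveLocalRing F s) := by
  rw [mem_nonZeroDivisors_iff_right]
  intro z hz
  obtain ⟨z, rfl⟩ := Ideal.Quotient.mk_surjective z
  rw [← map_mul, Ideal.Quotient.eq_zero_iff_mem, mul_comm] at hz
  exact Ideal.Quotient.eq_zero_iff_mem.mpr (mem_curveIdeal_of_mul_mem hi hF' hrel hz)

theorem map_ne_zero_of_mem_nonZeroDivisors [IsAlgClosed K] (hi : s i ≠ 0) (hF : F.IsHomogeneous d)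
    (hF0 : F ≠ 0) (hfr : IsFrame i (fun j => s j / s i) v w) {γ : K⟦X⟧}
    {φ : PlaneLocalRing k s →ₐ[k] K⟦X⟧}
    (hφ : ∀ G, φ (dehomogenize k hi G) = MvPolynomial.aeval (arc (fun j => s j / s i) v w γ) G)
    (hφF : φ (dehomogenize k hi F) = 0) {b : PlaneLocalRing k s}
    (hb : Ideal.Quotient.mk (curveIdeal F s) b ∈ nonZeroDivisors (CurveLocalRing F s)) : φ b ≠ 0 := by
  intro h0
  obtain ⟨e, he, hbe⟩ := exists_mul_mem_curveIdeal hi hF hF0 (hfr.arc_self γ) hφ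
    (hfr.exists_arc_ne_C γ) hφF h0
  apply he
  rw [← Ideal.Quotient.eq_zero_iff_mem] at hbe ⊢
  rw [map_mul] at hbe
  exact (mem_nonZeroDivisors_iff.mp hb).1 _ hbe

theorem exists_normalized_arc [IsAlgClosed K] (hi : s i ≠ 0) (hF : F.IsHomogeneous d)
    (hF0 : F ≠ 0) (hfr : IsFrame i (fun j => s j / s i) v w) {γ : K⟦X⟧}
    (hγ : MvPolynomial.aeval (arc (fun j => s j / s i) v w γ) F = 0) :
    ∃ Ψ : NormalizedLocalRing F s →ₐ[k] K⟦X⟧,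
      (∀ G, Ψ (toNormalized F s (dehomogenize k hi G)) =
        MvPolynomial.aeval (arc (fun j => s j / s i) v w γ) G) ∧
      (∀ a, constantCoeff (Ψ (toNormalized F s a)) = evalAt k s a) ∧
      ∀ b, Ideal.Quotient.mk (curveIdeal F s) b ∈ nonZeroDivisors (CurveLocalRing F s) →
        Ψ (toNormalized F s b) ≠ 0 := by
  obtain ⟨φ, hφ, hφ'⟩ := exists_arc (k := k) hi
    (constantCoeff_arc (fun j => s j / s i) v w γ) (hfr.arc_self γ)
  have hφF : φ (dehomogenize k hi F) = 0 := by rw [hφ, hγ]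
  have hreg : ∀ b, Ideal.Quotient.mk (curveIdeal F s) b ∈ nonZeroDivisors (CurveLocalRing F s) →
      φ b ≠ 0 := fun b hb => map_ne_zero_of_mem_nonZeroDivisors hi hF hF0 hfr hφ hφF hb
  obtain ⟨Ψ, hΨ⟩ := exists_normalized_extension φ (fun a ha => by
    rw [curveIdeal_eq_span hi hF, Ideal.mem_span_singleton] at ha
    obtain ⟨z, rfl⟩ := ha
    rw [map_mul, hφF, zero_mul]) hreg
  refine ⟨Ψ, fun G => by rw [hΨ, hφ], fun a => by rw [hΨ, hφ'], fun b hb => ?_⟩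
  rw [hΨ]
  exact hreg b hb

/-- A common series would make `F'` vanish along a branch of `F`, whereas nonzerodivisors of the
curve ring do not vanish there. -/
theorem series_ne_series [IsAlgClosed K] (hi : s i ≠ 0) (hF : F.IsHomogeneous d)
    (hF' : F'.IsHomogeneous d') (hF0 : F ≠ 0) (hrel : IsRelPrime F F')
    (hfr : IsFrame i (fun j => s j / s i) v w)
    (B : Branches (MvPolynomial.map (algebraMap k K) F) (fun j => s j / s i) v w m)
    (B' : Branches (MvPolynomial.map (algebraMap k K) F') (fun j => s j / s i) v w 1) (a : Fin m) :
    B.series a ≠ B'.series 0 := by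
  intro h
  have h1 := B.aeval_eq_zero_series a
  have h2 := B'.aeval_eq_zero_series 0
  rw [← h] at h2
  change MvPolynomial.aeval (arc (fun j => s j / s i) v w (B.series a)) _ = 0 at h1
  change MvPolynomial.aeval (arc (fun j => s j / s i) v w (B.series a)) _ = 0 at h2
  rw [MvPolynomial.aeval_map_algebraMap] at h1 h2
  obtain ⟨Ψ, hΨ, -, hreg⟩ := exists_normalized_arc hi hF hF0 hfr h1
  refine hreg _ (mk_dehomogenize_mem_nonZeroDivisors hi hF' hrel) ?_
  rw [hΨ, h2]

/-- One factor of the parameter comes from `F'` passing through `p`, the others from the contact of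
the two series. -/
theorem exists_aeval_arc_eq {F F' : MvPolynomial (Fin 3) K} {p : Fin 3 → K} (B : Branches F p v w m)
    (B' : Branches F' p v w 1) {a : Fin m} (hne : B.series a ≠ B'.series 0) :
    ∃ u, constantCoeff u ≠ 0 ∧ MvPolynomial.aeval (arc p v w (B.series a)) F' =
      X ^ (1 + (B.series a - B'.series 0).order.toNat) * u := by
  obtain ⟨u, hu, h1⟩ := B'.exists_eval₂_eq 0 (B.series a) fun b _ => Subsingleton.elim _ _
  obtain ⟨u', hu', h2⟩ := exists_sub_eq_X_pow_mul hne
  refine ⟨u' * u, by rw [map_mul]; exact mul_ne_zero hu' hu, ?_⟩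
  rw [B'.aeval_arc, h1]
  nth_rewrite 1 [h2]
  ring

end Normalization

section Fibre

variable {k K : Type*} [Field k] [Field K] [Algebra k K]

theorem length_quotient_map_span_toNat {R L : Type*} [CommRing R] [CommRing L] [Algebra K L]
    [IsLocalRing L] (f : R →+* L) (a : R) (Φ : L →ₐ[K] K⟦X⟧) {x : L} (hx : Φ x = X)
    (hexp : ∀ z, HasExpansion x z (Φ z)) {n : ℕ} {u : K⟦X⟧} (hu : constantCoeff u ≠ 0)
    (hΦ : Φ (f a) = X ^ n * u) :
    (Module.length L (L ⧸ (Ideal.span {a}).map f)).toNat = n := by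
  have h1 := length_quotient_of_hasExpansion Φ hx hexp hΦ hu
  rw [Ideal.map_span, Set.image_singleton, h1]
  rfl

end Fibre

end PlaneCurves

namespace PlaneCurves

open PowerSeries

universe u₁ u₂

/-! ### Intersection multiplicities at points of the normalisation. -/

section LocalBranch

variable {k K : Type*} [Field k] [Field K] [Algebra k K] [IsAlgClosed K] {s v w : Fin 3 → K} {i : Fin 3}
  {F F' : MvPolynomial (Fin 3) k} {d d' m : ℕ} {c : K} {l : Fin m → Fin 3 → K}

/-- The regularity of `F'` in `L` makes the coordinate `x` a regular generator of the ideal of the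
point, so the expansion along a branch is available and the length is the order of `F'` on that
branch. -/
theorem exists_branch_length (hi : s i ≠ 0) (hF : F.IsHomogeneous d) (hF' : F'.IsHomogeneous d')
    (hF0 : F ≠ 0) (hrel : IsRelPrime F F')
    (hA : IsAdapted (MvPolynomial.map (algebraMap k K) F) (MvPolynomial.map (algebraMap k K) F') i
      (fun j => s j / s i) v w m c l)
    (B : Branches (MvPolynomial.map (algebraMap k K) F) (fun j => s j / s i) v w m)
    (B' : Branches (MvPolynomial.map (algebraMap k K) F') (fun j => s j / s i) v w 1)
    {Ψ : Fin m → NormalizedLocalRing F s →ₐ[k] K⟦X⟧}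
    (hΨ : ∀ a G, Ψ a (toNormalized F s (dehomogenize k hi G)) =
        MvPolynomial.aeval (arc (fun j => s j / s i) v w (B.series a)) G)
    (hreg : ∀ a b, Ideal.Quotient.mk (curveIdeal F s) b ∈ nonZeroDivisors (CurveLocalRing F s) →
        Ψ a (toNormalized F s b) ≠ 0)
    {χ : NormalizedLocalRing F s →ₐ[k] K} (hχ : ∀ a, χ (toNormalized F s a) = evalAt k s a)
    {χ' : K ⊗[k] NormalizedLocalRing F s →ₐ[K] K} (hχ' : ∀ n, χ' (1 ⊗ₜ n) = χ n)
    {I : Ideal (K ⊗[k] NormalizedLocalRing F s)} [I.IsPrime] (hI : ∀ α, α ∈ I ↔ χ' α = 0)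
    (L : Type*) [CommRing L] [Algebra (K ⊗[k] NormalizedLocalRing F s) L] [IsLocalization.AtPrime L I] :
    ∃ a, (∀ b, (∀ n, χ n = constantCoeff (Ψ b n)) → b = a) ∧ (∀ n, χ n = constantCoeff (Ψ a n)) ∧
      (Module.length L (L ⧸ (Ideal.span {dehomogenize k hi F'}).map
        ((algebraMap (K ⊗[k] NormalizedLocalRing F s) L).comp
          ((Algebra.TensorProduct.includeRight : NormalizedLocalRing F s →ₐ[k]
            K ⊗[k] NormalizedLocalRing F s).toRingHom.comp (toNormalized F s))))).toNat =
        1 + (B.series a - B'.series 0).order.toNat := by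
  let : Algebra K L := ((algebraMap (K ⊗[k] NormalizedLocalRing F s) L).comp
    (algebraMap K (K ⊗[k] NormalizedLocalRing F s))).toAlgebra
  have : IsScalarTower K (K ⊗[k] NormalizedLocalRing F s) L :=
    IsScalarTower.of_algebraMap_eq (R := K) (S := K ⊗[k] NormalizedLocalRing F s) (A := L) fun _ => rfl
  have : IsLocalRing L := IsLocalization.AtPrime.isLocalRing L I
  have hιk : ∀ r : k, toNormalized F s (algebraMap k _ r) = algebraMap k (NormalizedLocalRing F s) r :=
    fun _ => rfl
  have hh := mk_dehomogenize_mem_nonZeroDivisors hi hF' hrel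
  have hprin : ∀ x ∈ IsLocalRing.maximalIdeal L, ∀ y ∈ IsLocalRing.maximalIdeal L,
      (∀ j, algebraMap (K ⊗[k] NormalizedLocalRing F s) L (1 ⊗ₜ toNormalized F s (planeCoord hi j)) =
        algebraMap K L (s j / s i) + (x * algebraMap K L (v j) + y * algebraMap K L (w j))) →
      IsLeftRegular x ∧ ∃ ℓ, y = x * ℓ := by
    intro x hx y hy hξ
    let θ : NormalizedLocalRing F s →+* L :=
      (algebraMap (K ⊗[k] NormalizedLocalRing F s) L).comp
        (Algebra.TensorProduct.includeRight : NormalizedLocalRing F s →ₐ[k]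
          K ⊗[k] NormalizedLocalRing F s).toRingHom
    have hθ : ∀ n, θ n = algebraMap (K ⊗[k] NormalizedLocalRing F s) L (1 ⊗ₜ n) := fun _ => rfl
    have hθk : ∀ r : k, θ (toNormalized F s (algebraMap k _ r)) =
        algebraMap K L (algebraMap k K r) := by
      intro r
      rw [hιk, hθ, IsScalarTower.algebraMap_apply K (K ⊗[k] NormalizedLocalRing F s) L]
      congr 1
      exact ((Algebra.TensorProduct.includeRight : NormalizedLocalRing F s →ₐ[k]
        K ⊗[k] NormalizedLocalRing F s).commutes r).trans (IsScalarTower.algebraMap_apply k K _ r)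
    have hregL : IsLeftRegular (θ (toNormalized F s (dehomogenize k hi F'))) := by
      rw [hθ]
      exact isLeftRegular_algebraMap_one_tmul I fun n hn => toNormalized_mul_cancel hh hn
    have hξ₀ : ∀ j, θ (toNormalized F s (planeCoord hi j)) =
        algebraMap K L (s j / s i) + (x * algebraMap K L (v j) + y * algebraMap K L (w j)) :=
      fun j => (hθ _).trans (hξ j)
    obtain ⟨ℓ, rfl⟩ := exists_eq_mul_of_normalized hi hF hA.toIsFrame hA.ne_zero hA.low hA.const_ne_zero
      hA.lead hA.transversal hA.det_ne hA.eval_eq_zero hA.transversal' hh hθk hregL hx hy hξ₀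
    refine ⟨?_, ℓ, rfl⟩
    have hdeh := map_dehomogenize (θ := θ.comp (toNormalized F s)) hi hθk F'
    have hξ' : (fun j => (θ.comp (toNormalized F s)) (planeCoord hi j)) = _ := funext hξ₀
    rw [RingHom.comp_apply, hξ'] at hdeh
    rw [hdeh] at hregL
    exact isLeftRegular_of_first_order hA.eval_eq_zero hregL
  obtain ⟨a, h1, h2, Φ, x, hx, hexp, hΦ⟩ := exists_branch (L := L) hi hA.toIsFrame B
    (ι := toNormalized F s) hιk hχ (toNormalized_eq_zero (dehomogenize_mem_curveIdeal hi hF)) hΨ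
    (fun n => by
      obtain ⟨a, b, hb, h⟩ := exists_toNormalized_mul_eq n
      exact ⟨a, b, fun j => hreg j b hb, h⟩) hχ' hI hprin
  obtain ⟨u, hu, hu'⟩ := exists_aeval_arc_eq B B'
    (series_ne_series hi hF hF' hF0 hrel hA.toIsFrame B B' a)
  refine ⟨a, h1, h2, length_quotient_map_span_toNat _ _ Φ hx hexp hu ?_⟩
  rw [← hu', MvPolynomial.aeval_map_algebraMap, ← hΨ]
  exact hΦ _

end LocalBranch

section Fibre

variable {k : Type u₁} {K : Type u₂} [Field k] [Field K] [Algebra k K]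

/-- Replaces the concrete local ring by any localisation with the same universal property. -/
theorem PlaneCurve.NormalizationPoint.mu_induction {D D' : PlaneCurve k} (T : D.NormalizationPoint K)
    {i : Fin 3} (hi : T.base.rep i ≠ 0) {P : ℕ → Prop}
    (h : ∀ (L : Type (max u₁ u₂)) [CommRing L]
      [Algebra (K ⊗[k] NormalizedLocalRing D.form T.base.rep) L] [IsLocalization.AtPrime L T.ideal],
      P (Module.length L (L ⧸ (Ideal.span {dehomogenize k hi D'.form}).map
        ((algebraMap (K ⊗[k] NormalizedLocalRing D.form T.base.rep) L).comp
          ((Algebra.TensorProduct.includeRight : NormalizedLocalRing D.form T.base.rep →ₐ[k]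
            K ⊗[k] NormalizedLocalRing D.form T.base.rep).toRingHom.comp
              (toNormalized D.form T.base.rep))))).toNat) : P (T.mu D') := by
  rw [PlaneCurve.NormalizationPoint.mu, curveIdeal_eq_span hi D'.isHomogeneous]
  exact h T.LocalRing

theorem PlaneCurve.NormalizationPoint.exists_branch [IsAlgClosed K] {D D' : PlaneCurve k}
    (hrel : IsRelPrime D.form D'.form) (T : D.NormalizationPoint K) {i : Fin 3} (hi : T.base.rep i ≠ 0)
    {v w : Fin 3 → K} {m : ℕ} {c : K} {l : Fin m → Fin 3 → K}
    (hA : IsAdapted (D.formOver K) (D'.formOver K) i (fun j => T.base.rep j / T.base.rep i) v w m c l)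
    (B : Branches (D.formOver K) (fun j => T.base.rep j / T.base.rep i) v w m)
    (B' : Branches (D'.formOver K) (fun j => T.base.rep j / T.base.rep i) v w 1)
    {Ψ : Fin m → NormalizedLocalRing D.form T.base.rep →ₐ[k] K⟦X⟧}
    (hΨ : ∀ a G, Ψ a (toNormalized D.form T.base.rep (dehomogenize k hi G)) =
        MvPolynomial.aeval (arc (fun j => T.base.rep j / T.base.rep i) v w (B.series a)) G)
    (hreg : ∀ a b, Ideal.Quotient.mk (curveIdeal D.form T.base.rep) b ∈
      nonZeroDivisors (CurveLocalRing D.form T.base.rep) → Ψ a (toNormalized D.form T.base.rep b) ≠ 0) :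
    ∃ a, (∀ b, (∀ n, T.hom n = constantCoeff (Ψ b n)) → b = a) ∧
      (∀ n, T.hom n = constantCoeff (Ψ a n)) ∧
      T.mu D' = 1 + (B.series a - B'.series 0).order.toNat := by
  refine T.mu_induction (D' := D') hi (P := fun n => ∃ a,
    (∀ b, (∀ n, T.hom n = constantCoeff (Ψ b n)) → b = a) ∧ (∀ n, T.hom n = constantCoeff (Ψ a n)) ∧
    n = 1 + (B.series a - B'.series 0).order.toNat) ?_
  intro L _ _ _
  exact exists_branch_length hi D.isHomogeneous D'.isHomogeneous D.squarefree.ne_zero hrel hA B B' hΨ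
    hreg T.hom_toNormalized (χ' := T.homOver) (fun n => by
      rw [PlaneCurve.NormalizationPoint.homOver, Algebra.TensorProduct.lift_tmul, map_one, one_mul])
    (I := T.ideal) (fun α => RingHom.mem_ker) L

/-- The points of the normalisation over an ordinary point `S`, with their intersection
multiplicities with a curve that is smooth at `S`. -/
theorem exists_points_of_isAdapted [IsAlgClosed K] {D D' : PlaneCurve k}
    (hrel : IsRelPrime D.form D'.form) (S : ℙ K (Fin 3 → K)) {i : Fin 3} (hi : S.rep i ≠ 0)
    {v w : Fin 3 → K} {m : ℕ} {c : K} {l : Fin m → Fin 3 → K}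
    (hA : IsAdapted (D.formOver K) (D'.formOver K) i (fun j => S.rep j / S.rep i) v w m c l)
    (B : Branches (D.formOver K) (fun j => S.rep j / S.rep i) v w m)
    (B' : Branches (D'.formOver K) (fun j => S.rep j / S.rep i) v w 1) :
    ∃ T : Fin m → D.NormalizationPoint K, Function.Injective T ∧ (∀ T', T'.base = S ↔ ∃ a, T a = T') ∧
      ∀ a, (T a).mu D' = 1 + (B.series a - B'.series 0).order.toNat := by
  have hF0 : D.form ≠ 0 := D.squarefree.ne_zero
  have hex := fun a => exists_normalized_arc (k := k) hi D.isHomogeneous hF0 hA.toIsFrame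
    (γ := B.series a) (by
      rw [← MvPolynomial.aeval_map_algebraMap K]
      exact B.aeval_eq_zero_series a)
  choose Ψ hΨ hΨ' hreg using hex
  have key : ∀ (χ : NormalizedLocalRing D.form S.rep →ₐ[k] K)
      (hχ : ∀ a, χ (toNormalized D.form S.rep a) = evalAt k S.rep a),
      ∃ a, (∀ b, (∀ n, χ n = constantCoeff (Ψ b n)) → b = a) ∧ (∀ n, χ n = constantCoeff (Ψ a n)) ∧
      (⟨S, χ, hχ⟩ : D.NormalizationPoint K).mu D' = 1 + (B.series a - B'.series 0).order.toNat := by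
    intro χ hχ
    exact (⟨S, χ, hχ⟩ : D.NormalizationPoint K).exists_branch hrel hi hA B B' hΨ hreg
  -- The centre of a branch: the constant term of the lifted arc.
  let χ : Fin m → NormalizedLocalRing D.form S.rep →ₐ[k] K := fun a =>
    { (constantCoeff (R := K)).comp (Ψ a).toRingHom with
      commutes' := fun r => by
        change constantCoeff (Ψ a (algebraMap k _ r)) = _
        rw [AlgHom.commutes]
        change constantCoeff (PowerSeries.C (algebraMap k K r)) = _
        simp }
  have hχ : ∀ a n, χ a n = constantCoeff (Ψ a n) := fun _ _ => rfl
  refine ⟨fun a => ⟨S, χ a, hΨ' a⟩, ?_, ?_, ?_⟩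
  · intro a b hab
    obtain ⟨e, he, -⟩ := key (χ a) (hΨ' a)
    have hab' : χ a = χ b := by
      simpa using hab
    rw [he a (hχ a), he b fun n => by rw [hab', hχ]]
  · intro T'
    constructor
    · rintro rfl
      obtain ⟨a, -, ha, -⟩ := key T'.hom T'.hom_toNormalized
      refine ⟨a, ?_⟩
      have : χ a = T'.hom := AlgHom.ext fun n => by rw [hχ, ha]
      cases T'
      simp only [this]
    · rintro ⟨a, rfl⟩
      rfl
  · intro a
    obtain ⟨e, he, -, hmu⟩ := key (χ a) (hΨ' a)
    rw [← he a (hχ a)] at hmu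
    exact hmu

end Fibre

end PlaneCurves

namespace PlaneCurves

open PowerSeries

/-! ### Intersection multiplicity in the plane, computed on `C'`. -/

section LocalRing

variable {k K : Type*} [Field k] [Field K] [Algebra k K]

instance (s : Fin 3 → K) : IsLocalRing (PlaneLocalRing k s) := by
  refine IsLocalRing.of_nonunits_add fun a b ha hb hab => ?_
  have h : ∀ a : PlaneLocalRing k s, a ∈ nonunits _ → evalAt k s a = 0 := fun a ha =>
    not_not.mp fun h => ha (isUnit_of_evalAt_ne_zero h)
  apply evalAt_ne_zero_of_isUnit hab
  rw [map_add, h a ha, h b hb, add_zero]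

/-- Both sides are the length of `R ⧸ (I ⊔ J)`. The symmetry allows `μ_S` to be computed on the
smooth curve. -/
theorem length_quotient_map_comm {R : Type*} [CommRing R] (I J : Ideal R) :
    Module.length (R ⧸ I) ((R ⧸ I) ⧸ J.map (Ideal.Quotient.mk I)) =
      Module.length (R ⧸ J) ((R ⧸ J) ⧸ I.map (Ideal.Quotient.mk J)) := by
  have key : ∀ I J : Ideal R, Module.length R (R ⧸ (J ⊔ I)) =
      Module.length (R ⧸ I) ((R ⧸ I) ⧸ J.map (Ideal.Quotient.mk I)) := by
    intro I J
    refine length_quotient_eq (Ideal.Quotient.mk I)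
      (Ideal.Quotient.mk_surjective.comp Ideal.Quotient.mk_surjective) ?_
    rw [Ideal.comap_map_of_surjective _ Ideal.Quotient.mk_surjective, ← RingHom.ker_eq_comap_bot,
      Ideal.mk_ker]
  rw [← key, sup_comm, key]

end LocalRing

section Smooth

variable {K : Type*} [Field K] {F F' : MvPolynomial (Fin 3) K} {s p v w : Fin 3 → K} {i : Fin 3}
  {d d' m : ℕ} {c : K} {l : Fin m → Fin 3 → K}

/-- The polynomial `F(p + t v + Y w)`, in `Y` over `K[t]`. -/
noncomputable def framePoly (F : MvPolynomial (Fin 3) K) (p v w : Fin 3 → K) :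
    Polynomial (Polynomial K) :=
  MvPolynomial.aeval (fun j => algebraMap K (Polynomial (Polynomial K)) (p j) +
    (Polynomial.C Polynomial.X * algebraMap K (Polynomial (Polynomial K)) (v j) +
      Polynomial.X * algebraMap K (Polynomial (Polynomial K)) (w j))) F

theorem eval₂_framePoly (F : MvPolynomial (Fin 3) K) (p v w : Fin 3 → K) {L : Type*} [CommRing L]
    [Algebra K L] (x y : L) :
    (framePoly F p v w).eval₂ (Polynomial.aeval x : Polynomial K →ₐ[K] L).toRingHom y =
      MvPolynomial.aeval (fun j => algebraMap K L (p j) +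
        (x * algebraMap K L (v j) + y * algebraMap K L (w j))) F := by
  let ψ : Polynomial (Polynomial K) →ₐ[K] L :=
    { Polynomial.eval₂RingHom (Polynomial.aeval x : Polynomial K →ₐ[K] L).toRingHom y with
      commutes' := fun r => by
        change Polynomial.eval₂ _ _ (Polynomial.C (Polynomial.C r)) = _
        rw [Polynomial.eval₂_C]
        exact Polynomial.aeval_C x r }
  have hC : ∀ q, ψ (Polynomial.C q) = Polynomial.aeval x q := fun q => Polynomial.eval₂_C _ _
  have hX : ψ Polynomial.X = y := Polynomial.eval₂_X _ _
  change ψ _ = _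
  rw [framePoly, ← AlgHom.comp_apply, MvPolynomial.comp_aeval]
  congr 2
  funext j
  simp only [map_add, map_mul, hC, hX, Polynomial.aeval_X, AlgHom.commutes]

theorem derivative_framePoly (h0 : MvPolynomial.eval p F' = 0) :
    (framePoly F' p v w).derivative.eval₂ Polynomial.constantCoeff 0 =
      ∑ j, MvPolynomial.eval p (MvPolynomial.pderiv j F') * w j := by
  have h1 : (framePoly F' p v w).map Polynomial.constantCoeff =
      (framePoly F' p v w).eval₂ (Polynomial.aeval (0 : Polynomial K) :
        Polynomial K →ₐ[K] Polynomial K).toRingHom Polynomial.X := by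
    rw [Polynomial.map]
    congr 1
    refine Polynomial.ringHom_ext (fun r => ?_) ?_
    · change Polynomial.C (Polynomial.constantCoeff (Polynomial.C r)) = Polynomial.aeval _ (Polynomial.C r)
      rw [Polynomial.aeval_C]
      simp
    · change Polynomial.C (Polynomial.constantCoeff Polynomial.X) = Polynomial.aeval _ Polynomial.X
      simp
  obtain ⟨A, B, -, hB, e⟩ := exists_aeval_eq_first_order (v := v) (w := w) h0
    (I := Ideal.span {(Polynomial.X : Polynomial K)}) (x := 0) (y := Polynomial.X)
    (zero_mem _) (Ideal.mem_span_singleton_self _)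
  rw [← Polynomial.eval_map, ← Polynomial.derivative_map, h1, eval₂_framePoly, e]
  obtain ⟨z, hz⟩ := Ideal.mem_span_singleton.mp hB
  rw [sub_eq_iff_eq_add] at hz
  rw [hz]
  simp [Polynomial.eval_finsetSum]

/-- On a smooth curve `y` is a simple root of `F'(p + x v + Y w)`, so it expands in `x` directly,
with no division by `x` beforehand. -/
theorem hasExpansion_of_smooth {L : Type*} [CommRing L] [Algebra K L] [IsLocalRing L] {x y : L}
    (hx : x ∈ IsLocalRing.maximalIdeal L) (hy : y ∈ IsLocalRing.maximalIdeal L)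
    (h0 : MvPolynomial.eval p F' = 0)
    (hw : ∑ j, MvPolynomial.eval p (MvPolynomial.pderiv j F') * w j ≠ 0)
    (hF : MvPolynomial.aeval (fun j => algebraMap K L (p j) +
      (x * algebraMap K L (v j) + y * algebraMap K L (w j))) F' = 0) {γ : K⟦X⟧}
    (hγ : MvPolynomial.aeval (arc p v w γ) F' = 0) : HasExpansion x y (X * γ) := by
  have hcc : constantCoeff (X * γ) = 0 := by simp
  refine HasExpansion.of_root hx (Φ := framePoly F' p v w) ?_ ?_ ?_ ?_
  · rw [eval₂_framePoly, hF]
  · rw [← toRingHom_aeval_X, eval₂_framePoly]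
    exact hγ
  · rw [hcc, map_zero, sub_zero]
    exact hy
  · rw [hcc, derivative_framePoly h0]
    exact hw

/-- Positive contact forces equal constant terms. The slopes of `B` being distinct, at most one
branch has positive contact with `B'`. -/
theorem slope_eq_of_order_ne_zero {p : Fin 3 → K} (B : Branches F p v w m) (B' : Branches F' p v w 1)
    {a : Fin m} (h : (B.series a - B'.series 0).order.toNat ≠ 0) : B.slope a = B'.slope 0 := by
  have h1 : coeff 0 (B.series a - B'.series 0) = 0 := by
    apply coeff_of_lt_order
    rw [Nat.cast_zero, pos_iff_ne_zero]
    exact fun h0 => h (by rw [h0]; rfl)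
  rw [coeff_zero_eq_constantCoeff_apply, map_sub, B.constantCoeff_series, B'.constantCoeff_series,
    sub_eq_zero] at h1
  exact h1

/-- Along the branch of `F'` the form `F` is `X ^ m` times the value of `B.poly`. The order of this
value is the contact with the one branch that has the slope of `B'`, and `0` if there is none; in
both cases it is the whole sum. -/
theorem exists_aeval_arc_series_eq {p : Fin 3 → K} (B : Branches F p v w m) (B' : Branches F' p v w 1)
    (hne : ∀ a, B.series a ≠ B'.series 0) :
    ∃ u, constantCoeff u ≠ 0 ∧ MvPolynomial.aeval (arc p v w (B'.series 0)) F =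
      X ^ (m + ∑ a, (B.series a - B'.series 0).order.toNat) * u := by
  by_cases hex : ∃ a, B.slope a = B'.slope 0
  · obtain ⟨a, ha⟩ := hex
    obtain ⟨u, hu, h1⟩ := B.exists_eval₂_eq a (B'.series 0) fun b hb => by
      rw [B'.constantCoeff_series] at hb
      exact B.slope_injective (hb.symm.trans ha.symm)
    obtain ⟨u', hu', h2⟩ := exists_sub_eq_X_pow_mul (hne a)
    refine ⟨-u' * u, by rw [map_mul, map_neg]; exact mul_ne_zero (neg_ne_zero.mpr hu') hu, ?_⟩
    rw [B.aeval_arc, h1, Finset.sum_eq_single a]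
    · rw [← neg_sub, h2, ← h2, pow_add]
      nth_rewrite 1 [h2]
      ring
    · intro b _ hb
      by_contra h
      exact hb (B.slope_injective ((slope_eq_of_order_ne_zero B B' h).trans ha.symm))
    · simp
  · refine ⟨B.poly.eval₂ Polynomial.coeToPowerSeries.ringHom (B'.series 0), fun h => hex ?_, ?_⟩
    · rw [constantCoeff_eval₂_coeToPowerSeries, B'.constantCoeff_series] at h
      obtain ⟨a, ha⟩ := B.exists_eq_slope _ h
      exact ⟨a, ha.symm⟩
    · rw [B.aeval_arc, Finset.sum_eq_zero, add_zero]
      intro a _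
      by_contra h
      exact hex ⟨a, slope_eq_of_order_ne_zero B B' h⟩

/-- With the roles exchanged, every element of the local ring of the smooth curve `F' = 0` expands
in `x`, and the length is the order of `F` along its branch. -/
theorem intersectionMultiplicity_eq (hi : s i ≠ 0) (hF : F.IsHomogeneous d) (hF' : F'.IsHomogeneous d')
    (hA : IsAdapted F F' i (fun j => s j / s i) v w m c l)
    (B : Branches F (fun j => s j / s i) v w m) (B' : Branches F' (fun j => s j / s i) v w 1)
    (hne : ∀ a, B.series a ≠ B'.series 0) :
    intersectionMultiplicity F F' s = m + ∑ a, (B.series a - B'.series 0).order.toNat := by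
  rw [intersectionMultiplicity, length_quotient_map_comm, curveIdeal_eq_span hi hF]
  have hF'0 : evalAt K s (dehomogenize K hi F') = 0 := by
    rw [evalAt_dehomogenize]
    exact hA.eval_eq_zero
  have hcurve : ∀ (f : PlaneLocalRing K s →+* K⟦X⟧), f (dehomogenize K hi F') = 0 →
      ∀ a ∈ curveIdeal F' s, f a = 0 := by
    intro f hf a ha
    rw [curveIdeal_eq_span hi hF', Ideal.mem_span_singleton] at ha
    obtain ⟨z, rfl⟩ := ha
    rw [map_mul, hf, zero_mul]
  let ev : CurveLocalRing F' s →ₐ[K] K := Ideal.Quotient.liftₐ (curveIdeal F' s) (evalAt K s) (by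
    intro a ha
    rw [curveIdeal_eq_span hi hF', Ideal.mem_span_singleton] at ha
    obtain ⟨z, rfl⟩ := ha
    rw [map_mul, hF'0, zero_mul])
  have hev : ∀ a, ev (Ideal.Quotient.mk _ a) = evalAt K s a := fun _ => rfl
  have : Nontrivial (CurveLocalRing F' s) := ev.toRingHom.domain_nontrivial
  have : IsLocalRing (CurveLocalRing F' s) :=
    IsLocalRing.of_surjective' (Ideal.Quotient.mk _) Ideal.Quotient.mk_surjective
  have hmem : ∀ z, ev z = 0 → z ∈ IsLocalRing.maximalIdeal (CurveLocalRing F' s) := by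
    intro z hz hu
    exact (hu.map ev).ne_zero hz
  obtain ⟨φ, hφ, hφ'⟩ := exists_arc (k := K) hi
    (constantCoeff_arc (fun j => s j / s i) v w (B'.series 0)) (hA.arc_self (B'.series 0))
  have hφF' : φ (dehomogenize K hi F') = 0 := by
    rw [hφ]
    exact B'.aeval_eq_zero_series 0
  let Φ : CurveLocalRing F' s →ₐ[K] K⟦X⟧ :=
    Ideal.Quotient.liftₐ (curveIdeal F' s) φ (hcurve φ.toRingHom hφF')
  have hΦ : ∀ a, Φ (Ideal.Quotient.mk _ a) = φ a := fun _ => rfl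
  have hmk : ∀ r, Ideal.Quotient.mk (curveIdeal F' s) (algebraMap K _ r) =
      algebraMap K (CurveLocalRing F' s) r := fun _ => rfl
  obtain ⟨x, y, hξ, hxy⟩ := hA.exists_decomposition (L := CurveLocalRing F' s)
    (ξ := fun j => Ideal.Quotient.mk _ (planeCoord hi j)) (by rw [planeCoord_self, map_one])
  obtain ⟨hx, hy⟩ := hxy (IsLocalRing.maximalIdeal _) fun j => hmem _ (by
    rw [map_sub, hev, evalAt_planeCoord, AlgHom.commutes]
    exact sub_self _)
  have hdeh : ∀ G, Ideal.Quotient.mk (curveIdeal F' s) (dehomogenize K hi G) =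
      MvPolynomial.aeval (fun j => algebraMap K (CurveLocalRing F' s) (s j / s i) +
        (x * algebraMap K _ (v j) + y * algebraMap K _ (w j))) G := by
    intro G
    have h := map_dehomogenize (θ := Ideal.Quotient.mk (curveIdeal F' s)) hi hmk G
    rw [MvPolynomial.aeval_map_algebraMap] at h
    rw [h]
    congr 2
    exact funext hξ
  obtain ⟨hΦx, -⟩ := hA.eq_of_arc_eq (γ := B'.series 0) (a := Φ x) (b := Φ y) (fun j => by
    have h1 := congrArg Φ (hξ j)
    simp only [map_add, map_mul, AlgHom.commutes] at h1
    rw [← h1, hΦ]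
    have h2 := hφ (MvPolynomial.X j)
    rw [dehomogenize, MvPolynomial.aeval_X, MvPolynomial.aeval_X] at h2
    exact h2.symm)
  have hy' : HasExpansion x y (X * B'.series 0) := by
    refine hasExpansion_of_smooth hx hy hA.eval_eq_zero hA.transversal' ?_ (B'.aeval_eq_zero_series 0)
    rw [← hdeh, Ideal.Quotient.eq_zero_iff_mem, curveIdeal_eq_span hi hF']
    exact Ideal.mem_span_singleton_self _
  have h1 : ∀ G, HasExpansion x (Ideal.Quotient.mk (curveIdeal F' s) (dehomogenize K hi G))
      (φ (dehomogenize K hi G)) := by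
    intro G
    rw [hdeh, hφ]
    exact HasExpansion.aeval hy'.arc G
  have hexp : ∀ z, HasExpansion x z (Φ z) := by
    intro z
    obtain ⟨z, rfl⟩ := Ideal.Quotient.mk_surjective z
    obtain ⟨G, H, hH, hGH⟩ := exists_mul_dehomogenize_eq hi z
    refine (h1 H).of_isUnit_mul hx (by rwa [hφ']) ?_
    rw [hΦ, ← map_mul, ← map_mul, mul_comm, hGH]
    exact h1 G
  obtain ⟨u, hu, hu'⟩ := exists_aeval_arc_series_eq B B' hne
  refine length_quotient_map_span_toNat _ _ Φ hΦx hexp hu ?_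
  rw [hΦ, hφ, hu']

end Smooth

end PlaneCurves

namespace PlaneCurves

/-! ### Parity and counting. -/

section Counting

/-- At most one `e a` is nonzero and it then equals the sum, so the parity of the sum decides
whether one index drops out. -/
theorem card_filter_odd_one_add {m : ℕ} (e : Fin m → ℕ) (he : ∀ a b, e a ≠ 0 → e b ≠ 0 → a = b) :
    (Finset.univ.filter fun a => Odd (1 + e a)).card =
      if m ≡ m + ∑ a, e a [MOD 2] then m else m - 1 := by
  have hmod : m ≡ m + ∑ a, e a [MOD 2] ↔ Even (∑ a, e a) := by
    rw [Nat.even_iff, Nat.ModEq]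
    omega
  have hsum : ∀ a, e a ≠ 0 → ∑ b, e b = e a := fun a ha =>
    Finset.sum_eq_single a (fun b _ hb => not_not.mp fun h => hb (he b a h ha)) (by simp)
  split_ifs with h
  · rw [hmod] at h
    rw [Finset.filter_true_of_mem, Finset.card_univ, Fintype.card_fin]
    intro a _
    rw [Nat.odd_iff]
    by_cases ha : e a = 0
    · rw [ha]
    · rw [hsum a ha, Nat.even_iff] at h
      omega
  · rw [hmod] at h
    obtain ⟨a, ha⟩ : ∃ a, e a ≠ 0 := by
      by_contra! h0
      simp [h0] at h
    rw [hsum a ha, Nat.even_iff] at h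
    have : (Finset.univ.filter fun b => Odd (1 + e b)) = Finset.univ.erase a := by
      ext b
      rw [Finset.mem_filter, Finset.mem_erase, Nat.odd_iff]
      constructor
      · rintro ⟨-, hb⟩
        refine ⟨?_, Finset.mem_univ b⟩
        rintro rfl
        omega
      · rintro ⟨hb, -⟩
        have : e b = 0 := not_not.mp fun h => hb (he b a h ha)
        exact ⟨Finset.mem_univ b, by omega⟩
    rw [this, Finset.card_erase_of_mem (Finset.mem_univ a), Finset.card_univ, Fintype.card_fin]

theorem sum_eq_two_iff {P : Type*} (X : Finset P) (f : P → ℕ) :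
    ∑ S ∈ X, f S = 2 ↔ (∃ S ∈ X, f S = 2 ∧ ∀ T ∈ X, T ≠ S → f T = 0) ∨
      ∃ S₁ ∈ X, ∃ S₂ ∈ X, S₁ ≠ S₂ ∧ f S₁ = 1 ∧ f S₂ = 1 ∧ ∀ T ∈ X, T ≠ S₁ → T ≠ S₂ → f T = 0 := by
  classical
  constructor
  · intro h
    obtain ⟨S, hS, hS0⟩ := Finset.exists_ne_zero_of_sum_ne_zero (s := X) (f := f) (by omega)
    have h1 := Finset.add_sum_erase X f hS
    by_cases h2 : f S = 2
    · have h3 : ∑ T ∈ X.erase S, f T = 0 := by omega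
      rw [Finset.sum_eq_zero_iff] at h3
      exact Or.inl ⟨S, hS, h2, fun T hT hne => h3 T (Finset.mem_erase.mpr ⟨hne, hT⟩)⟩
    · obtain ⟨S₂, hS₂, hS₂0⟩ := Finset.exists_ne_zero_of_sum_ne_zero (s := X.erase S) (f := f)
        (by omega)
      have h3 := Finset.add_sum_erase _ f hS₂
      have h4 : ∑ T ∈ (X.erase S).erase S₂, f T = 0 := by omega
      rw [Finset.sum_eq_zero_iff] at h4
      obtain ⟨hne, hS₂X⟩ := Finset.mem_erase.mp hS₂
      exact Or.inr ⟨S, hS, S₂, hS₂X, hne.symm, by omega, by omega, fun T hT h1 h2 =>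
        h4 T (Finset.mem_erase.mpr ⟨h2, Finset.mem_erase.mpr ⟨h1, hT⟩⟩)⟩
  · rintro (⟨S, hS, h2, h0⟩ | ⟨S₁, h₁, S₂, h₂, hne, e₁, e₂, h0⟩)
    · rw [Finset.sum_eq_single_of_mem S hS h0, h2]
    · rw [← Finset.add_sum_erase X f h₁,
        Finset.sum_eq_single_of_mem S₂ (Finset.mem_erase.mpr ⟨hne.symm, h₂⟩), e₁, e₂]
      intro T hT hT₂
      obtain ⟨hT₁, hTX⟩ := Finset.mem_erase.mp hT
      exact h0 T hTX hT₁ hT₂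

variable {P : Type*} {X : Finset P} {m μ c : P → ℕ}
  {O G : Set P}

theorem sum_eq_zero_iff_of_contribution (hm : ∀ S ∈ X, m S ≠ 0)
    (hc : ∀ S, c S = if m S ≡ μ S [MOD 2] then m S else m S - 1)
    (hO : ∀ S, S ∈ O ↔ S ∈ X ∧ Odd (μ S)) (hG : ∀ S, S ∈ G ↔ S ∈ X ∧ m S ≠ 1) :
    ∑ S ∈ X, c S = 0 ↔ O = ∅ ∧ G = ∅ := by
  rw [Finset.sum_eq_zero_iff, Set.eq_empty_iff_forall_notMem, Set.eq_empty_iff_forall_notMem,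
    ← forall_and]
  refine forall_congr' fun S => ?_
  rw [hO, hG]
  by_cases hS : S ∈ X
  · have := hm S hS
    rw [hc, Nat.odd_iff]
    simp only [hS, true_and, forall_true_left]
    split_ifs with h <;> rw [Nat.ModEq] at h <;> omega
  · simp [hS]

/-- The small values of `c` decode as follows: `0` means `m = 1` and `μ` even, `1` means `m ∈ {1,
2}` and `μ` odd, `2` means `m ∈ {2, 3}` and `μ` even. A sum equal to `2` is one value `2` or two
values `1`. -/
theorem sum_eq_two_iff_of_contribution {Y : Set P} (hXY : ∀ S ∈ X, S ∈ Y) (hm : ∀ S ∈ X, m S ≠ 0)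
    (hc : ∀ S, c S = if m S ≡ μ S [MOD 2] then m S else m S - 1)
    (hO : ∀ S, S ∈ O ↔ S ∈ X ∧ Odd (μ S)) (hG : ∀ S, S ∈ G ↔ S ∈ X ∧ m S ≠ 1) :
    ∑ S ∈ X, c S = 2 ↔ (O = ∅ ∧ ∃ S ∈ Y, (m S = 2 ∨ m S = 3) ∧ G = {S}) ∨
      ∃ S₁ ∈ Y, ∃ S₂ ∈ Y, S₁ ≠ S₂ ∧ O = {S₁, S₂} ∧ (m S₁ = 1 ∨ m S₁ = 2) ∧ (m S₂ = 1 ∨ m S₂ = 2) ∧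
        G ⊆ {S₁, S₂} := by
  have h0 : ∀ S ∈ X, c S = 0 ↔ m S = 1 ∧ ¬ Odd (μ S) := by
    intro S hS
    have := hm S hS
    rw [hc, Nat.odd_iff]
    split_ifs with h <;> rw [Nat.ModEq] at h <;> omega
  have h1 : ∀ S ∈ X, c S = 1 ↔ (m S = 1 ∨ m S = 2) ∧ Odd (μ S) := by
    intro S hS
    have := hm S hS
    rw [hc, Nat.odd_iff]
    split_ifs with h <;> rw [Nat.ModEq] at h <;> omega
  have h2 : ∀ S ∈ X, c S = 2 ↔ (m S = 2 ∨ m S = 3) ∧ ¬ Odd (μ S) := by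
    intro S hS
    have := hm S hS
    rw [hc, Nat.odd_iff]
    split_ifs with h <;> rw [Nat.ModEq] at h <;> omega
  rw [sum_eq_two_iff]
  refine or_congr ?_ ?_
  · constructor
    · rintro ⟨S, hS, hS2, hT⟩
      rw [h2 S hS] at hS2
      refine ⟨Set.eq_empty_of_forall_notMem fun T hTO => ?_, S, hXY S hS, hS2.1, ?_⟩
      · obtain ⟨hTX, hodd⟩ := (hO T).mp hTO
        by_cases h : T = S
        · exact hS2.2 (h ▸ hodd)
        · exact ((h0 T hTX).mp (hT T hTX h)).2 hodd
      · ext T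
        rw [hG, Set.mem_singleton_iff]
        constructor
        · rintro ⟨hTX, hT1⟩
          by_contra h
          exact hT1 ((h0 T hTX).mp (hT T hTX h)).1
        · rintro rfl
          exact ⟨hS, by omega⟩
    · rintro ⟨hOe, S, -, hmS, hGS⟩
      have hS : S ∈ X := ((hG S).mp (by rw [hGS]; rfl)).1
      have hodd : ∀ T ∈ X, ¬ Odd (μ T) := fun T hT h => by
        have : T ∈ O := (hO T).mpr ⟨hT, h⟩
        rw [hOe] at this
        exact this
      refine ⟨S, hS, (h2 S hS).mpr ⟨hmS, hodd S hS⟩, fun T hT hne => (h0 T hT).mpr ⟨?_, hodd T hT⟩⟩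
      by_contra h
      have : T ∈ G := (hG T).mpr ⟨hT, h⟩
      rw [hGS] at this
      exact hne this
  · constructor
    · rintro ⟨S₁, hS₁, S₂, hS₂, hne, e₁, e₂, hT⟩
      rw [h1 _ hS₁] at e₁
      rw [h1 _ hS₂] at e₂
      refine ⟨S₁, hXY _ hS₁, S₂, hXY _ hS₂, hne, ?_, e₁.1, e₂.1, ?_⟩
      · ext T
        rw [hO, Set.mem_insert_iff, Set.mem_singleton_iff]
        constructor
        · rintro ⟨hTX, hodd⟩
          by_contra! h
          exact ((h0 T hTX).mp (hT T hTX h.1 h.2)).2 hodd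
        · rintro (rfl | rfl)
          exacts [⟨hS₁, e₁.2⟩, ⟨hS₂, e₂.2⟩]
      · intro T hTG
        obtain ⟨hTX, hT1⟩ := (hG T).mp hTG
        rw [Set.mem_insert_iff, Set.mem_singleton_iff]
        by_contra! h
        exact hT1 ((h0 T hTX).mp (hT T hTX h.1 h.2)).1
    · rintro ⟨S₁, -, S₂, -, hne, hOe, e₁, e₂, hGS⟩
      obtain ⟨hS₁, o₁⟩ := (hO S₁).mp (by rw [hOe]; exact Or.inl rfl)
      obtain ⟨hS₂, o₂⟩ := (hO S₂).mp (by rw [hOe]; exact Or.inr rfl)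
      refine ⟨S₁, hS₁, S₂, hS₂, hne, (h1 _ hS₁).mpr ⟨e₁, o₁⟩, (h1 _ hS₂).mpr ⟨e₂, o₂⟩,
        fun T hT hn₁ hn₂ => (h0 T hT).mpr ⟨?_, fun hodd => ?_⟩⟩
      · by_contra h
        rcases hGS ((hG T).mpr ⟨hT, h⟩) with h | h
        exacts [hn₁ h, hn₂ h]
      · have : T ∈ O := (hO T).mpr ⟨hT, hodd⟩
        rw [hOe] at this
        rcases this with h | h
        exacts [hn₁ h, hn₂ h]

end Counting

end PlaneCurves

namespace PlaneCurves

/-! ### Passage to the whole curve. -/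

section Global

variable {k K : Type*} [Field k] [Field K] [Algebra k K]

theorem exists_rep_ne_zero (S : ℙ K (Fin 3 → K)) : ∃ i, S.rep i ≠ 0 := by
  by_contra! h
  exact S.rep_nonzero (funext h)

theorem eq_of_rep_div_eq {S S' : ℙ K (Fin 3 → K)} {i : Fin 3} (hi : S.rep i ≠ 0) (hi' : S'.rep i ≠ 0)
    (h : ∀ j, S.rep j / S.rep i = S'.rep j / S'.rep i) : S = S' := by
  rw [← S.mk_rep, ← S'.mk_rep, Projectivization.mk_eq_mk_iff']
  refine ⟨S.rep i / S'.rep i, funext fun j => ?_⟩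
  rw [Pi.smul_apply, smul_eq_mul, div_mul_eq_mul_div, div_eq_iff hi']
  have := h j
  rw [div_eq_div_iff hi hi'] at this
  rw [this, mul_comm]

namespace PlaneCurve

variable (D D' : PlaneCurve k)

theorem isHomogeneous_formOver : (D.formOver K).IsHomogeneous D.degree :=
  D.isHomogeneous.map _

theorem formOver_ne_zero : D.formOver K ≠ 0 := fun h =>
  D.squarefree.ne_zero (MvPolynomial.map_injective _ (algebraMap k K).injective
    (h.trans (map_zero _).symm))

variable {D D'}

theorem mem_points_iff {S : ℙ K (Fin 3 → K)} :
    S ∈ D.points K ↔ MvPolynomial.aeval S.rep D.form = 0 := by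
  rw [points, Set.mem_ofPred_eq, formOver, MvPolynomial.eval_map, MvPolynomial.aeval_def]

theorem evalAt_dehomogenize_eq_zero_iff {S : ℙ K (Fin 3 → K)} {i : Fin 3} (hi : S.rep i ≠ 0) :
    evalAt k S.rep (dehomogenize k hi D.form) = 0 ↔ S ∈ D.points K := by
  rw [mem_points_iff, evalAt_dehomogenize, aeval_eq_pow_mul hi D.isHomogeneous, mul_eq_zero,
    or_iff_right (pow_ne_zero _ hi)]

theorem curveIdeal_eq_top {S : ℙ K (Fin 3 → K)} (hS : S ∉ D.points K) :
    curveIdeal D.form S.rep = ⊤ := by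
  obtain ⟨i, hi⟩ := exists_rep_ne_zero S
  rw [curveIdeal_eq_span hi D.isHomogeneous, Ideal.span_singleton_eq_top]
  exact isUnit_of_evalAt_ne_zero fun h => hS ((evalAt_dehomogenize_eq_zero_iff hi).mp h)

theorem finite_points_inter (hrel : IsRelPrime D.form D'.form) :
    (D.points K ∩ D'.points K).Finite := by
  have h : D.points K ∩ D'.points K =
      ⋃ i, {S | S ∈ D.points K ∩ D'.points K ∧ S.rep i ≠ 0} := by
    ext S
    rw [Set.mem_iUnion]
    obtain ⟨i, hi⟩ := exists_rep_ne_zero S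
    exact ⟨fun hS => ⟨i, hS, hi⟩, fun ⟨_, hS, _⟩ => hS⟩
  rw [h]
  refine Set.finite_iUnion fun i => ?_
  obtain ⟨Z, hZ, hZ'⟩ := exists_finite_coordinates (K := K) i D.isHomogeneous D'.isHomogeneous
    D.squarefree.ne_zero hrel
  refine Set.Finite.of_finite_image (f := fun S j => S.rep j / S.rep i)
    ((Set.Finite.pi' fun _ => hZ).subset ?_) ?_
  · rintro _ ⟨S, ⟨⟨hS, hS'⟩, hi⟩, rfl⟩ j
    exact hZ' _ hi (mem_points_iff.mp hS) (mem_points_iff.mp hS') j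
  · rintro S ⟨-, hi⟩ S' ⟨-, hi'⟩ h
    exact eq_of_rep_div_eq hi hi' (congrFun h)

/-- The base lies on `D` because the equation of `D` is zero in the normalised ring. Off `D'` the
local equation is a unit, and the length `0` is even. -/
theorem base_mem_points_of_odd {T : D.NormalizationPoint K} (hT : T ∈ D.oddBranches K D') :
    T.base ∈ D.points K ∩ D'.points K := by
  obtain ⟨i, hi⟩ := exists_rep_ne_zero T.base
  constructor
  · rw [← evalAt_dehomogenize_eq_zero_iff hi, ← T.hom_toNormalized,
      toNormalized_eq_zero (dehomogenize_mem_curveIdeal hi D.isHomogeneous), map_zero]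
  · by_contra h
    have h0 : T.mu D' = 0 := by
      rw [NormalizationPoint.mu, curveIdeal_eq_top h, Ideal.map_top]
      have : Subsingleton (T.LocalRing ⧸ (⊤ : Ideal T.LocalRing)) := Ideal.Quotient.subsingleton_iff.mpr rfl
      rw [Module.length_eq_zero]
      rfl
    rw [oddBranches, Set.mem_ofPred_eq, h0] at hT
    exact absurd hT (by decide)

theorem mem_points_of_odd {S : ℙ K (Fin 3 → K)} (hS : S ∈ D.oddPoints K D') : S ∈ D'.points K := by
  by_contra h
  have hn : S ∉ D'.points K := h
  have h0 : D.mu D' S = 0 := by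
    have htop : curveIdeal (D'.formOver K) S.rep = ⊤ := by
      obtain ⟨i, hi⟩ := exists_rep_ne_zero S
      rw [curveIdeal_eq_span hi D'.isHomogeneous_formOver, Ideal.span_singleton_eq_top]
      refine isUnit_of_evalAt_ne_zero fun h => hn ?_
      rw [points, Set.mem_ofPred_eq, ← MvPolynomial.coe_aeval_eq_eval]
      change MvPolynomial.aeval S.rep _ = 0
      rw [aeval_eq_pow_mul hi D'.isHomogeneous_formOver, ← evalAt_dehomogenize hi, h, mul_zero]
    rw [mu, intersectionMultiplicity, htop, Ideal.map_top]
    have : Subsingleton (CurveLocalRing (D.formOver K) S.rep ⧸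
      (⊤ : Ideal (CurveLocalRing (D.formOver K) S.rep))) := Ideal.Quotient.subsingleton_iff.mpr rfl
    rw [Module.length_eq_zero]
    rfl
  rw [oddPoints, Set.mem_ofPred_eq, h0] at hS
  exact absurd hS.2 (by decide)

theorem mult_ne_zero {S : ℙ K (Fin 3 → K)} (hS : S ∈ D.points K) : D.mult S ≠ 0 :=
  multiplicityAt_ne_zero D.formOver_ne_zero hS

theorem mem_singularPoints_iff {S : ℙ K (Fin 3 → K)} (hS : S ∈ D.points K) :
    S ∈ D.singularPoints K ↔ D.mult S ≠ 1 := by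
  constructor
  · rintro ⟨-, h⟩ h1
    obtain ⟨j, hj⟩ := exists_pderiv_ne_zero_of_multiplicityAt_eq_one h1
    exact hj (h j)
  · intro h1
    refine ⟨hS, ?_⟩
    by_contra! h
    exact h1 (multiplicityAt_eq_one hS h)

/-- The number of points over `S` at which the intersection multiplicity is odd. -/
theorem ncard_fibre [IsAlgClosed K] (hrel : IsRelPrime D.form D'.form) (hsmooth : D'.IsSmooth K)
    (hord : ∀ S ∈ D.singularPoints K ∩ D'.points K, IsOrdinaryAt (D.formOver K) S.rep)
    {S : ℙ K (Fin 3 → K)} (hS : S ∈ D.points K) (hS' : S ∈ D'.points K) :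
    {T | T ∈ D.oddBranches K D' ∧ T.base = S}.Finite ∧
      {T | T ∈ D.oddBranches K D' ∧ T.base = S}.ncard = D.contribution D' S := by
  have : Infinite K := IsAlgClosed.instInfinite
  obtain ⟨i, hi⟩ := exists_rep_ne_zero S
  have hordS : IsOrdinaryAt (D.formOver K) S.rep := by
    by_cases h : S ∈ D.singularPoints K
    · exact hord S ⟨h, hS'⟩
    · refine isOrdinaryAt_of_smooth D.isHomogeneous_formOver hS ?_
      by_contra! h0
      exact h ⟨hS, h0⟩
  have hs' : ∃ j, MvPolynomial.eval S.rep (MvPolynomial.pderiv j (D'.formOver K)) ≠ 0 := by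
    by_contra! h
    have : S ∈ D'.singularPoints K := ⟨hS', h⟩
    rw [hsmooth] at this
    exact this
  obtain ⟨v, w, c, l, hA⟩ := exists_isAdapted D.isHomogeneous_formOver D'.isHomogeneous_formOver
    D.formOver_ne_zero hi hS hS' hordS hs'
  obtain ⟨B⟩ := hA.nonempty_branches
  obtain ⟨B'⟩ := hA.nonempty_branches'
  have hmu : D.mu D' S = D.mult S + _ :=
    intersectionMultiplicity_eq hi D.isHomogeneous_formOver D'.isHomogeneous_formOver hA B B'
      (series_ne_series hi D.isHomogeneous D'.isHomogeneous D.squarefree.ne_zero hrel hA.toIsFrame B B')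
  obtain ⟨T, hT, hbase, hTmu⟩ := exists_points_of_isAdapted hrel S hi hA B B'
  have hset : {T | T ∈ D.oddBranches K D' ∧ T.base = S} =
      T '' ↑(Finset.univ.filter fun a => Odd (1 + (B.series a - B'.series 0).order.toNat)) := by
    ext T'
    simp only [Set.mem_ofPred_eq, Finset.coe_filter, Finset.mem_univ, true_and, Set.mem_image, hbase,
      oddBranches]
    constructor
    · rintro ⟨h, a, rfl⟩
      exact ⟨a, hTmu a ▸ h, rfl⟩
    · rintro ⟨a, h, rfl⟩
      exact ⟨(hTmu a).symm ▸ h, a, rfl⟩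
  rw [hset]
  refine ⟨(Finset.finite_toSet _).image T, ?_⟩
  rw [Set.ncard_image_of_injective _ hT, Set.ncard_coe_finset, card_filter_odd_one_add, contribution, hmu]
  · rfl
  -- Two branches with positive contact both have the slope of `C'` at `S`.
  · exact fun a b ha hb => B.slope_injective ((slope_eq_of_order_ne_zero B B' ha).trans
      (slope_eq_of_order_ne_zero B B' hb).symm)

end PlaneCurve

end Global

end PlaneCurves

theorem proposition5p9 {k K : Type*} [Field k] [Field K] [Algebra k K] [IsAlgClosure k K]
    (h2 : (2 : k) ≠ 0)
    (C C' : PlaneCurves.PlaneCurve k)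
    (hcommon : IsRelPrime C.form C'.form)
    (hsmooth : C'.IsSmooth K)
    (hord : ∀ S ∈ C.singularPoints K ∩ C'.points K,
      PlaneCurves.IsOrdinaryAt (C.formOver K) S.rep) :
    ((C.points K ∩ C'.points K).Finite ∧ (C.oddBranches K C').Finite ∧
      (C.oddBranches K C').ncard = ∑ᶠ S ∈ C.points K ∩ C'.points K, C.contribution C' S) ∧
    (C.IsGeometricallyIntegral K → C'.IsGeometricallyIntegral K →
      (C.oddBranches K C' = ∅ ↔
        C.oddPoints K C' = ∅ ∧ C.singularPoints K ∩ C'.points K = ∅) ∧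
      ((C.oddBranches K C').ncard = 2 ↔
        (C.oddPoints K C' = ∅ ∧ ∃ S ∈ C.points K, (C.mult S = 2 ∨ C.mult S = 3) ∧
          C.singularPoints K ∩ C'.points K = {S}) ∨
        (∃ S₁ ∈ C.points K, ∃ S₂ ∈ C.points K, S₁ ≠ S₂ ∧ C.oddPoints K C' = {S₁, S₂} ∧
          (C.mult S₁ = 1 ∨ C.mult S₁ = 2) ∧ (C.mult S₂ = 1 ∨ C.mult S₂ = 2) ∧
          C.singularPoints K ∩ C'.points K ⊆ {S₁, S₂}))) := by
  have : IsAlgClosed K := IsAlgClosure.isAlgClosed k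
  classical
  have hfin := PlaneCurves.PlaneCurve.finite_points_inter (K := K) hcommon
  have hfib := fun S (hS : S ∈ C.points K ∩ C'.points K) =>
    PlaneCurves.PlaneCurve.ncard_fibre hcommon hsmooth hord hS.1 hS.2
  have hUnion : C.oddBranches K C' =
      ⋃ S ∈ C.points K ∩ C'.points K, {T | T ∈ C.oddBranches K C' ∧ T.base = S} := by
    ext T
    simp only [Set.mem_iUnion, Set.mem_ofPred_eq, exists_prop]
    exact ⟨fun hT => ⟨_, PlaneCurves.PlaneCurve.base_mem_points_of_odd hT, hT, rfl⟩,
      fun ⟨_, _, hT, _⟩ => hT⟩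
  have hbfin : (C.oddBranches K C').Finite := by
    rw [hUnion]
    exact hfin.biUnion fun S hS => (hfib S hS).1
  have hX : ∀ S, S ∈ hfin.toFinset ↔ S ∈ C.points K ∩ C'.points K := fun S => hfin.mem_toFinset
  -- The odd points of the normalisation are counted in the fibres over the finite set of
  -- intersection points.
  have hcard : (C.oddBranches K C').ncard = ∑ S ∈ hfin.toFinset, C.contribution C' S := by
    rw [Set.ncard_eq_toFinset_card _ hbfin,
      Finset.card_eq_sum_card_fiberwise (f := fun T => T.base) (t := hfin.toFinset) fun T hT => by
        have hT' := hbfin.mem_toFinset.mp hT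
        exact (hX _).mpr (PlaneCurves.PlaneCurve.base_mem_points_of_odd hT')]
    refine Finset.sum_congr rfl fun S hS => ?_
    rw [← (hfib S ((hX S).mp hS)).2, ← Set.ncard_coe_finset]
    congr 1
    ext T
    simp
  have hO : ∀ S, S ∈ C.oddPoints K C' ↔ S ∈ hfin.toFinset ∧ Odd (C.mu C' S) := fun S => by
    rw [hX]
    exact ⟨fun h => ⟨⟨h.1, PlaneCurves.PlaneCurve.mem_points_of_odd h⟩, h.2⟩, fun h => ⟨h.1.1, h.2⟩⟩
  have hG : ∀ S, S ∈ C.singularPoints K ∩ C'.points K ↔ S ∈ hfin.toFinset ∧ C.mult S ≠ 1 := fun S => by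
    rw [hX]
    constructor
    · rintro ⟨h, h'⟩
      exact ⟨⟨h.1, h'⟩, (PlaneCurves.PlaneCurve.mem_singularPoints_iff h.1).mp h⟩
    · rintro ⟨⟨h, h'⟩, h1⟩
      exact ⟨(PlaneCurves.PlaneCurve.mem_singularPoints_iff h).mpr h1, h'⟩
  have hm : ∀ S ∈ hfin.toFinset, C.mult S ≠ 0 := fun S hS =>
    PlaneCurves.PlaneCurve.mult_ne_zero ((hX S).mp hS).1
  refine ⟨⟨hfin, hbfin, ?_⟩, fun _ _ => ⟨?_, ?_⟩⟩
  · rw [hcard, finsum_mem_eq_finite_toFinset_sum _ hfin]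
  · rw [← Set.ncard_eq_zero hbfin, hcard]
    exact PlaneCurves.sum_eq_zero_iff_of_contribution hm (fun _ => rfl) hO hG
  · rw [hcard]
    exact PlaneCurves.sum_eq_two_iff_of_contribution (fun S hS => ((hX S).mp hS).1) hm (fun _ => rfl) hO hG
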